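/- **Models.** Let $1\le k\le n$ be integers, $q\in(0,1/2]$ and $\lambda\in[0,1-q]$. For a symmetric matrix $\Theta\in\mathbb R^{n\times n}$ and a random latent assignment $z\in[n]^n$, let the edge indicators $Y^\star_{ij}$, $1\le i<j\le n$, be independent conditionally on $z$, with $\mathbb P[Y^\star_{ij}=1\mid z]=q+\Theta_{z_iz_j}$, and let $Y_{ij}=Y_{ji}=Y^\star_{ij}-q$. Write $\mathbb P,\mathbb E$ for the resulting probability and expectation. The matrix $\Theta$ is one of * (HS) $\Theta_{ij}=\lambda\mathbf 1\{i\le k\}\mathbf 1\{j\le k\}$; * (SBM) $\Theta_{ij}=\lambda\mathbf 1\{\lceil i/k\rceil=\lceil j/k\rceil\}$, where $k$ divides $n$; * (TS) $\Theta_{ij}=\lambda\mathbf 1\{|i-j|\le k/2\}$, where $k$ is even; and $z$ is either uniform on $[n]^n$ (models HS-I, SBM-I, TS-I) or a uniform random permutation of $[n]$ (models HS-P, SBM-P, TS-P). **Basis.** Let $\mathcal G_{\le D}$ be a set consisting of exactly one representative of each isomorphism class of finite simple graphs $G=(V,E)$ without isolated vertices and with $1\le|E|\le D$. For $G\in\mathcal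 G_{\le D}$ with connected components $G_1,\dots,G_c$, let $\Pi_V$ be the set of injective maps $\pi:V\to[n]$, and for a graph $H$ whose vertices are labeled by $\pi$ put $P_{H,\pi}=\prod_{\{u,v\}\in E(H)}Y_{\pi(u)\pi(v)}$. Define $$\overline P_G=\sum_{\pi\in\Pi_V}\prod_{l=1}^c\bigl(P_{G_l,\pi}-\mathbb E[P_{G_l,\pi}]\bigr),\qquad \mathbb V(G)=\frac{n!}{(n-|V|)!}\,|\mathrm{Aut}(G)|\,\bigl(q(1-q)\bigr)^{|E|},\qquad \Psi_G=\frac{\overline P_G}{\sqrt{\mathbb V(G)}}.$$ **Theorem.** There exist positive numerical constants $c_0$ and $c$ such that the following holds for every integer $D\ge2$ and for all six models. If $$\Bigl(\frac kn\Bigr)\vee\Bigl(\frac{\lambda k}{\sqrt{nq}}\Bigr)\vee\Bigl(\frac\lambda q\Bigr)\le D^{-c_0},$$ then, for every real vector $\alpha=(\alpha_\emptyset,(\alpha_G)_{G\in\mathcal G_{\le D}})$, with $\|\alpha\|_2^2=\alpha_\emptyset^2+\sum_{G\in\mathcal G_{\le D}}\alpha_G^2$, $$(1-cD^{-2})\|\alpha\|_2^2\le\mathbb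 E\Bigl[\Bigl(\alpha_\emptyset+\sum_{G\in\mathcal G_{\le D}}\alpha_G\Psi_G\Bigr)^2\Bigr]\le(1+cD^{-2})\|\alpha\|_2^2 .$$ -/

import Mathlib

open MeasureTheory ProbabilityTheory

namespace LatentGraph

noncomputable section

/-- The three planted structures: hidden subclique, stochastic block model, Toeplitz seriation. -/
inductive Planted
  | HS
  | SBM
  | TS

/-- The two sampling schemes for the latent assignment: independent and permutation sampling. -/
inductive Sampling
  | independent
  | permutation

/-- The divisibility convention of each planted structure: `n / k` is an integer for the stochastic
block model, and `k` is even for Toeplitz seriation. -/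
def Planted.Admissible (n k : ℕ) : Planted → Prop
  | .HS => True
  | .SBM => k ∣ n
  | .TS => Even k

/-- The support of the signal matrix. The label `ℓ ∈ {1, …, n}` is represented by the element of
`Fin n` of value `ℓ - 1`, so that `ℓ ≤ k` reads `i < k`, the block number `⌈ℓ / k⌉` equals
`i / k + 1`, and differences of labels are unchanged. -/
def Planted.Linked {n : ℕ} (k : ℕ) (M : Planted) (i j : Fin n) : Prop :=
  match M with
  | .HS => (i : ℕ) < k ∧ (j : ℕ) < k
  | .SBM => (i : ℕ) / k = (j : ℕ) / k
  | .TS => |((i : ℕ) : ℝ) - ((j : ℕ) : ℝ)| ≤ (k : ℝ) / 2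

open Classical in
/-- The signal matrix `Θ`, with entries `λ` on its support and `0` elsewhere. -/
def theta {n : ℕ} (M : Planted) (k : ℕ) (lam : ℝ) (i j : Fin n) : ℝ :=
  if M.Linked k i j then lam else 0

theorem theta_symm {n : ℕ} (M : Planted) (k : ℕ) (lam : ℝ) (i j : Fin n) :
    theta M k lam i j = theta M k lam j i := by
  classical
  have h : M.Linked k i j ↔ M.Linked k j i := by
    cases M
    · exact and_comm
    · exact eq_comm
    · simp only [Planted.Linked, abs_sub_comm]
  exact if_congr h rfl rfl

/-- The unordered pairs of distinct nodes of `{1, …, n}`. -/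
abbrev Pair (n : ℕ) : Type := {e : Sym2 (Fin n) // ¬ e.IsDiag}

/-- The observed graph `Y⋆`, as the indicator of its edges. -/
abbrev Obs (n : ℕ) : Type := Pair n → Bool

/-- `Θ_{z_i z_j}` for the pair `{i, j}`. -/
def pairTheta {n : ℕ} (M : Planted) (k : ℕ) (lam : ℝ) (z : Fin n → Fin n) (e : Pair n) : ℝ :=
  Sym2.lift ⟨fun i j => theta M k lam (z i) (z j), fun _ _ => theta_symm M k lam _ _⟩ e.1

/-- The law of the latent assignment `z`: uniform on all maps from nodes to labels (independent
uniform labels), or uniform on the permutations. -/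
def latentLaw (n : ℕ) : Sampling → Measure (Fin n → Fin n)
  | .independent => uniformOn Set.univ
  | .permutation => uniformOn {z | Function.Bijective z}

/-- The law of `Y⋆` given `z`: independent Bernoulli variables of parameters `q + Θ_{z_i z_j}`.
The projection onto `[0, 1]` does nothing as soon as `0 ≤ q`, `0 ≤ λ` and `q + λ ≤ 1`. -/
def condLaw {n : ℕ} (M : Planted) (k : ℕ) (lam q : ℝ) (z : Fin n → Fin n) : Measure (Obs n) :=
  Measure.pi fun e =>
    bernoulliMeasure true false (Set.projIcc (0 : ℝ) 1 zero_le_one (q + pairTheta M k lam z e))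

/-- The law `ℙ` of the observed graph `Y⋆`. -/
def obsLaw (M : Planted) (S : Sampling) (n k : ℕ) (lam q : ℝ) : Measure (Obs n) :=
  (latentLaw n S).bind (condLaw M k lam q)

/-- The centered adjacency `Y_{ij} = Y⋆_{ij} - q`. -/
def centered {n : ℕ} (q : ℝ) (y : Obs n) (e : Pair n) : ℝ :=
  (if y e then 1 else 0) - q

/-- The image of an edge of `G` by an injective labeling of its vertices. -/
def imagePair {V : Type} {n : ℕ} (G : SimpleGraph V) (p : V ↪ Fin n) (e : G.edgeSet) : Pair n :=
  ⟨Sym2.map p e.1, by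
    rw [Sym2.isDiag_map p.injective]
    exact G.not_isDiag_of_mem_edgeSet e.2⟩

open Classical in
/-- The monomial `P_{G,π}(Y) = ∏_{(u,v) ∈ E} Y_{π(u) π(v)}`. -/
def monomial {V : Type} [Fintype V] {n : ℕ} (q : ℝ) (G : SimpleGraph V) (p : V ↪ Fin n)
    (y : Obs n) : ℝ :=
  ∏ e : G.edgeSet, centered q y (imagePair G p e)

open Classical in
/-- The corrected monomial: the product, over the connected components `C` of `G`, of the
monomial of `C` minus its expectation under `ℙ`. -/
def correctedMonomial {V : Type} [Fintype V] (M : Planted) (S : Sampling) {n : ℕ} (k : ℕ)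
    (lam q : ℝ) (G : SimpleGraph V) (p : V ↪ Fin n) (y : Obs n) : ℝ :=
  ∏ C : G.ConnectedComponent,
    (monomial q C.toSimpleGraph ((Function.Embedding.subtype (· ∈ C)).trans p) y
      - ∫ y', monomial q C.toSimpleGraph ((Function.Embedding.subtype (· ∈ C)).trans p) y'
          ∂(obsLaw M S n k lam q))

/-- A template: a finite nonempty simple graph without isolated vertex. -/
structure Template where
  /-- the number of vertices -/
  order : ℕ
  order_pos : 0 < order
  graph : SimpleGraph (Fin order)
  no_isolated : ∀ v, ¬ graph.IsIsolated v

/-- The number of edges of a template. -/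
def Template.size (G : Template) : ℕ := G.graph.edgeSet.ncard

/-- `𝒢` is a maximum collection of pairwise non-isomorphic templates with at most `D` edges:
it contains exactly one representative of each isomorphism class. -/
structure IsTemplateCollection (D : ℕ) (𝒢 : Finset Template) : Prop where
  size_le : ∀ G ∈ 𝒢, G.size ≤ D
  eq_of_iso : ∀ G ∈ 𝒢, ∀ H ∈ 𝒢, Nonempty (G.graph ≃g H.graph) → G = H
  exists_iso : ∀ H : Template, H.size ≤ D → ∃ G ∈ 𝒢, Nonempty (G.graph ≃g H.graph)

/-- The variance proxy `𝕍(G) = n! / (n - |V|)! · |Aut(G)| · (q (1 - q))^{|E|}`. -/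
def varianceProxy (n : ℕ) (q : ℝ) (G : Template) : ℝ :=
  (n.descFactorial G.order : ℝ) * (Nat.card (G.graph ≃g G.graph) : ℝ) * (q * (1 - q)) ^ G.size

/-- The normalized invariant polynomial `Ψ_G = 𝕍(G)^{-1/2} ∑_π \overline{P}_{G,π}`, the sum being
over all injective labelings `π` of the vertices of `G`. -/
def Psi (M : Planted) (S : Sampling) (n k : ℕ) (lam q : ℝ) (G : Template) (y : Obs n) : ℝ :=
  (∑ p : Fin G.order ↪ Fin n, correctedMonomial M S k lam q G.graph p y)
    / √(varianceProxy n q G)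

end

end LatentGraph

/-!
The polynomials `Ψ_G` are combinations of the corrected monomials of labelled graphs, a labelled
graph being the image of a template by a labeling of its vertices. The normalization by `𝕍(G)` is
such that this change of family is an isometry on coefficients (`sum_labelledCoeff_sq`): a labelled
graph comes from one template only, and from as many labelings as there are automorphisms. It is
thus enough that the Gram matrix of the corrected monomials of labelled graphs with at most `D`
edges, normalized by `(q (1 - q))^(|E| / 2)`, is close to the identity
(`near_orthonormal_corrected`).

Let `𝒮 ≠ 𝒯` be two labelled graphs, `f` the number of edges in exactly one of them and `u` the
number of vertices in exactly one of them. The entry of the Gram matrix is at most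
`8 w^f n^(-u/2)`, where `w = D^(-20)` (`abs_sum_overlapTerm_le`). In the weighted Schur test
(`abs_sum_mul_mul_le`) with weights `n^(-|V|/2)`, the factor `n^(-u/2)` compensates for the number
of choices of the vertices of `𝒯` outside `𝒮`. What remains is a sum over nonempty sets of edges on
`O(D)` vertices, with a price `w` for each edge (`sum_edgeSets_le`), and this is `O(D² w)`.

The bound on an entry comes from three facts.

* Only the components which share a vertex with the other graph are expanded
  (`integral_corrected_mul`). Given the latent assignment, the edges are independent, so that an
  edge of one graph only contributes its weight `Θ ≤ λ`, and a shared one about `q (1 - q)`.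
* Revealing the labels one at a time, each vertex of one graph only, in a component touching the
  other graph, is linked to an already revealed one, which has probability at most `2 k / n`
  (`EdgeWeight.expect_prod_le`). The assumption on `λ k / √(n q)` turns this into `n^(-1/2)`.
* The components which touch nothing stay centered. For independent labels they make the entry
  vanish. A random permutation, restricted to a few vertices, is a random function conditioned on
  being injective; by inclusion-exclusion on the collisions, a centered component contributes only
  if it collides with something else (`ind_sep_eq`). A cluster of `r ≥ 2` colliding components has
  probability `O(n^(-(r-1)))`, hence a gain `n^(-1/2)` for each component (`abs_expect_sep_le`),
  which is what its first vertex needs.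
-/

set_option linter.unusedSectionVars false

open scoped BigOperators

namespace LatentGraph

/-! ### Averages over random labels and edge weights -/

section Elementary

lemma one_add_pow_le {x : ℝ} (hx : 0 ≤ x) (k : ℕ) (hk : 2 * (k * x) ≤ 1) :
    (1 + x) ^ k ≤ 1 + 2 * (k * x) := by
  induction k with
  | zero => simp
  | succ k ih =>
    push_cast at hk ⊢
    have h1 : 2 * (k * x) ≤ 1 := by nlinarith
    calc (1 + x) ^ (k + 1) = (1 + x) ^ k * (1 + x) := pow_succ _ _
      _ ≤ (1 + 2 * (k * x)) * (1 + x) := mul_le_mul_of_nonneg_right (ih h1) (by linarith)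
      _ ≤ 1 + 2 * ((k + 1) * x) := by nlinarith [mul_le_mul_of_nonneg_right h1 hx]

lemma sum_powerset_pow {α : Type*} (s : Finset α) (x : ℝ) :
    ∑ A ∈ s.powerset, x ^ A.card = (1 + x) ^ s.card := by
  rw [add_comm, ← Finset.sum_pow_mul_eq_add_pow]
  simp

open Classical in
/-- The real-valued indicator of a proposition. -/
noncomputable def ind (P : Prop) : ℝ := if P then 1 else 0

lemma ind_true {P : Prop} (h : P) : ind P = 1 := if_pos h

lemma ind_false {P : Prop} (h : ¬ P) : ind P = 0 := if_neg h

lemma ind_nonneg (P : Prop) : 0 ≤ ind P := by unfold ind; split_ifs <;> norm_num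

lemma ind_le_one (P : Prop) : ind P ≤ 1 := by unfold ind; split_ifs <;> norm_num

lemma ind_mono {P Q : Prop} (h : P → Q) : ind P ≤ ind Q := by
  by_cases hP : P
  · rw [ind_true hP, ind_true (h hP)]
  · rw [ind_false hP]; exact ind_nonneg _

end Elementary

section Expectation

lemma dependsOn_ind {ι κ : Type*} {P : (ι → κ) → Prop} {s : Set ι} (h : DependsOn P s) :
    DependsOn (fun z => ind (P z)) s :=
  fun _ _ hz => congrArg ind (h hz)

lemma _root_.DependsOn.mul {ι κ : Type*} {f g : (ι → κ) → ℝ} {s : Set ι} (hf : DependsOn f s)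
    (hg : DependsOn g s) : DependsOn (fun z => f z * g z) s :=
  fun _ _ h => congrArg₂ (· * ·) (hf h) (hg h)

lemma _root_.DependsOn.abs {ι κ : Type*} {f : (ι → κ) → ℝ} {s : Set ι} (hf : DependsOn f s) :
    DependsOn (fun z => |f z|) s :=
  fun _ _ h => congrArg _ (hf h)

lemma _root_.DependsOn.prod {ι κ : Type*} {J : Type*} {I : Finset J} {f : J → (ι → κ) → ℝ}
    {s : Set ι} (hf : ∀ i ∈ I, DependsOn (f i) s) : DependsOn (fun z => ∏ i ∈ I, f i z) s :=
  fun _ _ h => Finset.prod_congr rfl fun i hi => hf i hi h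

variable {ι κ : Type*} [Fintype ι] [DecidableEq ι] [Fintype κ] [Nonempty κ]

/-- Resampling one coordinate does not change an average over all functions. -/
lemma expect_update (f : (ι → κ) → ℝ) (u : ι) :
    𝔼 z : ι → κ, 𝔼 x : κ, f (Function.update z u x) = 𝔼 z, f z := by
  have h1 : 𝔼 z : ι → κ, 𝔼 x : κ, f (Function.update z u x)
      = 𝔼 a : (ι → κ) × κ, f (Function.update a.1 u a.2) := by
    rw [← Finset.univ_product_univ, Finset.expect_product]
  have h2 : 𝔼 z : ι → κ, f z = 𝔼 a : (ι → κ) × κ, f a.1 := by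
    rw [← Finset.univ_product_univ, Finset.expect_product]
    simp
  rw [h1, h2]
  refine Finset.expect_nbij' (fun a => (Function.update a.1 u a.2, a.1 u))
    (fun a => (Function.update a.1 u a.2, a.1 u)) ?_ ?_ ?_ ?_ ?_ <;> simp

/-- Functions of disjoint sets of coordinates are independent. -/
lemma expect_mul_of_dependsOn {f g : (ι → κ) → ℝ} (A : Finset ι)
    (hf : DependsOn f (A : Set ι)) (hg : DependsOn g (A : Set ι)ᶜ) :
    𝔼 z, f z * g z = (𝔼 z, f z) * 𝔼 z, g z := by
  have h1 : (𝔼 z, f z) * 𝔼 z, g z = 𝔼 a : (ι → κ) × (ι → κ), f a.1 * g a.2 := by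
    rw [← Finset.univ_product_univ, Finset.expect_product, Finset.expect_mul_expect]
  have h2 : 𝔼 z, f z * g z = 𝔼 a : (ι → κ) × (ι → κ), f a.1 * g a.1 := by
    rw [← Finset.univ_product_univ, Finset.expect_product]
    simp
  rw [h1, h2]
  symm
  refine Finset.expect_nbij' (fun a => (A.piecewise a.1 a.2, A.piecewise a.2 a.1))
    (fun a => (A.piecewise a.1 a.2, A.piecewise a.2 a.1)) ?_ ?_ ?_ ?_ ?_
  · simp
  · simp
  · intro a _
    ext i <;> by_cases h : i ∈ A <;> simp [h]
  · intro a _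
    ext i <;> by_cases h : i ∈ A <;> simp [h]
  · intro a _
    congr 1
    · exact hf fun i hi => by simp [Finset.mem_coe.1 hi]
    · exact hg fun i hi => by
        have : i ∉ A := fun h => hi (Finset.mem_coe.2 h)
        simp [this]

/-- If resampling the coordinate `u` averages `h` down to at most `c`, then `h` costs at most a
factor `c` against any nonnegative function not depending on `u`. -/
lemma expect_mul_le_of_update {g h : (ι → κ) → ℝ} {c : ℝ} (u : ι)
    (hg : DependsOn g ({u} : Set ι)ᶜ) (hg0 : ∀ z, 0 ≤ g z)
    (hh : ∀ z, 𝔼 x, h (Function.update z u x) ≤ c) :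
    𝔼 z, g z * h z ≤ (𝔼 z, g z) * c := by
  rw [← expect_update _ u, Finset.expect_mul]
  refine Finset.expect_le_expect fun z _ => ?_
  have : ∀ x, g (Function.update z u x) = g z := fun x => hg fun i hi => by
    simp only [Set.mem_compl_iff, Set.mem_singleton_iff] at hi
    simp [hi]
  simp only [this]
  rw [← Finset.mul_expect]
  exact mul_le_mul_of_nonneg_left (hh z) (hg0 z)

lemma expect_mul_ind_eq_le {g : (ι → κ) → ℝ} {u w : ι} (huw : u ≠ w)
    (hg : DependsOn g ({u} : Set ι)ᶜ) (hg0 : ∀ z, 0 ≤ g z) :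
    𝔼 z, g z * ind (z u = z w) ≤ (𝔼 z, g z) * (1 / Fintype.card κ) := by
  classical
  refine expect_mul_le_of_update u hg hg0 fun z => ?_
  simp only [Function.update_self, Function.update_of_ne huw.symm]
  rw [Fintype.expect_eq_sum_div_card]
  simp [ind]

end Expectation

section EdgeWeights

/-- Every nonempty subset of `U` is left by some edge of `F`; equivalently, every vertex of `U` is
joined by a path of `F` to a vertex outside `U`. -/
def Exits {n : ℕ} (F : Finset (Pair n)) (U : Finset (Fin n)) : Prop :=
  ∀ U' ⊆ U, U'.Nonempty → ∃ e ∈ F, ∃ u ∈ U', ∃ w ∉ U', u ∈ e.1 ∧ w ∈ e.1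

/-- Weights attached to the edges, which are bounded by `lam`, depend on the two labels of the edge
only, and average to at most `lam * p` when one of the two labels is resampled. -/
structure EdgeWeight {n : ℕ} (lam p : ℝ) (θ : (Fin n → Fin n) → Pair n → ℝ) : Prop where
  lam_nonneg : 0 ≤ lam
  p_nonneg : 0 ≤ p
  nonneg : ∀ z e, 0 ≤ θ z e
  le : ∀ z e, θ z e ≤ lam
  dependsOn : ∀ e, DependsOn (fun z => θ z e) {v | v ∈ e.1}
  update_le : ∀ e, ∀ u ∈ e.1, ∀ z, 𝔼 x, θ (Function.update z u x) e ≤ lam * p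

/-- Revealing the labels of `U` one at a time, each of them being linked to an already revealed
one, gains a factor `p` for each vertex of `U`. -/
lemma EdgeWeight.expect_prod_le {n : ℕ} [Nonempty (Fin n)] {lam p : ℝ}
    {θ : (Fin n → Fin n) → Pair n → ℝ}
    (hθ : EdgeWeight lam p θ) (U : Finset (Fin n)) :
    ∀ (F : Finset (Pair n)) (_ : Exits F U) (g : (Fin n → Fin n) → ℝ)
      (_ : DependsOn g (U : Set (Fin n))ᶜ) (_ : ∀ z, 0 ≤ g z),
      U.card ≤ F.card ∧
      𝔼 z, g z * ∏ e ∈ F, θ z e ≤ (𝔼 z, g z) * (lam ^ F.card * p ^ U.card) := by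
  induction hc : U.card generalizing U with
  | zero =>
    intro F _ g _ hg0
    refine ⟨Nat.zero_le _, ?_⟩
    rw [Finset.expect_mul]
    refine Finset.expect_le_expect fun z _ => mul_le_mul_of_nonneg_left ?_ (hg0 z)
    rw [pow_zero, mul_one]
    exact (Finset.prod_le_prod (fun e _ => hθ.nonneg z e)
      fun e _ => hθ.le z e).trans_eq (Finset.prod_const _)
  | succ m ih =>
    intro F hex g hg hg0
    have hne : U.Nonempty := by rw [← Finset.card_pos]; omega
    obtain ⟨e, he, u, hu, w, hw, hue, hwe⟩ := hex U subset_rfl hne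
    have huw : u ≠ w := fun h => hw (h ▸ hu)
    have hes : e.1 = s(u, w) := (Sym2.mem_and_mem_iff huw).1 ⟨hue, hwe⟩
    have hex' : Exits (F.erase e) (U.erase u) := by
      intro U' hU' hne'
      obtain ⟨e', he', a, ha, b, hb, hae, hbe⟩ := hex U' (hU'.trans (Finset.erase_subset _ _)) hne'
      refine ⟨e', Finset.mem_erase.2 ⟨?_, he'⟩, a, ha, b, hb, hae, hbe⟩
      rintro rfl
      have haU := Finset.mem_erase.1 (hU' ha)
      rw [hes, Sym2.mem_iff] at hae
      rcases hae with h | h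
      · exact haU.1 h
      · exact hw (h ▸ haU.2)
    have hcard : (U.erase u).card = m := by rw [Finset.card_erase_of_mem hu]; omega
    have hFc : (F.erase e).card + 1 = F.card := Finset.card_erase_add_one he
    have hdep : DependsOn (fun z => g z * θ z e) ((U.erase u : Finset (Fin n)) : Set (Fin n))ᶜ := by
      refine DependsOn.mul (hg.mono ?_) ((hθ.dependsOn e).mono ?_)
      · intro i hi
        simp only [Set.mem_compl_iff, Finset.mem_coe] at hi ⊢
        exact fun h => hi (Finset.mem_of_mem_erase h)
      · intro i hi
        simp only [hes, Sym2.mem_iff, Set.mem_ofPred_eq] at hi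
        simp only [Set.mem_compl_iff, Finset.mem_coe, Finset.mem_erase]
        rcases hi with rfl | rfl <;> tauto
    obtain ⟨h1, h2⟩ := ih (U.erase u) hcard (F.erase e) hex' _ hdep
      (fun z => mul_nonneg (hg0 z) (hθ.nonneg z e))
    refine ⟨by omega, ?_⟩
    have h3 : 𝔼 z, g z * θ z e ≤ (𝔼 z, g z) * (lam * p) := by
      refine expect_mul_le_of_update u (hg.mono ?_) hg0 (hθ.update_le e u hue)
      intro i hi
      simp only [Set.mem_compl_iff, Set.mem_singleton_iff, Finset.mem_coe] at hi ⊢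
      rintro rfl
      exact hi hu
    calc 𝔼 z, g z * ∏ e ∈ F, θ z e
        = 𝔼 z, (g z * θ z e) * ∏ e ∈ F.erase e, θ z e := by
          refine Finset.expect_congr rfl fun z _ => ?_
          rw [mul_assoc, Finset.mul_prod_erase F (θ z) he]
      _ ≤ _ := h2
      _ ≤ ((𝔼 z, g z) * (lam * p)) * (lam ^ (F.erase e).card * p ^ m) :=
          mul_le_mul_of_nonneg_right h3
            (mul_nonneg (pow_nonneg hθ.lam_nonneg _) (pow_nonneg hθ.p_nonneg _))
      _ = _ := by rw [← hFc]; ring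

end EdgeWeights

/-! ### Separated blocks and clusters -/

section Cluster

variable {ι κ : Type*}

/-- The labels of `A` and of `B` collide. -/
def Hit (z : ι → κ) (A B : Finset ι) : Prop := ∃ a ∈ A, ∃ b ∈ B, z a = z b

lemma Hit.symm {z : ι → κ} {A B : Finset ι} (h : Hit z A B) : Hit z B A := by
  obtain ⟨a, ha, b, hb, hab⟩ := h
  exact ⟨b, hb, a, ha, hab.symm⟩

lemma Hit.mono {z : ι → κ} {A B A' B' : Finset ι} (h : Hit z A B) (hA : A ⊆ A') (hB : B ⊆ B') :
    Hit z A' B' := by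
  obtain ⟨a, ha, b, hb, hab⟩ := h
  exact ⟨a, hA ha, b, hB hb, hab⟩

lemma dependsOn_hit (A B : Finset ι) {s : Set ι} (hA : (A : Set ι) ⊆ s) (hB : (B : Set ι) ⊆ s) :
    DependsOn (fun z : ι → κ => Hit z A B) s := by
  intro z z' h
  simp only [Hit, eq_iff_iff]
  refine exists_congr fun a => and_congr_right fun ha => exists_congr fun b =>
    and_congr_right fun hb => ?_
  rw [h a (hA ha), h b (hB hb)]

variable {J : Type*}

/-- The blocks `V i`, `i ∈ I`, receive pairwise disjoint sets of labels, which also avoid the labels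
of `R`. -/
def Sep (V : J → Finset ι) (I : Finset J) (R : Finset ι) (z : ι → κ) : Prop :=
  (∀ i ∈ I, ¬ Hit z (V i) R) ∧ ∀ i ∈ I, ∀ j ∈ I, i ≠ j → ¬ Hit z (V i) (V j)

lemma Sep.mono {V : J → Finset ι} {I I' : Finset J} {R : Finset ι} {z : ι → κ}
    (h : Sep V I R z) (hI : I' ⊆ I) : Sep V I' R z :=
  ⟨fun i hi => h.1 i (hI hi), fun i hi j hj => h.2 i (hI hi) j (hI hj)⟩

lemma dependsOn_sep (V : J → Finset ι) (I : Finset J) (R : Finset ι) {s : Set ι}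
    (hR : (R : Set ι) ⊆ s) (hV : ∀ i ∈ I, (V i : Set ι) ⊆ s) :
    DependsOn (fun z : ι → κ => Sep V I R z) s := by
  intro z z' h
  simp only [Sep, eq_iff_iff]
  refine and_congr (forall₂_congr fun i hi => not_congr ?_)
    (forall₂_congr fun i hi => forall₂_congr fun j hj => imp_congr_right fun _ => not_congr ?_)
  · exact (dependsOn_hit (V i) R (hV i hi) hR h).to_iff
  · exact (dependsOn_hit (V i) (V j) (hV i hi) (hV j hj) h).to_iff

variable [DecidableEq ι] [DecidableEq J]

/-- The block `s` forms a cluster with the blocks of `N`: each of them collides with `s`, they are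
separated from each other and from `R`, and `s` collides with one of them or with `R`. -/
def Cluster (V : J → Finset ι) (s : J) (R : Finset ι) (N : Finset J) (z : ι → κ) : Prop :=
  Sep V N R z ∧ (∀ j ∈ N, Hit z (V j) (V s)) ∧ (N.Nonempty ∨ Hit z (V s) R)

/-- Inclusion-exclusion for the block `s`: if `s` spoils the separation, it forms a cluster with the
blocks that it hits, and the other blocks are separated from this cluster. -/
lemma ind_sep_eq (V : J → Finset ι) {s : J} {I : Finset J} (hs : s ∈ I) (R : Finset ι)
    (z : ι → κ) :
    ind (Sep V I R z) = ind (Sep V (I.erase s) R z) - ∑ N ∈ (I.erase s).powerset,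
      ind (Sep V (I.erase s \ N) (R ∪ V s ∪ N.biUnion V) z) * ind (Cluster V s R N z) := by
  classical
  set K := I.erase s with hK
  by_cases hsep : Sep V K R z
  -- When the other blocks are separated, only the set of blocks hit by `s` contributes to the sum.
  · set N₀ := K.filter fun j => Hit z (V j) (V s) with hN₀
    rw [ind_true hsep, Finset.sum_eq_single N₀]
    · have h1 : Sep V (K \ N₀) (R ∪ V s ∪ N₀.biUnion V) z := by
        refine ⟨fun i hi => ?_, fun i hi j hj => hsep.2 i (Finset.mem_sdiff.1 hi).1 j
          (Finset.mem_sdiff.1 hj).1⟩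
        rintro ⟨a, ha, b, hb, hab⟩
        obtain ⟨hiK, hiN⟩ := Finset.mem_sdiff.1 hi
        rcases Finset.mem_union.1 hb with hb | hb
        · rcases Finset.mem_union.1 hb with hb | hb
          · exact hsep.1 i hiK ⟨a, ha, b, hb, hab⟩
          · exact hiN (Finset.mem_filter.2 ⟨hiK, a, ha, b, hb, hab⟩)
        · obtain ⟨j, hj, hb⟩ := Finset.mem_biUnion.1 hb
          have hij : i ≠ j := fun h => hiN (h ▸ hj)
          exact hsep.2 i hiK j (Finset.mem_filter.1 hj).1 hij ⟨a, ha, b, hb, hab⟩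
      rw [ind_true h1, one_mul]
      by_cases hI : Sep V I R z
      · rw [ind_true hI, ind_false, sub_zero]
        rintro ⟨-, h2, h3 | h3⟩
        · obtain ⟨j, hj⟩ := h3
          have hjK := (Finset.mem_filter.1 hj).1
          exact hI.2 j (Finset.mem_of_mem_erase hjK) s hs (Finset.ne_of_mem_erase hjK) (h2 j hj)
        · exact hI.1 s hs h3
      · rw [ind_false hI, ind_true, sub_self]
        refine ⟨hsep.mono (Finset.filter_subset _ _), fun j hj => (Finset.mem_filter.1 hj).2, ?_⟩
        by_contra hcon
        push Not at hcon
        obtain ⟨hN, hR⟩ := hcon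
        have hno : ∀ j ∈ K, ¬ Hit z (V j) (V s) := fun j hj hh =>
          Finset.notMem_empty j (hN ▸ Finset.mem_filter.2 ⟨hj, hh⟩)
        refine hI ⟨fun i hi => ?_, fun i hi j hj hij => ?_⟩
        · by_cases his : i = s
          · exact his ▸ hR
          · exact hsep.1 i (Finset.mem_erase.2 ⟨his, hi⟩)
        · by_cases his : i = s
          · subst his
            exact fun hh => hno j (Finset.mem_erase.2 ⟨hij.symm, hj⟩) hh.symm
          · by_cases hjs : j = s
            · subst hjs
              exact hno i (Finset.mem_erase.2 ⟨his, hi⟩)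
            · exact hsep.2 i (Finset.mem_erase.2 ⟨his, hi⟩) j (Finset.mem_erase.2 ⟨hjs, hj⟩) hij
    · intro N hN hne
      by_cases h1 : Sep V (K \ N) (R ∪ V s ∪ N.biUnion V) z
      · rw [ind_false (P := Cluster V s R N z), mul_zero]
        rintro ⟨-, h2, -⟩
        refine hne (Finset.Subset.antisymm (fun j hj => Finset.mem_filter.2
          ⟨Finset.mem_powerset.1 hN hj, h2 j hj⟩) fun j hj => ?_)
        obtain ⟨hjK, hh⟩ := Finset.mem_filter.1 hj
        by_contra hjN
        refine h1.1 j (Finset.mem_sdiff.2 ⟨hjK, hjN⟩) (hh.mono subset_rfl ?_)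
        exact Finset.subset_union_right.trans Finset.subset_union_left
      · rw [ind_false h1, zero_mul]
    · intro h
      exact absurd (Finset.mem_powerset.2 (Finset.filter_subset _ _)) h
  · rw [ind_false hsep, ind_false fun h => hsep (h.mono (Finset.erase_subset _ _)),
      Finset.sum_eq_zero, sub_zero]
    intro N hN
    by_cases h1 : Sep V (K \ N) (R ∪ V s ∪ N.biUnion V) z
    · rw [ind_false (P := Cluster V s R N z), mul_zero]
      rintro ⟨h2, -, -⟩
      have hcross : ∀ i ∈ K, i ∉ N → ∀ j ∈ N, ¬ Hit z (V i) (V j) := fun i hi hiN j hj hh =>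
        h1.1 i (Finset.mem_sdiff.2 ⟨hi, hiN⟩) (hh.mono subset_rfl
          ((Finset.subset_biUnion_of_mem V hj).trans Finset.subset_union_right))
      refine hsep ⟨fun i hi => ?_, fun i hi j hj hij => ?_⟩
      · by_cases hiN : i ∈ N
        · exact h2.1 i hiN
        · exact fun hh => h1.1 i (Finset.mem_sdiff.2 ⟨hi, hiN⟩) (hh.mono subset_rfl
            (Finset.subset_union_left.trans Finset.subset_union_left))
      · by_cases hiN : i ∈ N
        · by_cases hjN : j ∈ N
          · exact h2.2 i hiN j hjN hij
          · exact fun hh => hcross j hj hjN i hiN hh.symm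
        · by_cases hjN : j ∈ N
          · exact hcross i hi hiN j hjN
          · exact h1.2 i (Finset.mem_sdiff.2 ⟨hi, hiN⟩) j (Finset.mem_sdiff.2 ⟨hj, hjN⟩) hij
    · rw [ind_false h1, zero_mul]

variable [Fintype ι] [Fintype κ] [Nonempty κ]

/-- A centered function of the labels of a block `V`, of size at most `b` on average, also when two
labels, one inside and one outside the block, are required to coincide. -/
structure CenteredBlock (V : Finset ι) (X : (ι → κ) → ℝ) (b : ℝ) : Prop where
  nonempty : V.Nonempty
  nonneg : 0 ≤ b
  dependsOn : DependsOn X (V : Set ι)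
  expect_eq_zero : 𝔼 z, X z = 0
  abs_le : ∀ g : (ι → κ) → ℝ, DependsOn g (V : Set ι)ᶜ → (∀ z, 0 ≤ g z) →
    𝔼 z, g z * |X z| ≤ (𝔼 z, g z) * b
  hit_le : ∀ g : (ι → κ) → ℝ, DependsOn g (V : Set ι)ᶜ → (∀ z, 0 ≤ g z) →
    ∀ v ∈ V, ∀ r ∉ V, 𝔼 z, g z * (|X z| * ind (z v = z r)) ≤ (𝔼 z, g z) * (b / Fintype.card κ)

lemma CenteredBlock.expect_hit_le {V : Finset ι} {X : (ι → κ) → ℝ} {b : ℝ}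
    (h : CenteredBlock V X b) {R : Finset ι} (hR : Disjoint V R) {m : ℕ} (hVm : V.card ≤ m)
    (hRm : R.card ≤ m) {g : (ι → κ) → ℝ} (hg : DependsOn g (V : Set ι)ᶜ) (hg0 : ∀ z, 0 ≤ g z) :
    𝔼 z, g z * (|X z| * ind (Hit z V R)) ≤ (𝔼 z, g z) * (b * m ^ 2 / Fintype.card κ) := by
  have h1 : ∀ z : ι → κ, ind (Hit z V R) ≤ ∑ v ∈ V, ∑ r ∈ R, ind (z v = z r) := by
    intro z
    by_cases hh : Hit z V R
    · obtain ⟨v, hv, r, hr, hvr⟩ := hh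
      calc ind (Hit z V R) ≤ ind (z v = z r) := by rw [ind_true hvr]; exact ind_le_one _
        _ ≤ ∑ r ∈ R, ind (z v = z r) :=
          Finset.single_le_sum (f := fun r => ind (z v = z r)) (fun _ _ => ind_nonneg _) hr
        _ ≤ _ := Finset.single_le_sum (f := fun v => ∑ r ∈ R, ind (z v = z r))
          (fun _ _ => Finset.sum_nonneg fun _ _ => ind_nonneg _) hv
    · rw [ind_false hh]
      exact Finset.sum_nonneg fun _ _ => Finset.sum_nonneg fun _ _ => ind_nonneg _
  have hE : 0 ≤ 𝔼 z, g z := Finset.expect_nonneg fun z _ => hg0 z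
  have hb : 0 ≤ b / Fintype.card κ := div_nonneg h.nonneg (Nat.cast_nonneg _)
  calc 𝔼 z, g z * (|X z| * ind (Hit z V R))
      ≤ 𝔼 z, ∑ v ∈ V, ∑ r ∈ R, g z * (|X z| * ind (z v = z r)) := by
        refine Finset.expect_le_expect fun z _ => ?_
        simp only [← Finset.mul_sum]
        exact mul_le_mul_of_nonneg_left (mul_le_mul_of_nonneg_left (h1 z) (abs_nonneg _)) (hg0 z)
    _ = ∑ v ∈ V, ∑ r ∈ R, 𝔼 z, g z * (|X z| * ind (z v = z r)) := by
        rw [Finset.expect_sum_comm]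
        exact Finset.sum_congr rfl fun v _ => Finset.expect_sum_comm _ _ _
    _ ≤ ∑ v ∈ V, ∑ r ∈ R, (𝔼 z, g z) * (b / Fintype.card κ) :=
        Finset.sum_le_sum fun v hv => Finset.sum_le_sum fun r hr =>
          h.hit_le g hg hg0 v hv r fun hrV => (Finset.disjoint_left.1 hR hrV hr)
    _ = (V.card * R.card : ℝ) * ((𝔼 z, g z) * (b / Fintype.card κ)) := by
        simp only [Finset.sum_const, nsmul_eq_mul]; ring
    _ ≤ (m * m : ℝ) * ((𝔼 z, g z) * (b / Fintype.card κ)) := by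
        refine mul_le_mul_of_nonneg_right ?_ (mul_nonneg hE hb)
        exact mul_le_mul (by exact_mod_cast hVm) (by exact_mod_cast hRm) (by positivity)
          (by positivity)
    _ = _ := by ring

/-- Requiring each of the disjoint blocks of `N` to collide with `W` costs a factor
`m ^ 2 / card κ` for each of them. -/
lemma expect_prod_hit_le {V : J → Finset ι} {X : J → (ι → κ) → ℝ} {b : J → ℝ} {m : ℕ}
    {W : Finset ι} (hWm : W.card ≤ m) (N : Finset J)
    (hX : ∀ i ∈ N, CenteredBlock (V i) (X i) (b i)) (hVm : ∀ i ∈ N, (V i).card ≤ m)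
    (hVW : ∀ i ∈ N, Disjoint (V i) W)
    (hVV : ∀ i ∈ N, ∀ j ∈ N, i ≠ j → Disjoint (V i) (V j)) :
    ∀ (g : (ι → κ) → ℝ), DependsOn g ((N.biUnion V : Finset ι) : Set ι)ᶜ → (∀ z, 0 ≤ g z) →
    𝔼 z, g z * ∏ i ∈ N, (|X i z| * ind (Hit z (V i) W))
      ≤ (𝔼 z, g z) * ∏ i ∈ N, (b i * m ^ 2 / Fintype.card κ) := by
  induction N using Finset.induction_on with
  | empty => intro g _ _; simp
  | insert j N hj ih =>
    intro g hg hg0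
    have hjX := hX j (Finset.mem_insert_self _ _)
    have hdisj : ∀ i ∈ N, Disjoint (V j) (V i) := fun i hi =>
      hVV j (Finset.mem_insert_self _ _) i (Finset.mem_insert_of_mem hi) fun h => hj (h ▸ hi)
    have key := ih (fun i hi => hX i (Finset.mem_insert_of_mem hi))
      (fun i hi => hVm i (Finset.mem_insert_of_mem hi))
      (fun i hi => hVW i (Finset.mem_insert_of_mem hi))
      (fun i hi k hk => hVV i (Finset.mem_insert_of_mem hi) k (Finset.mem_insert_of_mem hk))
      (fun z => g z * (|X j z| * ind (Hit z (V j) W)))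
      (by
        refine hg.mono ?_ |>.mul ((hjX.dependsOn.mono ?_).abs.mul ?_)
        · refine Set.compl_subset_compl.2 ?_
          exact_mod_cast Finset.biUnion_subset_biUnion_of_subset_left _ (Finset.subset_insert _ _)
        · intro v hv
          simp only [Finset.mem_coe, Set.mem_compl_iff, Finset.mem_biUnion, not_exists, not_and]
            at hv ⊢
          exact fun i hi hvi => Finset.disjoint_left.1 (hdisj i hi) hv hvi
        · intro z z' hz
          refine congrArg ind (dependsOn_hit (V j) W ?_ ?_ hz)
          · intro v hv
            simp only [Finset.mem_coe, Set.mem_compl_iff, Finset.mem_biUnion, not_exists, not_and]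
              at hv ⊢
            exact fun i hi hvi => Finset.disjoint_left.1 (hdisj i hi) hv hvi
          · intro v hv
            simp only [Finset.mem_coe, Set.mem_compl_iff, Finset.mem_biUnion, not_exists, not_and]
              at hv ⊢
            exact fun i hi hvi => Finset.disjoint_left.1
              (hVW i (Finset.mem_insert_of_mem hi)) hvi hv)
      (fun z => mul_nonneg (hg0 z) (mul_nonneg (abs_nonneg _) (ind_nonneg _)))
    have key2 := hjX.expect_hit_le (hVW j (Finset.mem_insert_self _ _))
      (hVm j (Finset.mem_insert_self _ _)) hWm (g := g) (hg.mono (by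
        refine Set.compl_subset_compl.2 ?_
        exact_mod_cast Finset.subset_biUnion_of_mem V (Finset.mem_insert_self _ _))) hg0
    simp only [Finset.prod_insert hj]
    calc 𝔼 z, g z * (|X j z| * ind (Hit z (V j) W) * ∏ i ∈ N, (|X i z| * ind (Hit z (V i) W)))
        = 𝔼 z, g z * (|X j z| * ind (Hit z (V j) W)) *
            ∏ i ∈ N, (|X i z| * ind (Hit z (V i) W)) :=
          Finset.expect_congr rfl fun z _ => by ring
      _ ≤ _ := key
      _ ≤ _ := mul_le_mul_of_nonneg_right key2 (Finset.prod_nonneg fun i hi =>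
          div_nonneg (mul_nonneg (hX i (Finset.mem_insert_of_mem hi)).nonneg (by positivity))
            (Nat.cast_nonneg _))
      _ = _ := by ring

end Cluster

/-! ### Centered blocks under a separation constraint -/

section ClusterBound

variable {ι κ J : Type*} [DecidableEq ι] [DecidableEq J] [Fintype ι] [Fintype κ] [Nonempty κ]

/-- The total weight of the clusters of a block, where `x` stands for `(card κ)^(-1/2)`: a cluster
reduced to the block collides with `R`, hence the exceptional weight of `∅`. -/
lemma sum_cluster_weights_le {m : ℕ} (hm : 4 ≤ m) {x : ℝ} (hx : 0 ≤ x) (hmx : 2 * (m * x) ≤ 1)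
    (K : Finset J) (hK : K.card ≤ m) :
    ∑ N ∈ K.powerset, (if N = ∅ then m ^ 2 * x ^ 2 else x ^ N.card) ≤ m ^ 2 * x := by
  have hm' : (4 : ℝ) ≤ m := by exact_mod_cast hm
  have hK' : (K.card : ℝ) ≤ m := by exact_mod_cast hK
  have h2 : ∑ N ∈ K.powerset, (if N = ∅ then m ^ 2 * x ^ 2 else x ^ N.card)
      = m ^ 2 * x ^ 2 + ((1 + x) ^ K.card - 1) := by
    rw [← sum_powerset_pow, ← Finset.add_sum_erase _ _ (Finset.empty_mem_powerset K),
      ← Finset.add_sum_erase _ (fun N : Finset J => x ^ N.card) (Finset.empty_mem_powerset K)]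
    rw [if_pos rfl, Finset.card_empty, pow_zero, add_sub_cancel_left]
    congr 1
    exact Finset.sum_congr rfl fun N hN => if_neg (Finset.ne_of_mem_erase hN)
  rw [h2]
  have hKx : (K.card : ℝ) * x ≤ m * x := mul_le_mul_of_nonneg_right hK' hx
  have h3 := one_add_pow_le hx K.card (by linarith)
  have h4 : (m : ℝ) ^ 2 * x ^ 2 = m * x * (m * x) := by ring
  have h5 : m * x * (m * x) ≤ m * x * (1 / 2) :=
    mul_le_mul_of_nonneg_left (by linarith) (by positivity)
  nlinarith [mul_nonneg (by linarith : (0 : ℝ) ≤ m) hx, mul_le_mul_of_nonneg_right hm'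
    (mul_nonneg (by linarith : (0 : ℝ) ≤ m) hx)]

/-- In the presence of the separation constraint, each centered block gains a factor of order
`(card κ)^(-1/2)`: by independence a block contributes only if it collides with another one, and a
cluster of at least two colliding blocks gains a factor `(card κ)⁻¹` for each block but one. -/
theorem abs_expect_sep_le {V : J → Finset ι} {X : J → (ι → κ) → ℝ} {b : J → ℝ} {m : ℕ}
    (hm : 4 ≤ m) (hmn : 4 * m ^ 2 ≤ Fintype.card κ) (I : Finset J) :
    (∀ i ∈ I, CenteredBlock (V i) (X i) (b i)) →
    (∀ i ∈ I, ∀ j ∈ I, i ≠ j → Disjoint (V i) (V j)) →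
    ∀ (R : Finset ι) (g : (ι → κ) → ℝ), (∀ i ∈ I, Disjoint (V i) R) →
      (R ∪ I.biUnion V).card ≤ m → DependsOn g (R : Set ι) →
    |𝔼 z, g z * (∏ i ∈ I, X i z) * ind (Sep V I R z)|
      ≤ (𝔼 z, |g z|) * ∏ i ∈ I, (b i * (m ^ 2 / √(Fintype.card κ))) := by
  induction I using Finset.strongInductionOn with
  | _ I ih =>
  intro hX hVV R g hVR hcard hg
  rcases I.eq_empty_or_nonempty with rfl | ⟨s, hs⟩
  · have : ∀ z : ι → κ, Sep V ∅ R z := fun z => ⟨by simp, by simp⟩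
    simp only [Finset.prod_empty, mul_one, ind_true (this _)]
    exact Finset.abs_expect_le _ _
  set K := I.erase s with hK
  set n : ℝ := ((Fintype.card κ : ℕ) : ℝ) with hn
  set x : ℝ := 1 / √n with hx
  have hn0 : 0 < n := by rw [hn]; exact_mod_cast Fintype.card_pos
  have hsn : 0 < √n := Real.sqrt_pos.2 hn0
  have hx0 : 0 ≤ x := by positivity
  have hxx : x ^ 2 = 1 / n := by rw [hx, div_pow, Real.sq_sqrt hn0.le, one_pow]
  have hmx : 2 * (m * x) ≤ 1 := by
    have h1 : (2 * m : ℝ) ≤ √n := by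
      refine Real.le_sqrt_of_sq_le ?_
      have : ((4 * m ^ 2 : ℕ) : ℝ) ≤ n := Nat.cast_le.2 hmn
      push_cast at this
      linarith [this, (by ring : (2 * m : ℝ) ^ 2 = 4 * m ^ 2)]
    rw [hx, ← mul_assoc, mul_one_div, div_le_one hsn]
    exact h1
  set β : J → ℝ := fun i => b i * (m ^ 2 / √n) with hβ
  have hKI : K ⊆ I := Finset.erase_subset _ _
  have hb0 : ∀ i ∈ I, 0 ≤ b i := fun i hi => (hX i hi).nonneg
  have hβ0 : ∀ i ∈ I, 0 ≤ β i := fun i hi => mul_nonneg (hb0 i hi) (by positivity)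
  have hbβ : ∀ i, b i * m ^ 2 / n = β i * x := fun i => by
    have : x * x = 1 / n := by rw [← sq, hxx]
    rw [hβ]
    calc b i * m ^ 2 / n = b i * m ^ 2 * (1 / n) := by ring
      _ = b i * m ^ 2 * (x * x) := by rw [this]
      _ = _ := by rw [hx]; ring
  have hE : 0 ≤ 𝔼 z, |g z| := Finset.expect_nonneg fun z _ => abs_nonneg _
  have hcardV : ∀ i ∈ I, (V i).card ≤ m := fun i hi => (Finset.card_le_card
    ((Finset.subset_biUnion_of_mem V hi).trans Finset.subset_union_right)).trans hcard
  have hcardR : R.card ≤ m := (Finset.card_le_card Finset.subset_union_left).trans hcard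
  have hcardK : K.card ≤ m := by
    refine le_trans ?_ ((Finset.card_le_card
      ((Finset.biUnion_subset_biUnion_of_subset_left V hKI).trans
        Finset.subset_union_right)).trans hcard)
    rw [Finset.card_biUnion fun i hi j hj hij => hVV i (hKI hi) j (hKI hj) hij,
      Finset.card_eq_sum_ones]
    exact Finset.sum_le_sum fun i hi => Finset.card_pos.2 (hX i (hKI hi)).nonempty
  have hKs : ∀ i ∈ K, Disjoint (V i) (V s) := fun i hi =>
    hVV i (hKI hi) s hs (Finset.ne_of_mem_erase hi)
  have hdepV : ∀ i ∈ K, (V i : Set ι) ⊆ (V s : Set ι)ᶜ := fun i hi v hv hvs =>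
    Finset.disjoint_left.1 (hKs i hi) hv hvs
  have hdepR : (R : Set ι) ⊆ (V s : Set ι)ᶜ := fun v hv hvs =>
    Finset.disjoint_left.1 (hVR s hs) hvs hv
  -- `G N` gathers the cluster formed by `s` and `N`, whose vertices are moved into `R' N`.
  set G : Finset J → (ι → κ) → ℝ := fun N z =>
    g z * X s z * (∏ i ∈ N, X i z) * ind (Cluster V s R N z) with hG
  set R' : Finset J → Finset ι := fun N => R ∪ V s ∪ N.biUnion V with hR'
  -- As `X s` is centered, nothing is left if the block `s` is freed from the separation.
  have hzero : 𝔼 z, g z * (∏ i ∈ I, X i z) * ind (Sep V K R z) = 0 := by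
    have := expect_mul_of_dependsOn (f := X s)
      (g := fun z => g z * (∏ i ∈ K, X i z) * ind (Sep V K R z)) (V s) (hX s hs).dependsOn
      (((hg.mono hdepR).mul (DependsOn.prod fun i hi =>
        (hX i (hKI hi)).dependsOn.mono (hdepV i hi))).mul
        (dependsOn_ind (dependsOn_sep V K R hdepR hdepV)))
    rw [(hX s hs).expect_eq_zero, zero_mul] at this
    rw [← this]
    refine Finset.expect_congr rfl fun z _ => ?_
    rw [← Finset.mul_prod_erase I (fun i => X i z) hs]
    ring
  have hsplit : 𝔼 z, g z * (∏ i ∈ I, X i z) * ind (Sep V I R z)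
      = - ∑ N ∈ K.powerset, 𝔼 z, G N z * (∏ i ∈ K \ N, X i z) * ind (Sep V (K \ N) (R' N) z) := by
    rw [← Finset.expect_sum_comm, ← Finset.expect_neg_distrib,
      ← zero_add (Finset.expect _ (fun z => -_)), ← hzero, ← Finset.expect_add_distrib]
    refine Finset.expect_congr rfl fun z _ => ?_
    rw [ind_sep_eq V hs R z, mul_sub, sub_eq_add_neg, Finset.mul_sum]
    congr 2
    refine Finset.sum_congr rfl fun N hN => ?_
    rw [← Finset.mul_prod_erase I (fun i => X i z) hs,
      ← Finset.prod_sdiff (Finset.mem_powerset.1 hN)]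
    simp only [hG, hR', ← hK]
    ring
  have hGbound : ∀ N ∈ K.powerset, 𝔼 z, |G N z| ≤ (𝔼 z, |g z|) *
      (b s * (if N = ∅ then m ^ 2 * x ^ 2 else x ^ N.card) * ∏ i ∈ N, β i) := by
    intro N hN
    rw [Finset.mem_powerset] at hN
    have hgs : DependsOn (fun z => |g z|) (V s : Set ι)ᶜ := (hg.mono hdepR).abs
    by_cases hNe : N = ∅
    · subst hNe
      rw [if_pos rfl, Finset.prod_empty, mul_one]
      calc 𝔼 z, |G ∅ z| ≤ 𝔼 z, |g z| * (|X s z| * ind (Hit z (V s) R)) := by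
            refine Finset.expect_le_expect fun z _ => ?_
            simp only [hG, Finset.prod_empty, mul_one, abs_mul, abs_of_nonneg (ind_nonneg _)]
            rw [mul_assoc]
            refine mul_le_mul_of_nonneg_left (mul_le_mul_of_nonneg_left (ind_mono ?_)
              (abs_nonneg _)) (abs_nonneg _)
            rintro ⟨-, -, h | h⟩
            · exact absurd h (by simp)
            · exact h
        _ ≤ _ := (hX s hs).expect_hit_le (hVR s hs) (hcardV s hs) hcardR hgs
            fun z => abs_nonneg _
        _ = _ := by rw [hxx]; ring
    · rw [if_neg hNe]
      calc 𝔼 z, |G N z|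
          ≤ 𝔼 z, (|g z| * |X s z|) * ∏ i ∈ N, (|X i z| * ind (Hit z (V i) (V s))) := by
            refine Finset.expect_le_expect fun z _ => ?_
            simp only [hG, abs_mul, abs_of_nonneg (ind_nonneg _), Finset.abs_prod,
              Finset.prod_mul_distrib]
            rw [mul_assoc]
            refine mul_le_mul_of_nonneg_left (mul_le_mul_of_nonneg_left ?_ ?_) ?_
            · by_cases hcl : Cluster V s R N z
              · rw [Finset.prod_eq_one fun i hi => ind_true (hcl.2.1 i hi)]
                exact ind_le_one _
              · rw [ind_false hcl]
                exact Finset.prod_nonneg fun _ _ => ind_nonneg _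
            · exact Finset.prod_nonneg fun _ _ => abs_nonneg _
            · positivity
        _ ≤ (𝔼 z, |g z| * |X s z|) * ∏ i ∈ N, (b i * m ^ 2 / n) := by
            refine expect_prod_hit_le (hcardV s hs) N (fun i hi => hX i (hKI (hN hi)))
              (fun i hi => hcardV i (hKI (hN hi))) (fun i hi => hKs i (hN hi))
              (fun i hi j hj => hVV i (hKI (hN hi)) j (hKI (hN hj))) _ ?_
              (fun z => by positivity)
            refine (hg.mono ?_).abs.mul ((hX s hs).dependsOn.mono ?_).abs
            · intro v hv
              simp only [Finset.mem_coe, Set.mem_compl_iff, Finset.mem_biUnion, not_exists,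
                not_and] at hv ⊢
              exact fun i hi hvi => Finset.disjoint_left.1 (hVR i (hKI (hN hi))) hvi hv
            · intro v hv
              simp only [Finset.mem_coe, Set.mem_compl_iff, Finset.mem_biUnion, not_exists,
                not_and] at hv ⊢
              exact fun i hi hvi => Finset.disjoint_left.1 (hKs i (hN hi)) hvi hv
        _ ≤ ((𝔼 z, |g z|) * b s) * ∏ i ∈ N, (b i * m ^ 2 / n) := by
            refine mul_le_mul_of_nonneg_right ((hX s hs).abs_le _ hgs fun z => abs_nonneg _)
              (Finset.prod_nonneg fun i hi => ?_)
            have := hb0 i (hKI (hN hi))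
            positivity
        _ = _ := by
            simp only [hbβ, Finset.prod_mul_distrib, Finset.prod_const]
            ring
  -- The blocks outside the cluster are handled by induction.
  have hterm : ∀ N ∈ K.powerset,
      |𝔼 z, G N z * (∏ i ∈ K \ N, X i z) * ind (Sep V (K \ N) (R' N) z)|
        ≤ (𝔼 z, |g z|) * b s * (∏ i ∈ K, β i) *
          (if N = ∅ then m ^ 2 * x ^ 2 else x ^ N.card) := by
    intro N hN
    have hNK := Finset.mem_powerset.1 hN
    have hsub : K \ N ⊆ I := Finset.sdiff_subset.trans hKI
    have hlt : K \ N ⊂ I := ⟨hsub, fun h => by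
      have := h hs
      rw [Finset.mem_sdiff, hK] at this
      exact Finset.notMem_erase s I this.1⟩
    have hRs : (R : Set ι) ⊆ (R' N : Set ι) := by
      exact_mod_cast Finset.subset_union_left.trans Finset.subset_union_left
    have hVs : (V s : Set ι) ⊆ (R' N : Set ι) := by
      exact_mod_cast Finset.subset_union_right.trans Finset.subset_union_left
    have hNs : ∀ i ∈ N, (V i : Set ι) ⊆ (R' N : Set ι) := fun i hi => by
      exact_mod_cast (Finset.subset_biUnion_of_mem V hi).trans Finset.subset_union_right
    have key := ih (K \ N) hlt (fun i hi => hX i (hsub hi))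
      (fun i hi j hj => hVV i (hsub hi) j (hsub hj)) (R' N) (G N) ?_ ?_ ?_
    · refine key.trans ?_
      have hprod : 0 ≤ ∏ i ∈ K \ N, β i := Finset.prod_nonneg fun i hi => hβ0 i (hsub hi)
      refine (mul_le_mul_of_nonneg_right (hGbound N hN) hprod).trans_eq ?_
      rw [← Finset.prod_sdiff hNK]
      ring
    · intro i hi
      obtain ⟨hiK, hiN⟩ := Finset.mem_sdiff.1 hi
      simp only [hR', Finset.disjoint_union_right, Finset.disjoint_biUnion_right]
      exact ⟨⟨hVR i (hKI hiK), hKs i hiK⟩, fun j hj =>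
        hVV i (hKI hiK) j (hKI (hNK hj)) fun h => hiN (h ▸ hj)⟩
    · refine le_trans (Finset.card_le_card ?_) hcard
      intro v hv
      simp only [hR', Finset.mem_union, Finset.mem_biUnion] at hv ⊢
      rcases hv with ((hv | hv) | ⟨i, hi, hv⟩) | ⟨i, hi, hv⟩
      · exact Or.inl hv
      · exact Or.inr ⟨s, hs, hv⟩
      · exact Or.inr ⟨i, hKI (hNK hi), hv⟩
      · exact Or.inr ⟨i, hsub hi, hv⟩
    · refine (((hg.mono hRs).mul ((hX s hs).dependsOn.mono hVs)).mul (DependsOn.prod fun i hi =>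
        (hX i (hKI (hNK hi))).dependsOn.mono (hNs i hi))).mul (dependsOn_ind ?_)
      intro z z' hz
      simp only [Cluster, eq_iff_iff]
      refine and_congr (dependsOn_sep V N R hRs hNs hz).to_iff (and_congr
        (forall₂_congr fun j hj => (dependsOn_hit (V j) (V s) (hNs j hj) hVs hz).to_iff)
        (or_congr_right (dependsOn_hit (V s) R hVs hRs hz).to_iff))
  rw [hsplit, abs_neg]
  have hprodK : 0 ≤ ∏ i ∈ K, β i := Finset.prod_nonneg fun i hi => hβ0 i (hKI hi)
  calc |∑ N ∈ K.powerset, 𝔼 z, G N z * (∏ i ∈ K \ N, X i z) * ind (Sep V (K \ N) (R' N) z)|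
      ≤ ∑ N ∈ K.powerset, (𝔼 z, |g z|) * b s * (∏ i ∈ K, β i) *
          (if N = ∅ then m ^ 2 * x ^ 2 else x ^ N.card) :=
        (Finset.abs_sum_le_sum_abs _ _).trans (Finset.sum_le_sum hterm)
    _ = (𝔼 z, |g z|) * b s * (∏ i ∈ K, β i) *
          ∑ N ∈ K.powerset, (if N = ∅ then m ^ 2 * x ^ 2 else x ^ N.card) := by
        rw [Finset.mul_sum]
    _ ≤ (𝔼 z, |g z|) * b s * (∏ i ∈ K, β i) * (m ^ 2 * x) :=
        mul_le_mul_of_nonneg_left (sum_cluster_weights_le hm hx0 hmx K hcardK)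
          (mul_nonneg (mul_nonneg hE (hb0 s hs)) hprodK)
    _ = _ := by
        rw [← Finset.mul_prod_erase I _ hs, ← hK]
        simp only [hβ, hx]
        ring

end ClusterBound

/-! ### Independent labels and permutations -/

section LatentAverage

variable {ι : Type*} [DecidableEq ι] [Fintype ι]

/-- The average over the latent assignment: over all functions, or over all permutations. -/
noncomputable def latentE (S : Sampling) (f : (ι → ι) → ℝ) : ℝ :=
  match S with
  | .independent => 𝔼 z, f z
  | .permutation => 𝔼 σ : Equiv.Perm ι, f σ

lemma latentE_mono {S : Sampling} {f g : (ι → ι) → ℝ} (h : ∀ z, f z ≤ g z) :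
    latentE S f ≤ latentE S g := by
  cases S <;> exact Finset.expect_le_expect fun _ _ => h _

lemma latentE_nonneg {S : Sampling} {f : (ι → ι) → ℝ} (h : ∀ z, 0 ≤ f z) : 0 ≤ latentE S f := by
  cases S <;> exact Finset.expect_nonneg fun _ _ => h _

lemma latentE_const [Nonempty ι] (S : Sampling) (c : ℝ) :
    latentE S (fun _ : ι → ι => c) = c := by
  cases S <;> exact Fintype.expect_const _

lemma dependsOn_injOn {W : Finset ι} {s : Set ι} (h : (W : Set ι) ⊆ s) :
    DependsOn (fun z : ι → ι => Set.InjOn z W) s := by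
  intro z z' hz
  simp only [eq_iff_iff]
  exact Set.EqOn.injOn_iff fun i hi => hz i (h hi)

/-- A random permutation restricted to `W` is a random function conditioned on being injective
on `W`. -/
lemma expect_injOn_mul {W : Finset ι} {h : (ι → ι) → ℝ} (hh : DependsOn h (W : Set ι)) :
    𝔼 z : ι → ι, ind (Set.InjOn z W) * h z
      = (𝔼 z : ι → ι, ind (Set.InjOn z W)) * 𝔼 σ : Equiv.Perm ι, h σ := by
  have h1 : ∀ σ : Equiv.Perm ι, 𝔼 z : ι → ι, ind (Set.InjOn z W) * h z
      = 𝔼 z : ι → ι, ind (Set.InjOn z W) * h (σ ∘ z) := by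
    intro σ
    symm
    refine Fintype.expect_equiv (Equiv.arrowCongr (Equiv.refl ι) σ) _ _ fun z => ?_
    have : (Equiv.arrowCongr (Equiv.refl ι) σ) z = σ ∘ z := by
      ext i; simp [Equiv.arrowCongr]
    rw [this]
    congr 2
    rw [Set.InjOn, Set.InjOn]
    simp
  have h2 : 𝔼 z : ι → ι, ind (Set.InjOn z W) * h z
      = 𝔼 _σ : Equiv.Perm ι, 𝔼 z : ι → ι, ind (Set.InjOn z W) * h z :=
    (Fintype.expect_const _).symm
  rw [h2, Finset.expect_congr rfl fun σ _ => h1 σ, Finset.expect_comm, Finset.expect_mul]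
  refine Finset.expect_congr rfl fun z _ => ?_
  rw [← Finset.mul_expect]
  by_cases hz : Set.InjOn z W
  · congr 1
    obtain ⟨τ, hτ⟩ := Finset.exists_equiv_extend_of_card_eq (α := ι) (t := Finset.univ)
      Finset.card_univ.symm (Finset.subset_univ (W.image z)) hz
    set τ' : Equiv.Perm ι := τ.trans (Equiv.subtypeUnivEquiv (Finset.mem_univ)) with hτ'
    have h3 : ∀ i ∈ W, τ' i = z i := fun i hi => hτ i hi
    refine Fintype.expect_equiv (Equiv.mulRight τ') _ _ fun σ => hh fun i hi => ?_
    simp [h3 i hi]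
  · rw [ind_false hz, zero_mul, zero_mul]

/-- By a union bound, a random function is injective on few coordinates with probability at least
`1 / 2`. -/
lemma half_le_expect_injOn [Nonempty ι] {W : Finset ι} {m : ℕ} (hW : W.card ≤ m)
    (hm : 2 * m ^ 2 ≤ Fintype.card ι) : 1 / 2 ≤ 𝔼 z : ι → ι, ind (Set.InjOn z W) := by
  have hn : (0 : ℝ) < Fintype.card ι := by exact_mod_cast Fintype.card_pos
  have h1 : ∀ z : ι → ι, 1 - ∑ u ∈ W, ∑ v ∈ W.erase u, ind (z u = z v)
      ≤ ind (Set.InjOn z W) := by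
    intro z
    by_cases hz : Set.InjOn z W
    · rw [ind_true hz, sub_le_self_iff]
      exact Finset.sum_nonneg fun _ _ => Finset.sum_nonneg fun _ _ => ind_nonneg _
    · rw [ind_false hz, sub_nonpos]
      simp only [Set.InjOn, not_forall] at hz
      obtain ⟨u, hu, v, hv, huv, hne⟩ := hz
      calc (1 : ℝ) = ind (z u = z v) := (ind_true huv).symm
        _ ≤ ∑ v ∈ W.erase u, ind (z u = z v) :=
          Finset.single_le_sum (f := fun v => ind (z u = z v)) (fun _ _ => ind_nonneg _)
            (Finset.mem_erase.2 ⟨Ne.symm hne, hv⟩)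
        _ ≤ _ := Finset.single_le_sum (f := fun u => ∑ v ∈ W.erase u, ind (z u = z v))
          (fun _ _ => Finset.sum_nonneg fun _ _ => ind_nonneg _) hu
  have h2 : ∀ u ∈ W, ∀ v ∈ W.erase u, 𝔼 z : ι → ι, ind (z u = z v) ≤ 1 / Fintype.card ι := by
    intro u _ v hv
    simpa using expect_mul_ind_eq_le (ι := ι) (κ := ι) (g := fun _ => 1)
      (Finset.ne_of_mem_erase hv).symm (fun _ _ _ => rfl) (fun _ => zero_le_one)
  have h3 : (W.card : ℝ) ≤ m := by exact_mod_cast hW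
  have h4 : (2 * m ^ 2 : ℝ) ≤ Fintype.card ι := by exact_mod_cast hm
  calc (1 / 2 : ℝ) ≤ 1 - m * (m * (1 / Fintype.card ι)) := by
        have : (m * (m * (1 / Fintype.card ι)) : ℝ) ≤ 1 / 2 := by
          rw [← mul_assoc, mul_one_div, div_le_iff₀ hn]; nlinarith
        linarith
    _ ≤ 1 - ∑ u ∈ W, ∑ v ∈ W.erase u, (1 / Fintype.card ι : ℝ) := by
        refine sub_le_sub_left ?_ _
        simp only [Finset.sum_const, nsmul_eq_mul]
        have h5 : ∀ u ∈ W, (((W.erase u).card : ℝ) * (1 / Fintype.card ι))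
            ≤ m * (1 / Fintype.card ι) := fun u _ => by
          refine mul_le_mul_of_nonneg_right ?_ (by positivity)
          exact_mod_cast (Finset.card_le_card (Finset.erase_subset _ _)).trans hW
        refine (Finset.sum_le_sum h5).trans ?_
        rw [Finset.sum_const, nsmul_eq_mul]
        exact mul_le_mul_of_nonneg_right h3 (by positivity)
    _ ≤ 1 - ∑ u ∈ W, ∑ v ∈ W.erase u, 𝔼 z : ι → ι, ind (z u = z v) :=
        sub_le_sub_left (Finset.sum_le_sum fun u hu => Finset.sum_le_sum fun v hv =>
          h2 u hu v hv) _
    _ = 𝔼 z : ι → ι, (1 - ∑ u ∈ W, ∑ v ∈ W.erase u, ind (z u = z v)) := by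
        rw [Finset.expect_sub_distrib, Fintype.expect_const, Finset.expect_sum_comm]
        congr 1
        exact Finset.sum_congr rfl fun u _ => (Finset.expect_sum_comm _ _ _).symm
    _ ≤ _ := Finset.expect_le_expect fun z _ => h1 z

/-- On few coordinates, both latent laws have density at most two with respect to the uniform law
on all functions. -/
lemma latentE_le [Nonempty ι] (S : Sampling) {W : Finset ι} {m : ℕ} (hW : W.card ≤ m)
    (hm : 2 * m ^ 2 ≤ Fintype.card ι) {h : (ι → ι) → ℝ} (hh : DependsOn h (W : Set ι))
    (h0 : ∀ z, 0 ≤ h z) : latentE S h ≤ 2 * 𝔼 z, h z := by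
  have hE : 0 ≤ 𝔼 z, h z := Finset.expect_nonneg fun z _ => h0 z
  cases S with
  | independent => exact (by linarith : 𝔼 z, h z ≤ 2 * 𝔼 z, h z)
  | permutation =>
    change 𝔼 σ : Equiv.Perm ι, h σ ≤ _
    have h1 := half_le_expect_injOn hW hm
    have h2 := expect_injOn_mul hh
    have h3 : 0 ≤ 𝔼 σ : Equiv.Perm ι, h σ := Finset.expect_nonneg fun z _ => h0 z
    have h4 : 𝔼 z : ι → ι, ind (Set.InjOn z W) * h z ≤ 𝔼 z, h z :=
      Finset.expect_le_expect fun z _ => mul_le_of_le_one_left (h0 z) (ind_le_one _)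
    nlinarith

/-- A nonnegative function of the labels of a block `V`, of size at most `b` on average, also when
two labels, one inside and one outside the block, are required to coincide. -/
structure Block (V : Finset ι) (T : (ι → ι) → ℝ) (b : ℝ) : Prop where
  nonempty : V.Nonempty
  nonneg : ∀ z, 0 ≤ T z
  dependsOn : DependsOn T (V : Set ι)
  le : ∀ g : (ι → ι) → ℝ, DependsOn g (V : Set ι)ᶜ → (∀ z, 0 ≤ g z) →
    𝔼 z, g z * T z ≤ (𝔼 z, g z) * b
  hit_le : ∀ g : (ι → ι) → ℝ, DependsOn g (V : Set ι)ᶜ → (∀ z, 0 ≤ g z) →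
    ∀ v ∈ V, ∀ r ∉ V, 𝔼 z, g z * (T z * ind (z v = z r)) ≤ (𝔼 z, g z) * (b / Fintype.card ι)

lemma Block.expect_le [Nonempty ι] {V : Finset ι} {T : (ι → ι) → ℝ} {b : ℝ} (h : Block V T b) :
    𝔼 z, T z ≤ b := by
  have := h.le (fun _ => 1) (fun _ _ _ => rfl) (fun _ => zero_le_one)
  simpa using this

lemma Block.bound_nonneg [Nonempty ι] {V : Finset ι} {T : (ι → ι) → ℝ} {b : ℝ}
    (h : Block V T b) : 0 ≤ b :=
  (Finset.expect_nonneg fun z _ => h.nonneg z).trans h.expect_le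

lemma Block.latentE_le [Nonempty ι] {V : Finset ι} {T : (ι → ι) → ℝ} {b : ℝ} (h : Block V T b)
    (S : Sampling) {m : ℕ} (hV : V.card ≤ m) (hm : 2 * m ^ 2 ≤ Fintype.card ι) :
    latentE S T ≤ 2 * b :=
  (LatentGraph.latentE_le S hV hm h.dependsOn h.nonneg).trans
    (mul_le_mul_of_nonneg_left h.expect_le zero_le_two)

/-- Under the uniform law on functions, the centering of a block by its average over permutations
is exact once restricted to the assignments which are injective on the block. -/
lemma Block.centeredBlock [Nonempty ι] {V : Finset ι} {T : (ι → ι) → ℝ} {b : ℝ}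
    (h : Block V T b) {m : ℕ} (hV : V.card ≤ m) (hm : 2 * m ^ 2 ≤ Fintype.card ι) :
    CenteredBlock V (fun z => (T z - latentE .permutation T) * ind (Set.InjOn z V)) (3 * b) := by
  set μ := latentE .permutation T with hμ
  have hμ0 : 0 ≤ μ := latentE_nonneg h.nonneg
  have hμb : μ ≤ 2 * b := h.latentE_le _ hV hm
  have hb : 0 ≤ b := h.bound_nonneg
  have habs : ∀ z : ι → ι, |(T z - μ) * ind (Set.InjOn z V)| ≤ T z + μ := by
    intro z
    rw [abs_mul, abs_of_nonneg (ind_nonneg _)]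
    refine (mul_le_of_le_one_right (abs_nonneg _) (ind_le_one _)).trans ?_
    have := h.nonneg z
    rw [abs_le]
    constructor <;> linarith
  refine ⟨h.nonempty, by positivity, ?_, ?_, ?_, ?_⟩
  · intro z z' hz
    have h1 := h.dependsOn hz
    have h2 := dependsOn_injOn (subset_refl (V : Set ι)) hz
    simp only at h2
    simp only [h1, h2]
  · have h1 := expect_injOn_mul (W := V) (h := fun z => T z - μ)
      (fun z z' hz => by simp only [h.dependsOn hz])
    rw [Finset.expect_sub_distrib, Fintype.expect_const] at h1
    have h2 : 𝔼 σ : Equiv.Perm ι, T σ = μ := rfl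
    rw [h2, sub_self, mul_zero] at h1
    rw [← h1]
    exact Finset.expect_congr rfl fun z _ => mul_comm _ _
  · intro g hg hg0
    calc _ ≤ 𝔼 z, (g z * T z + g z * μ) := by
          refine Finset.expect_le_expect fun z _ => ?_
          rw [← mul_add]
          exact mul_le_mul_of_nonneg_left (habs z) (hg0 z)
      _ = 𝔼 z, g z * T z + (𝔼 z, g z) * μ := by
          rw [Finset.expect_add_distrib, Finset.expect_mul]
      _ ≤ (𝔼 z, g z) * b + (𝔼 z, g z) * (2 * b) :=
          add_le_add (h.le g hg hg0) (mul_le_mul_of_nonneg_left hμb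
            (Finset.expect_nonneg fun z _ => hg0 z))
      _ = _ := by ring
  · intro g hg hg0 v hv r hr
    have hvr : v ≠ r := fun h => hr (h ▸ hv)
    have h1 := expect_mul_ind_eq_le (ι := ι) (κ := ι) (g := g) hvr
      (hg.mono (by simpa using hv)) hg0
    calc _ ≤ 𝔼 z, (g z * (T z * ind (z v = z r)) + g z * ind (z v = z r) * μ) := by
          refine Finset.expect_le_expect fun z _ => ?_
          have : g z * (T z * ind (z v = z r)) + g z * ind (z v = z r) * μ
            = g z * ((T z + μ) * ind (z v = z r)) := by ring
          rw [this]
          exact mul_le_mul_of_nonneg_left (mul_le_mul_of_nonneg_right (habs z) (ind_nonneg _))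
            (hg0 z)
      _ = 𝔼 z, g z * (T z * ind (z v = z r)) + (𝔼 z, g z * ind (z v = z r)) * μ := by
          rw [Finset.expect_add_distrib, Finset.expect_mul]
      _ ≤ (𝔼 z, g z) * (b / Fintype.card ι) + (𝔼 z, g z) * (1 / Fintype.card ι) * (2 * b) := by
          refine add_le_add (h.hit_le g hg hg0 v hv r hr) (mul_le_mul h1 hμb hμ0 ?_)
          exact mul_nonneg (Finset.expect_nonneg fun z _ => hg0 z) (by positivity)
      _ = _ := by ring

variable {J : Type*} [DecidableEq J]

lemma injOn_union_biUnion_iff {V : J → Finset ι} {I : Finset J} {R : Finset ι}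
    (hVR : ∀ i ∈ I, Disjoint (V i) R) (hVV : ∀ i ∈ I, ∀ j ∈ I, i ≠ j → Disjoint (V i) (V j))
    (z : ι → ι) :
    Set.InjOn z (R ∪ I.biUnion V : Finset ι) ↔
      Set.InjOn z R ∧ (∀ i ∈ I, Set.InjOn z (V i)) ∧ Sep V I R z := by
  constructor
  · intro h
    have hR : ∀ r ∈ R, r ∈ (R ∪ I.biUnion V) := fun r hr => Finset.mem_union_left _ hr
    have hV : ∀ i ∈ I, ∀ v ∈ V i, v ∈ (R ∪ I.biUnion V) := fun i hi v hv =>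
      Finset.mem_union_right _ (Finset.mem_biUnion.2 ⟨i, hi, hv⟩)
    refine ⟨h.mono fun r hr => hR r hr, fun i hi => h.mono fun v hv => hV i hi v hv, ?_, ?_⟩
    · rintro i hi ⟨a, ha, b, hb, hab⟩
      have := h (hV i hi a ha) (hR b hb) hab
      exact Finset.disjoint_left.1 (hVR i hi) ha (this ▸ hb)
    · rintro i hi j hj hij ⟨a, ha, b, hb, hab⟩
      have := h (hV i hi a ha) (hV j hj b hb) hab
      exact Finset.disjoint_left.1 (hVV i hi j hj hij) ha (this ▸ hb)
  · rintro ⟨hR, hV, h1, h2⟩ a ha b hb hab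
    simp only [Finset.coe_union, Set.mem_union, Finset.mem_coe, Finset.mem_biUnion] at ha hb
    rcases ha with ha | ⟨i, hi, ha⟩ <;> rcases hb with hb | ⟨j, hj, hb⟩
    · exact hR ha hb hab
    · exact absurd ⟨b, hb, a, ha, hab.symm⟩ (h1 j hj)
    · exact absurd ⟨a, ha, b, hb, hab⟩ (h1 i hi)
    · by_cases hij : i = j
      · subst hij; exact hV i hi ha hb hab
      · exact absurd ⟨a, ha, b, hb, hab⟩ (h2 i hi j hj hij)

/-- Each centered block costs, besides its size `b i`, a factor of order `n^(-1/2)`. For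
independent labels a centered block makes the average vanish. -/
theorem abs_latentE_mul_prod_le [Nonempty ι] (S : Sampling) {V : J → Finset ι}
    {T : J → (ι → ι) → ℝ} {b : J → ℝ} {m : ℕ} (hm : 4 ≤ m) (hmn : 4 * m ^ 2 ≤ Fintype.card ι)
    {I : Finset J} (hT : ∀ i ∈ I, Block (V i) (T i) (b i))
    (hVV : ∀ i ∈ I, ∀ j ∈ I, i ≠ j → Disjoint (V i) (V j)) {R : Finset ι} {g : (ι → ι) → ℝ}
    (hVR : ∀ i ∈ I, Disjoint (V i) R) (hcard : (R ∪ I.biUnion V).card ≤ m)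
    (hg : DependsOn g (R : Set ι)) (hg0 : ∀ z, 0 ≤ g z) :
    |latentE S fun z => g z * ∏ i ∈ I, (T i z - latentE S (T i))|
      ≤ 2 * (𝔼 z, g z) * ∏ i ∈ I, (3 * b i * (m ^ 2 / √(Fintype.card ι))) := by
  have hE : 0 ≤ 𝔼 z, g z := Finset.expect_nonneg fun z _ => hg0 z
  have hb : ∀ i ∈ I, 0 ≤ 3 * b i * (m ^ 2 / √(Fintype.card ι)) := fun i hi => by
    have := (hT i hi).bound_nonneg
    positivity
  have hm2 : 2 * m ^ 2 ≤ Fintype.card ι := by nlinarith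
  cases S with
  | independent =>
    change |𝔼 z, g z * ∏ i ∈ I, (T i z - 𝔼 z, T i z)| ≤ _
    rcases I.eq_empty_or_nonempty with rfl | ⟨s, hs⟩
    · simp only [Finset.prod_empty, mul_one]
      rw [abs_of_nonneg hE]
      linarith
    · have hzero : 𝔼 z, g z * ∏ i ∈ I, (T i z - 𝔼 z, T i z) = 0 := by
        have h1 := expect_mul_of_dependsOn (f := fun z => T s z - 𝔼 z, T s z)
          (g := fun z => g z * ∏ i ∈ I.erase s, (T i z - 𝔼 z, T i z)) (V s)
          (fun z z' hz => by simp only [(hT s hs).dependsOn hz])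
          ((hg.mono fun v hv hvs => Finset.disjoint_left.1 (hVR s hs) hvs hv).mul
            (DependsOn.prod fun i hi z z' hz => by
              obtain ⟨his, hiI⟩ := Finset.mem_erase.1 hi
              simp only [(hT i hiI).dependsOn fun v hv => hz v fun hvs =>
                Finset.disjoint_left.1 (hVV i hiI s hs his) hv hvs]))
        rw [Finset.expect_sub_distrib, Fintype.expect_const, sub_self, zero_mul] at h1
        rw [← h1]
        refine Finset.expect_congr rfl fun z _ => ?_
        rw [← Finset.mul_prod_erase I _ hs]
        ring
      rw [hzero, abs_zero]
      exact mul_nonneg (by positivity) (Finset.prod_nonneg hb)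
  | permutation =>
    -- Injectivity on the union of the blocks is injectivity on each of them, plus their separation.
    set W := R ∪ I.biUnion V with hW
    set μ : J → ℝ := fun i => latentE .permutation (T i) with hμ
    have hRW : (R : Set ι) ⊆ W := by exact_mod_cast Finset.subset_union_left
    have hVW : ∀ i ∈ I, V i ⊆ W := fun i hi =>
      (Finset.subset_biUnion_of_mem V hi).trans Finset.subset_union_right
    have hhalf := half_le_expect_injOn hcard hm2
    have htr := expect_injOn_mul (W := W)
      (h := fun z => g z * ∏ i ∈ I, (T i z - μ i))
      ((hg.mono hRW).mul (DependsOn.prod fun i hi z z' hz => by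
        simp only [(hT i hi).dependsOn fun v hv => hz v (hVW i hi hv)]))
    have hcl := abs_expect_sep_le hm hmn I
      (X := fun i z => (T i z - μ i) * ind (Set.InjOn z (V i))) (b := fun i => 3 * b i)
      (fun i hi => (hT i hi).centeredBlock ((Finset.card_le_card (hVW i hi)).trans hcard) hm2)
      hVV R (fun z => g z * ind (Set.InjOn z R)) hVR hcard
      (hg.mul (dependsOn_ind (dependsOn_injOn subset_rfl)))
    have hpt : ∀ z : ι → ι, ind (Set.InjOn z W) * (g z * ∏ i ∈ I, (T i z - μ i))
        = g z * ind (Set.InjOn z R) * (∏ i ∈ I, ((T i z - μ i) * ind (Set.InjOn z (V i))))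
          * ind (Sep V I R z) := by
      intro z
      rw [Finset.prod_mul_distrib]
      have hiff := injOn_union_biUnion_iff hVR hVV z
      by_cases hz : Set.InjOn z W
      · obtain ⟨h1, h2, h3⟩ := hiff.1 hz
        rw [ind_true hz, ind_true h1, ind_true h3, Finset.prod_congr rfl fun i hi =>
          ind_true (h2 i hi), Finset.prod_const_one]
        ring
      · rw [ind_false hz]
        by_cases h1 : Set.InjOn z R
        · by_cases h3 : Sep V I R z
          · have : ∃ i ∈ I, ¬ Set.InjOn z (V i) := by
              by_contra hcon
              push Not at hcon
              exact hz (hiff.2 ⟨h1, hcon, h3⟩)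
            obtain ⟨i, hi, hin⟩ := this
            rw [Finset.prod_eq_zero (f := fun i => ind (Set.InjOn z (V i))) hi (ind_false hin)]
            ring
          · rw [ind_false h3]; ring
        · rw [ind_false h1]; ring
    rw [Finset.expect_congr rfl fun z _ => hpt z] at htr
    have hgE : 𝔼 z : ι → ι, |g z * ind (Set.InjOn z R)| ≤ 𝔼 z, g z := by
      refine Finset.expect_le_expect fun z _ => ?_
      rw [abs_of_nonneg (mul_nonneg (hg0 z) (ind_nonneg _))]
      exact mul_le_of_le_one_right (hg0 z) (ind_le_one _)
    rw [htr, abs_mul, abs_of_nonneg (by linarith)] at hcl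
    change |𝔼 σ : Equiv.Perm ι, g σ * ∏ i ∈ I, (T i σ - μ i)| ≤ _
    have h5 := mul_le_mul_of_nonneg_right hgE (Finset.prod_nonneg hb)
    have h6 := mul_le_mul_of_nonneg_right hhalf
      (abs_nonneg (𝔼 σ : Equiv.Perm ι, g σ * ∏ i ∈ I, (T i σ - μ i)))
    linarith

end LatentAverage

/-! ### The signal matrix and the latent law -/

section Model

/-- A label is linked to at most `2 * k` labels. The factor `2` is needed for Toeplitz seriation
only, where there may be `k + 1` of them. -/
lemma Planted.card_linked_le {n k : ℕ} (hk : 1 ≤ k) (M : Planted) (b : Fin n)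
    (s : Finset (Fin n)) (hs : ∀ x ∈ s, M.Linked k x b) : s.card ≤ 2 * k := by
  rw [← Finset.card_map Fin.valEmbedding]
  cases M with
  | HS =>
    refine (Finset.card_le_card (t := Finset.range k) fun i hi => ?_).trans (by simp; omega)
    obtain ⟨x, hx, rfl⟩ := Finset.mem_map.1 hi
    exact Finset.mem_range.2 (hs x hx).1
  | SBM =>
    refine (Finset.card_le_card (t := Finset.Ico (k * (b / k)) (k * (b / k) + k))
      fun i hi => ?_).trans (by simp; omega)
    obtain ⟨x, hx, rfl⟩ := Finset.mem_map.1 hi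
    have h : (x : ℕ) / k = (b : ℕ) / k := hs x hx
    rw [Finset.mem_Ico, ← h]
    exact ⟨Nat.mul_div_le _ _, Nat.lt_mul_div_succ _ (by omega)⟩
  | TS =>
    refine (Finset.card_le_card (t := Finset.Icc ((b : ℕ) - k / 2) (b + k / 2))
      fun i hi => ?_).trans (by simp; omega)
    obtain ⟨x, hx, rfl⟩ := Finset.mem_map.1 hi
    have h : |((x : ℕ) : ℝ) - ((b : ℕ) : ℝ)| ≤ (k : ℝ) / 2 := hs x hx
    rw [abs_le] at h
    have h1 : 2 * (x : ℕ) ≤ 2 * (b : ℕ) + k := by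
      have : (2 * (x : ℕ) : ℝ) ≤ 2 * (b : ℕ) + k := by linarith [h.2]
      exact_mod_cast this
    have h2 : 2 * (b : ℕ) ≤ 2 * (x : ℕ) + k := by
      have : (2 * (b : ℕ) : ℝ) ≤ 2 * (x : ℕ) + k := by linarith [h.1]
      exact_mod_cast this
    rw [Finset.mem_Icc]
    change (b : ℕ) - k / 2 ≤ x ∧ (x : ℕ) ≤ b + k / 2
    omega

lemma expect_theta_le {n k : ℕ} (hk : 1 ≤ k) (M : Planted) {lam : ℝ} (hlam : 0 ≤ lam)
    (b : Fin n) : 𝔼 x : Fin n, theta M k lam x b ≤ lam * (2 * k / n) := by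
  classical
  have hn : (0 : ℝ) < n := by exact_mod_cast b.pos
  rw [Fintype.expect_eq_sum_div_card, Fintype.card_fin, div_le_iff₀ hn]
  have h1 : ∑ x : Fin n, theta M k lam x b
      = ((Finset.univ.filter fun x => M.Linked k x b).card : ℝ) * lam := by
    simp only [theta]
    rw [← Finset.sum_filter, Finset.sum_const, nsmul_eq_mul]
  have h2 : ((Finset.univ.filter fun x => M.Linked k x b).card : ℝ) ≤ 2 * k := by
    exact_mod_cast Planted.card_linked_le hk M b _ fun x hx => (Finset.mem_filter.1 hx).2
  rw [h1]
  calc _ ≤ 2 * k * lam := mul_le_mul_of_nonneg_right h2 hlam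
    _ = _ := by field_simp

lemma theta_nonneg {n k : ℕ} (M : Planted) {lam : ℝ} (hlam : 0 ≤ lam) (a b : Fin n) :
    0 ≤ theta M k lam a b := by
  unfold theta; split_ifs <;> simp [hlam]

lemma theta_le {n k : ℕ} (M : Planted) {lam : ℝ} (hlam : 0 ≤ lam) (a b : Fin n) :
    theta M k lam a b ≤ lam := by
  unfold theta; split_ifs <;> simp [hlam]

lemma pairTheta_eq {n k : ℕ} (M : Planted) {lam : ℝ} (z : Fin n → Fin n) {e : Pair n}
    {u w : Fin n} (h : e.1 = s(u, w)) : pairTheta M k lam z e = theta M k lam (z u) (z w) := by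
  rw [pairTheta, h, Sym2.lift_mk]

lemma edgeWeight_pairTheta {n k : ℕ} (hk : 1 ≤ k) (M : Planted) {lam : ℝ} (hlam : 0 ≤ lam) :
    EdgeWeight (n := n) lam (2 * k / n) (pairTheta M k lam) where
  lam_nonneg := hlam
  p_nonneg := by positivity
  nonneg z e := by
    obtain ⟨⟨u, w⟩, h⟩ : ∃ a : Fin n × Fin n, s(a.1, a.2) = e.1 := Sym2.mk_surjective e.1
    rw [pairTheta_eq M z h.symm]
    exact theta_nonneg M hlam _ _
  le z e := by
    obtain ⟨⟨u, w⟩, h⟩ : ∃ a : Fin n × Fin n, s(a.1, a.2) = e.1 := Sym2.mk_surjective e.1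
    rw [pairTheta_eq M z h.symm]
    exact theta_le M hlam _ _
  dependsOn e := by
    intro z z' hz
    obtain ⟨⟨u, w⟩, h⟩ : ∃ a : Fin n × Fin n, s(a.1, a.2) = e.1 := Sym2.mk_surjective e.1
    have hu : z u = z' u := hz u (by simp [← h])
    have hw : z w = z' w := hz w (by simp [← h])
    simp only [pairTheta_eq M _ h.symm, hu, hw]
  update_le e u hu z := by
    obtain ⟨w, hw⟩ := Sym2.mem_iff_exists.1 hu
    have huw : w ≠ u := by
      rintro rfl
      exact e.2 (by rw [hw]; exact Sym2.mk_isDiag_iff.2 rfl)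
    simp only [pairTheta_eq M _ hw, Function.update_self, Function.update_of_ne huw]
    exact expect_theta_le hk M hlam _

lemma integral_uniformOn_finset {Ω : Type*} [Fintype Ω] [MeasurableSpace Ω]
    [MeasurableSingletonClass Ω] (s : Finset Ω) (f : Ω → ℝ) :
    ∫ x, f x ∂(uniformOn (s : Set Ω)) = 𝔼 x ∈ s, f x := by
  classical
  rcases s.eq_empty_or_nonempty with rfl | hs
  · simp
  have := isProbabilityMeasure_uniformOn s.finite_toSet hs
  rw [integral_fintype .of_finite, Finset.expect_eq_sum_div_card, Finset.sum_div]
  have : ∀ x : Ω, (uniformOn (s : Set Ω)).real {x} = if x ∈ s then (s.card : ℝ)⁻¹ else 0 := by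
    intro x
    rw [measureReal_def, ← Finset.coe_singleton, uniformOn_apply_finset]
    split_ifs with h
    · rw [Finset.inter_singleton_of_mem h]
      simp
    · rw [Finset.inter_singleton_of_notMem h]
      simp
  simp only [this, smul_eq_mul, ite_mul, zero_mul, Finset.sum_ite_mem, Finset.univ_inter]
  exact Finset.sum_congr rfl fun x _ => by ring

lemma integral_latentLaw {n : ℕ} (S : Sampling) (f : (Fin n → Fin n) → ℝ) :
    ∫ z, f z ∂(latentLaw n S) = latentE S f := by
  classical
  cases S with
  | independent =>
    have := integral_uniformOn_finset (Finset.univ : Finset (Fin n → Fin n)) f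
    rw [Finset.coe_univ] at this
    exact this
  | permutation =>
    have := integral_uniformOn_finset
      (Finset.univ.filter fun z : Fin n → Fin n => Function.Bijective z) f
    rw [Finset.coe_filter_univ] at this
    refine this.trans ?_
    symm
    refine Finset.expect_nbij (fun σ : Equiv.Perm (Fin n) => (σ : Fin n → Fin n)) ?_ ?_ ?_ ?_
    · intro σ _
      exact Finset.mem_coe.2 (Finset.mem_filter.2 ⟨Finset.mem_univ _, σ.bijective⟩)
    · intro σ _
      rfl
    · intro σ _ τ _ h
      exact DFunLike.coe_injective h
    · intro z hz
      have hz : Function.Bijective z := (Finset.mem_filter.1 (Finset.mem_coe.1 hz)).2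
      exact ⟨Equiv.ofBijective z hz, by simp, rfl⟩

instance {n : ℕ} (M : Planted) (k : ℕ) (lam q : ℝ) (z : Fin n → Fin n) :
    IsProbabilityMeasure (condLaw M k lam q z) := by
  unfold condLaw; infer_instance

lemma isProbabilityMeasure_latentLaw (n : ℕ) [Nonempty (Fin n)] (S : Sampling) :
    IsProbabilityMeasure (latentLaw n S) := by
  cases S with
  | independent => exact isProbabilityMeasure_uniformOn Set.finite_univ Set.univ_nonempty
  | permutation => exact isProbabilityMeasure_uniformOn (Set.toFinite _) ⟨id, Function.bijective_id⟩

end Model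

/-! ### Moments given the latent assignment -/

section Moments

instance {n : ℕ} [Nonempty (Fin n)] (M : Planted) (S : Sampling) (k : ℕ) (lam q : ℝ) :
    IsProbabilityMeasure (obsLaw M S n k lam q) := by
  have := isProbabilityMeasure_latentLaw n S
  refine ⟨?_⟩
  rw [obsLaw, Measure.bind_apply MeasurableSet.univ (measurable_of_countable _).aemeasurable]
  simp

lemma integral_obsLaw {n : ℕ} [Nonempty (Fin n)] (M : Planted) (S : Sampling) (k : ℕ)
    (lam q : ℝ) (f : Obs n → ℝ) :
    ∫ y, f y ∂(obsLaw M S n k lam q) = latentE S fun z => ∫ y, f y ∂(condLaw M k lam q z) := by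
  have := isProbabilityMeasure_latentLaw n S
  have h : ∀ y : Obs n, (obsLaw M S n k lam q).real {y}
      = ∫ z, (condLaw M k lam q z).real {y} ∂(latentLaw n S) := by
    intro y
    rw [measureReal_def, obsLaw, Measure.bind_apply (MeasurableSet.singleton y)
      (measurable_of_countable _).aemeasurable]
    exact (integral_toReal (measurable_of_countable _).aemeasurable
      (Filter.Eventually.of_forall fun z => measure_lt_top _ _)).symm
  rw [← integral_latentLaw, integral_fintype .of_finite]
  simp only [h, smul_eq_mul]
  have h2 : ∀ z, ∫ y, f y ∂(condLaw M k lam q z)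
      = ∑ y, (condLaw M k lam q z).real {y} * f y := fun z => by
    rw [integral_fintype .of_finite]; rfl
  simp only [h2]
  rw [integral_finsetSum _ fun _ _ => .of_finite]
  exact Finset.sum_congr rfl fun y _ => (integral_mul_const _ _).symm

/-- The monomial of a set of edges. -/
noncomputable def edgeMonomial {n : ℕ} (q : ℝ) (A : Finset (Pair n)) (y : Obs n) : ℝ :=
  ∏ e ∈ A, centered q y e

/-- The conditional expectation of the product of the monomials of `A` and of `B`, given the edge
weights `t`. -/
noncomputable def mixedMoment {n : ℕ} (q : ℝ) (t : Pair n → ℝ) (A B : Finset (Pair n)) : ℝ :=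
  (∏ e ∈ A ∩ B, (q * (1 - q) + (1 - 2 * q) * t e)) * ∏ e ∈ symmDiff A B, t e

/-- An edge of both sets contributes the second moment `q (1 - q) + (1 - 2 q) Θ` of the centered
adjacency, and an edge of exactly one of them the mean `Θ`. -/
lemma integral_edgeMonomial_mul {n k : ℕ} {lam q : ℝ} (hk : 1 ≤ k) (M : Planted)
    (hlam : 0 ≤ lam) (hq : 0 ≤ q) (hql : lam ≤ 1 - q) (z : Fin n → Fin n)
    (A B : Finset (Pair n)) :
    ∫ y, edgeMonomial q A y * edgeMonomial q B y ∂(condLaw M k lam q z)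
      = mixedMoment q (pairTheta M k lam z) A B := by
  have hθ := edgeWeight_pairTheta (n := n) hk M hlam
  set t := pairTheta M k lam z with ht
  have hp : ∀ e, ((Set.projIcc (0 : ℝ) 1 zero_le_one (q + t e) : unitInterval) : ℝ) = q + t e := by
    intro e
    rw [Set.projIcc_of_mem zero_le_one
      ⟨add_nonneg hq (hθ.nonneg z e), by linarith [hθ.le z e]⟩]
  have h1 : ∀ y : Obs n, edgeMonomial q A y * edgeMonomial q B y
      = ∏ e, ((if e ∈ A then ((if y e then 1 else 0) - q) else 1)
          * (if e ∈ B then ((if y e then 1 else 0) - q) else 1)) := by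
    intro y
    rw [Finset.prod_mul_distrib, Finset.prod_ite_mem, Finset.prod_ite_mem, Finset.univ_inter,
      Finset.univ_inter]
    rfl
  simp only [h1]
  rw [condLaw, integral_fintype_prod_eq_prod (fun e (b : Bool) =>
    ((if e ∈ A then ((if b then (1 : ℝ) else 0) - q) else 1)
      * (if e ∈ B then ((if b then (1 : ℝ) else 0) - q) else 1)))]
  simp only [integral_bernoulliMeasure, ← ht, hp]
  have hind : ∀ (s : Finset (Pair n)) (f : Pair n → ℝ),
      ∏ e ∈ s, f e = ∏ e, if e ∈ s then f e else 1 := fun s f => by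
    rw [Finset.prod_ite_mem, Finset.univ_inter]
  rw [mixedMoment, hind (A ∩ B), hind (symmDiff A B), ← Finset.prod_mul_distrib]
  refine Finset.prod_congr rfl fun e _ => ?_
  by_cases hA : e ∈ A <;> by_cases hB : e ∈ B <;>
    simp [hA, hB, Finset.mem_symmDiff] <;> ring

lemma edgeMonomial_union {n : ℕ} (q : ℝ) {A B : Finset (Pair n)} (h : Disjoint A B) (y : Obs n) :
    edgeMonomial q (A ∪ B) y = edgeMonomial q A y * edgeMonomial q B y :=
  Finset.prod_union h

lemma mixedMoment_union {n : ℕ} (q : ℝ) (t : Pair n → ℝ) {A B C : Finset (Pair n)}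
    (hA : Disjoint C A) (hB : Disjoint C B) :
    mixedMoment q t (A ∪ C) B = mixedMoment q t A B * ∏ e ∈ C, t e := by
  have h1 : (A ∪ C) ∩ B = A ∩ B := by
    rw [Finset.union_inter_distrib_right, Finset.disjoint_iff_inter_eq_empty.1 hB,
      Finset.union_empty]
  have h2 : symmDiff (A ∪ C) B = symmDiff A B ∪ C := by
    ext e
    have h3 : e ∈ C → e ∉ A := fun h h' => Finset.disjoint_left.1 hA h h'
    have h4 : e ∈ C → e ∉ B := fun h h' => Finset.disjoint_left.1 hB h h'
    simp only [Finset.mem_symmDiff, Finset.mem_union]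
    tauto
  have h3 : Disjoint (symmDiff A B) C := by
    rw [Finset.disjoint_left]
    intro e he heC
    rcases Finset.mem_symmDiff.1 he with h | h
    · exact Finset.disjoint_left.1 hA heC h.1
    · exact Finset.disjoint_left.1 hB heC h.1
  rw [mixedMoment, mixedMoment, h1, h2, Finset.prod_union h3, mul_assoc]

/-- Given the latent assignment, edge-disjoint monomials are independent. -/
lemma integral_edgeMonomial_mul_prod {n k : ℕ} {lam q : ℝ} (hk : 1 ≤ k) (M : Planted)
    (hlam : 0 ≤ lam) (hq : 0 ≤ q) (hql : lam ≤ 1 - q) (z : Fin n → Fin n)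
    (μ : Finset (Pair n) → ℝ) (𝒞 : Finset (Finset (Pair n))) :
    (∀ C ∈ 𝒞, ∀ C' ∈ 𝒞, C ≠ C' → Disjoint C C') →
    ∀ (A B : Finset (Pair n)), (∀ C ∈ 𝒞, Disjoint C A) → (∀ C ∈ 𝒞, Disjoint C B) →
    ∫ y, edgeMonomial q A y * edgeMonomial q B y * ∏ C ∈ 𝒞, (edgeMonomial q C y - μ C)
        ∂(condLaw M k lam q z)
      = mixedMoment q (pairTheta M k lam z) A B
        * ∏ C ∈ 𝒞, (∏ e ∈ C, pairTheta M k lam z e - μ C) := by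
  induction 𝒞 using Finset.induction_on with
  | empty =>
    intro _ A B _ _
    simp only [Finset.prod_empty, mul_one]
    exact integral_edgeMonomial_mul hk M hlam hq hql z A B
  | insert C 𝒞 hC ih =>
    intro hdis A B hA hB
    have hdis' : ∀ C' ∈ 𝒞, Disjoint C' C := fun C' hC' =>
      hdis C' (Finset.mem_insert_of_mem hC') C (Finset.mem_insert_self _ _) fun h => hC (h ▸ hC')
    have hCA := hA C (Finset.mem_insert_self _ _)
    have hCB := hB C (Finset.mem_insert_self _ _)
    have ih' := ih fun C₁ h₁ C₂ h₂ => hdis C₁ (Finset.mem_insert_of_mem h₁) C₂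
      (Finset.mem_insert_of_mem h₂)
    have e1 := ih' (A ∪ C) B
      (fun C' hC' => Finset.disjoint_union_right.2
        ⟨hA C' (Finset.mem_insert_of_mem hC'), hdis' C' hC'⟩)
      (fun C' hC' => hB C' (Finset.mem_insert_of_mem hC'))
    have e2 := ih' A B (fun C' hC' => hA C' (Finset.mem_insert_of_mem hC'))
      (fun C' hC' => hB C' (Finset.mem_insert_of_mem hC'))
    have hpt : ∀ y : Obs n, edgeMonomial q A y * edgeMonomial q B y *
        ∏ C ∈ insert C 𝒞, (edgeMonomial q C y - μ C)
        = edgeMonomial q (A ∪ C) y * edgeMonomial q B y * ∏ C ∈ 𝒞, (edgeMonomial q C y - μ C)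
          - μ C * (edgeMonomial q A y * edgeMonomial q B y *
            ∏ C ∈ 𝒞, (edgeMonomial q C y - μ C)) := fun y => by
      rw [Finset.prod_insert hC, edgeMonomial_union q hCA.symm]
      ring
    simp only [hpt]
    rw [integral_sub .of_finite .of_finite, integral_const_mul, e1, e2,
      mixedMoment_union q _ hCA hCB, Finset.prod_insert hC]
    ring

end Moments

/-! ### Labelled graphs and their overlaps -/

section Configurations

variable {n : ℕ}

/-- The vertices covered by a set of edges. -/
def verts (A : Finset (Pair n)) : Finset (Fin n) := A.biUnion fun e => e.1.toFinset

lemma mem_verts {A : Finset (Pair n)} {v : Fin n} : v ∈ verts A ↔ ∃ e ∈ A, v ∈ e.1 := by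
  simp [verts]

lemma verts_mono {A B : Finset (Pair n)} (h : A ⊆ B) : verts A ⊆ verts B :=
  Finset.biUnion_subset_biUnion_of_subset_left _ h

lemma card_verts_le (A : Finset (Pair n)) : (verts A).card ≤ 2 * A.card := by
  rw [mul_comm]
  refine Finset.card_biUnion_le_card_mul _ _ _ fun e _ => ?_
  rw [Sym2.card_toFinset]
  split_ifs <;> omega

lemma disjoint_of_disjoint_verts {A B : Finset (Pair n)} (h : Disjoint (verts A) (verts B)) :
    Disjoint A B := by
  rw [Finset.disjoint_left] at h ⊢
  intro e hA hB
  obtain ⟨v, hv⟩ : ∃ v, v ∈ e.1 := ⟨_, Sym2.out_fst_mem e.1⟩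
  exact h (mem_verts.2 ⟨e, hA, hv⟩) (mem_verts.2 ⟨e, hB, hv⟩)

/-- The graph formed by the edges of `C` is nonempty and connected: every set of vertices which
contains some, but not all, of the vertices covered by `C` is left by an edge of `C`. -/
structure IsConnectedEdges (C : Finset (Pair n)) : Prop where
  nonempty : C.Nonempty
  cut : ∀ U : Finset (Fin n), (∃ u ∈ U, u ∈ verts C) → (∃ w ∈ verts C, w ∉ U) →
    ∃ e ∈ C, ∃ u ∈ U, ∃ w ∉ U, u ∈ e.1 ∧ w ∈ e.1

lemma IsConnectedEdges.verts_nonempty {C : Finset (Pair n)} (h : IsConnectedEdges C) :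
    (verts C).Nonempty := by
  obtain ⟨e, he⟩ := h.nonempty
  exact ⟨_, mem_verts.2 ⟨e, he, Sym2.out_fst_mem e.1⟩⟩

lemma IsConnectedEdges.exits {C : Finset (Pair n)} (h : IsConnectedEdges C) {U : Finset (Fin n)}
    (hU : U ⊆ verts C) (hne : ∃ w ∈ verts C, w ∉ U) : Exits C U := by
  intro U' hU' ⟨u, hu⟩
  obtain ⟨w, hw, hwU⟩ := hne
  exact h.cut U' ⟨u, hu, hU (hU' hu)⟩ ⟨w, hw, fun h => hwU (hU' h)⟩

/-- A labelled graph, given by the edge sets of its connected components. -/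
structure IsConfig (𝒮 : Finset (Finset (Pair n))) : Prop where
  conn : ∀ C ∈ 𝒮, IsConnectedEdges C
  disj : ∀ C ∈ 𝒮, ∀ C' ∈ 𝒮, C ≠ C' → Disjoint (verts C) (verts C')

/-- All the edges of a family of components. -/
def edges (𝒮 : Finset (Finset (Pair n))) : Finset (Pair n) := 𝒮.biUnion id

lemma mem_edges {𝒮 : Finset (Finset (Pair n))} {e : Pair n} : e ∈ edges 𝒮 ↔ ∃ C ∈ 𝒮, e ∈ C := by
  simp [edges]

lemma subset_edges {𝒮 : Finset (Finset (Pair n))} {C : Finset (Pair n)} (h : C ∈ 𝒮) :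
    C ⊆ edges 𝒮 := fun _ he => mem_edges.2 ⟨C, h, he⟩

lemma edges_mono {𝒮 𝒯 : Finset (Finset (Pair n))} (h : 𝒮 ⊆ 𝒯) : edges 𝒮 ⊆ edges 𝒯 :=
  Finset.biUnion_subset_biUnion_of_subset_left _ h

lemma mem_verts_edges {𝒮 : Finset (Finset (Pair n))} {v : Fin n} :
    v ∈ verts (edges 𝒮) ↔ ∃ C ∈ 𝒮, v ∈ verts C := by
  simp only [mem_verts, mem_edges]
  constructor
  · rintro ⟨e, ⟨C, hC, he⟩, hv⟩
    exact ⟨C, hC, e, he, hv⟩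
  · rintro ⟨C, hC, e, he, hv⟩
    exact ⟨e, ⟨C, hC, he⟩, hv⟩

lemma IsConfig.subset {𝒮 𝒯 : Finset (Finset (Pair n))} (h : IsConfig 𝒯) (hs : 𝒮 ⊆ 𝒯) :
    IsConfig 𝒮 :=
  ⟨fun C hC => h.conn C (hs hC), fun C hC C' hC' => h.disj C (hs hC) C' (hs hC')⟩

lemma IsConfig.disjoint {𝒮 : Finset (Finset (Pair n))} (h : IsConfig 𝒮) {C C' : Finset (Pair n)}
    (hC : C ∈ 𝒮) (hC' : C' ∈ 𝒮) (hne : C ≠ C') : Disjoint C C' :=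
  disjoint_of_disjoint_verts (h.disj C hC C' hC' hne)

lemma IsConfig.card_edges {𝒮 : Finset (Finset (Pair n))} (h : IsConfig 𝒮) :
    (edges 𝒮).card = ∑ C ∈ 𝒮, C.card :=
  Finset.card_biUnion fun _ hC _ hC' hne => h.disjoint hC hC' hne

lemma IsConfig.card_le {𝒮 : Finset (Finset (Pair n))} (h : IsConfig 𝒮) :
    𝒮.card ≤ ∑ C ∈ 𝒮, C.card := by
  rw [Finset.card_eq_sum_ones]
  exact Finset.sum_le_sum fun C hC => Finset.card_pos.2 (h.conn C hC).nonempty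

lemma IsConfig.prod_edgeMonomial {𝒮 : Finset (Finset (Pair n))} (h : IsConfig 𝒮) (q : ℝ)
    (y : Obs n) : ∏ C ∈ 𝒮, edgeMonomial q C y = edgeMonomial q (edges 𝒮) y :=
  (Finset.prod_biUnion fun _ hC _ hC' hne => h.disjoint hC hC' hne).symm

/-- The components of a labelled graph are determined by its edges. -/
lemma IsConfig.subset_of_edges_eq {𝒮 𝒯 : Finset (Finset (Pair n))} (h𝒮 : IsConfig 𝒮)
    (h𝒯 : IsConfig 𝒯) (h : edges 𝒮 = edges 𝒯) : 𝒮 ⊆ 𝒯 := by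
  have key : ∀ {𝒮 𝒯 : Finset (Finset (Pair n))}, IsConfig 𝒮 → IsConfig 𝒯 → edges 𝒮 = edges 𝒯 →
      ∀ C ∈ 𝒮, ∀ C' ∈ 𝒯, ∀ e ∈ C, e ∈ C' → C ⊆ C' := by
    intro 𝒮 𝒯 h𝒮 h𝒯 h C hC C' hC' e he he'
    have hmem : ∀ f ∈ C, ∀ v ∈ f.1, v ∈ verts C' → f ∈ C' := by
      intro f hf v hv hvC'
      obtain ⟨C'', hC'', hf''⟩ := mem_edges.1 (h ▸ subset_edges hC hf)
      by_cases heq : C' = C''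
      · exact heq ▸ hf''
      · exact absurd (mem_verts.2 ⟨f, hf'', hv⟩)
          (Finset.disjoint_left.1 (h𝒯.disj C' hC' C'' hC'' heq) hvC')
    have hall : ∀ w ∈ verts C, w ∈ verts C' := by
      by_contra hcon
      push Not at hcon
      have hv := Sym2.out_fst_mem e.1
      obtain ⟨f, hf, u, hu, w, hw, huf, hwf⟩ := (h𝒮.conn C hC).cut (verts C')
        ⟨_, mem_verts.2 ⟨e, he', hv⟩, mem_verts.2 ⟨e, he, hv⟩⟩ hcon
      exact hw (mem_verts.2 ⟨f, hmem f hf u huf hu, hwf⟩)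
    intro f hf
    have hv := Sym2.out_fst_mem f.1
    exact hmem f hf _ hv (hall _ (mem_verts.2 ⟨f, hf, hv⟩))
  intro C hC
  obtain ⟨e, he⟩ := (h𝒮.conn C hC).nonempty
  obtain ⟨C', hC', he'⟩ := mem_edges.1 (h ▸ subset_edges hC he)
  have h1 := key h𝒮 h𝒯 h C hC C' hC' e he he'
  have h2 := key h𝒯 h𝒮 h.symm C' hC' C hC e he' he
  exact (h1.antisymm h2) ▸ hC'

lemma IsConfig.eq_of_edges_eq {𝒮 𝒯 : Finset (Finset (Pair n))} (h𝒮 : IsConfig 𝒮)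
    (h𝒯 : IsConfig 𝒯) (h : edges 𝒮 = edges 𝒯) : 𝒮 = 𝒯 :=
  (h𝒮.subset_of_edges_eq h𝒯 h).antisymm (h𝒯.subset_of_edges_eq h𝒮 h.symm)

/-- The components of `𝒮` which share a vertex with `𝒯`. -/
def touched (𝒮 𝒯 : Finset (Finset (Pair n))) : Finset (Finset (Pair n)) :=
  𝒮.filter fun C => ¬ Disjoint (verts C) (verts (edges 𝒯))

/-- The components of `𝒮` which share no vertex with `𝒯`. -/
def untouched (𝒮 𝒯 : Finset (Finset (Pair n))) : Finset (Finset (Pair n)) :=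
  𝒮.filter fun C => Disjoint (verts C) (verts (edges 𝒯))

lemma touched_subset (𝒮 𝒯 : Finset (Finset (Pair n))) : touched 𝒮 𝒯 ⊆ 𝒮 :=
  Finset.filter_subset _ _

lemma untouched_subset (𝒮 𝒯 : Finset (Finset (Pair n))) : untouched 𝒮 𝒯 ⊆ 𝒮 :=
  Finset.filter_subset _ _

lemma prod_eq_touched_mul_untouched {R : Type*} [CommMonoid R] (𝒮 𝒯 : Finset (Finset (Pair n)))
    (f : Finset (Pair n) → R) :
    ∏ C ∈ 𝒮, f C = (∏ C ∈ touched 𝒮 𝒯, f C) * ∏ C ∈ untouched 𝒮 𝒯, f C := by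
  rw [touched, untouched, mul_comm]
  exact (Finset.prod_filter_mul_prod_filter_not 𝒮
    (fun C => Disjoint (verts C) (verts (edges 𝒯))) f).symm

lemma sum_eq_touched_add_untouched (𝒮 𝒯 : Finset (Finset (Pair n)))
    (f : Finset (Pair n) → ℕ) :
    ∑ C ∈ 𝒮, f C = (∑ C ∈ touched 𝒮 𝒯, f C) + ∑ C ∈ untouched 𝒮 𝒯, f C := by
  rw [touched, untouched, add_comm]
  exact (Finset.sum_filter_add_sum_filter_not 𝒮
    (fun C => Disjoint (verts C) (verts (edges 𝒯))) f).symm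

lemma touched_self {𝒮 : Finset (Finset (Pair n))} (h : IsConfig 𝒮) : touched 𝒮 𝒮 = 𝒮 := by
  refine Finset.filter_true_of_mem fun C hC hd => ?_
  obtain ⟨v, hv⟩ := (h.conn C hC).verts_nonempty
  exact Finset.disjoint_left.1 hd hv (mem_verts_edges.2 ⟨C, hC, hv⟩)

lemma untouched_self {𝒮 : Finset (Finset (Pair n))} (h : IsConfig 𝒮) : untouched 𝒮 𝒮 = ∅ := by
  refine Finset.filter_false_of_mem fun C hC hd => ?_
  obtain ⟨v, hv⟩ := (h.conn C hC).verts_nonempty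
  exact Finset.disjoint_left.1 hd hv (mem_verts_edges.2 ⟨C, hC, hv⟩)

/-- The components of `𝒮` or of `𝒯` which share no vertex with the other graph. -/
def isolatedParts (𝒮 𝒯 : Finset (Finset (Pair n))) : Finset (Finset (Pair n)) :=
  untouched 𝒮 𝒯 ∪ untouched 𝒯 𝒮

lemma disjoint_untouched {𝒮 𝒯 : Finset (Finset (Pair n))} (h𝒮 : IsConfig 𝒮) :
    Disjoint (untouched 𝒮 𝒯) (untouched 𝒯 𝒮) := by
  rw [Finset.disjoint_left]
  intro C hC hC'
  obtain ⟨hC1, hC2⟩ := Finset.mem_filter.1 hC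
  obtain ⟨v, hv⟩ := (h𝒮.conn C hC1).verts_nonempty
  exact Finset.disjoint_left.1 hC2 hv (mem_verts_edges.2 ⟨C, (Finset.mem_filter.1 hC').1, hv⟩)

lemma isConfig_isolatedParts {𝒮 𝒯 : Finset (Finset (Pair n))} (h𝒮 : IsConfig 𝒮)
    (h𝒯 : IsConfig 𝒯) : IsConfig (isolatedParts 𝒮 𝒯) := by
  have hcross : ∀ C ∈ untouched 𝒮 𝒯, ∀ C' ∈ untouched 𝒯 𝒮, Disjoint (verts C) (verts C') := by
    intro C hC C' hC'
    exact (Finset.mem_filter.1 hC).2.mono_right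
      fun v hv => mem_verts_edges.2 ⟨C', untouched_subset _ _ hC', hv⟩
  refine ⟨fun C hC => ?_, fun C hC C' hC' hne => ?_⟩
  · rcases Finset.mem_union.1 hC with h | h
    · exact h𝒮.conn C (untouched_subset _ _ h)
    · exact h𝒯.conn C (untouched_subset _ _ h)
  · rcases Finset.mem_union.1 hC with h | h <;> rcases Finset.mem_union.1 hC' with h' | h'
    · exact h𝒮.disj C (untouched_subset _ _ h) C' (untouched_subset _ _ h') hne
    · exact hcross C h C' h'
    · exact (hcross C' h' C h).symm
    · exact h𝒯.disj C (untouched_subset _ _ h) C' (untouched_subset _ _ h') hne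

lemma disjoint_verts_touched_left {𝒮 𝒯 : Finset (Finset (Pair n))} (h𝒮 : IsConfig 𝒮)
    {C : Finset (Pair n)} (hC : C ∈ isolatedParts 𝒮 𝒯) :
    Disjoint (verts C) (verts (edges (touched 𝒮 𝒯))) := by
  rcases Finset.mem_union.1 hC with h | h
  · rw [Finset.disjoint_left]
    intro v hv hv'
    obtain ⟨C', hC', hvC'⟩ := mem_verts_edges.1 hv'
    have hne : C ≠ C' := by
      rintro rfl
      exact (Finset.mem_filter.1 hC').2 (Finset.mem_filter.1 h).2
    exact Finset.disjoint_left.1 (h𝒮.disj C (untouched_subset _ _ h) C'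
      (touched_subset _ _ hC') hne) hv hvC'
  · exact (Finset.mem_filter.1 h).2.mono_right (verts_mono (edges_mono (touched_subset _ _)))

lemma isolatedParts_comm (𝒮 𝒯 : Finset (Finset (Pair n))) :
    isolatedParts 𝒮 𝒯 = isolatedParts 𝒯 𝒮 := Finset.union_comm _ _

lemma disjoint_verts_touched_right {𝒮 𝒯 : Finset (Finset (Pair n))} (h𝒯 : IsConfig 𝒯)
    {C : Finset (Pair n)} (hC : C ∈ isolatedParts 𝒮 𝒯) :
    Disjoint (verts C) (verts (edges (touched 𝒯 𝒮))) :=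
  disjoint_verts_touched_left h𝒯 (isolatedParts_comm 𝒮 𝒯 ▸ hC)

/-- The vertices which belong to exactly one of two labelled graphs. -/
def unmatched (𝒮 𝒯 : Finset (Finset (Pair n))) : Finset (Fin n) :=
  symmDiff (verts (edges 𝒮)) (verts (edges 𝒯))

lemma unmatched_comm (𝒮 𝒯 : Finset (Finset (Pair n))) : unmatched 𝒮 𝒯 = unmatched 𝒯 𝒮 :=
  symmDiff_comm _ _

/-- A touched component has a matched vertex. -/
lemma exists_mem_verts_notMem_unmatched {𝒮 𝒯 : Finset (Finset (Pair n))} {C : Finset (Pair n)}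
    (hC : C ∈ touched 𝒮 𝒯) : ∃ w ∈ verts C, w ∉ unmatched 𝒮 𝒯 := by
  obtain ⟨hC1, hC2⟩ := Finset.mem_filter.1 hC
  obtain ⟨w, hw, hw'⟩ := Finset.not_disjoint_iff.1 hC2
  refine ⟨w, hw, fun h => ?_⟩
  rcases Finset.mem_symmDiff.1 h with h | h
  · exact h.2 hw'
  · exact h.2 (mem_verts_edges.2 ⟨C, hC1, hw⟩)

/-- The unmatched vertices of a touched component are joined, inside it, to a matched vertex. -/
lemma exits_inter_unmatched {𝒮 𝒯 : Finset (Finset (Pair n))} (h𝒮 : IsConfig 𝒮)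
    {C : Finset (Pair n)} (hC : C ∈ touched 𝒮 𝒯) : Exits C (unmatched 𝒮 𝒯 ∩ verts C) := by
  obtain ⟨w, hw, hwU⟩ := exists_mem_verts_notMem_unmatched hC
  exact (h𝒮.conn C (touched_subset _ _ hC)).exits Finset.inter_subset_right
    ⟨w, hw, fun h => hwU (Finset.mem_inter.1 h).1⟩

/-- The unmatched vertices of touched components are joined to matched vertices by edges which are
not shared by the two graphs. -/
lemma exits_symmDiff {𝒮 𝒯 𝒮₁ 𝒯₁ : Finset (Finset (Pair n))} (h𝒮 : IsConfig 𝒮)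
    (h𝒯 : IsConfig 𝒯) (h𝒮₁ : 𝒮₁ ⊆ touched 𝒮 𝒯) (h𝒯₁ : 𝒯₁ ⊆ touched 𝒯 𝒮) :
    Exits (symmDiff (edges 𝒮₁) (edges 𝒯₁))
      (unmatched 𝒮 𝒯 ∩ (verts (edges 𝒮₁) ∪ verts (edges 𝒯₁))) := by
  have key : ∀ {𝒮 𝒯 𝒮₁ 𝒯₁ : Finset (Finset (Pair n))}, IsConfig 𝒮 → 𝒮₁ ⊆ touched 𝒮 𝒯 →
      𝒯₁ ⊆ 𝒯 → ∀ U' ⊆ unmatched 𝒮 𝒯, ∀ u ∈ U', u ∈ verts (edges 𝒮₁) →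
      ∃ e ∈ edges 𝒮₁ \ edges 𝒯₁, ∃ u ∈ U', ∃ w ∉ U', u ∈ e.1 ∧ w ∈ e.1 := by
    intro 𝒮 𝒯 𝒮₁ 𝒯₁ h𝒮 h𝒮₁ h𝒯₁ U' hU' u hu huS
    obtain ⟨C, hC, huC⟩ := mem_verts_edges.1 huS
    obtain ⟨w, hw, hwU⟩ := exists_mem_verts_notMem_unmatched (h𝒮₁ hC)
    have hC𝒮 := touched_subset _ _ (h𝒮₁ hC)
    obtain ⟨e, he, a, ha, b, hb, hae, hbe⟩ := (h𝒮.conn C hC𝒮).cut U' ⟨u, hu, huC⟩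
      ⟨w, hw, fun h => hwU (hU' h)⟩
    refine ⟨e, Finset.mem_sdiff.2 ⟨subset_edges hC he, fun heT => ?_⟩, a, ha, b, hb, hae, hbe⟩
    have haT : a ∈ verts (edges 𝒯) := mem_verts.2 ⟨e, edges_mono h𝒯₁ heT, hae⟩
    have haS : a ∈ verts (edges 𝒮) := mem_verts.2 ⟨e, subset_edges hC𝒮 he, hae⟩
    rcases Finset.mem_symmDiff.1 (hU' ha) with h | h
    · exact h.2 haT
    · exact h.2 haS
  intro U' hU' ⟨u, hu⟩
  have hU : U' ⊆ unmatched 𝒮 𝒯 := hU'.trans Finset.inter_subset_left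
  rcases Finset.mem_union.1 (Finset.mem_inter.1 (hU' hu)).2 with h | h
  · obtain ⟨e, he, H⟩ := key h𝒮 h𝒮₁ (h𝒯₁.trans (touched_subset _ _)) U' hU u hu h
    exact ⟨e, Finset.mem_symmDiff.2 (Or.inl (Finset.mem_sdiff.1 he)), H⟩
  · obtain ⟨e, he, H⟩ := key h𝒯 h𝒯₁ (h𝒮₁.trans (touched_subset _ _)) U'
      (unmatched_comm 𝒮 𝒯 ▸ hU) u hu h
    exact ⟨e, Finset.mem_symmDiff.2 (Or.inr (Finset.mem_sdiff.1 he)), H⟩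

/-- An unmatched vertex lies in a component of `A` or `B`, in another touched component, or in an
untouched one. -/
lemma card_unmatched_le {𝒮 𝒯 A B : Finset (Finset (Pair n))} :
    (unmatched 𝒮 𝒯).card ≤ (∑ C ∈ A, (unmatched 𝒮 𝒯 ∩ verts C).card)
      + (∑ C ∈ B, (unmatched 𝒮 𝒯 ∩ verts C).card)
      + (unmatched 𝒮 𝒯 ∩ (verts (edges (touched 𝒮 𝒯 \ A)) ∪ verts (edges (touched 𝒯 𝒮 \ B)))).card
      + ∑ C ∈ isolatedParts 𝒮 𝒯, (verts C).card := by
  set U := unmatched 𝒮 𝒯 with hU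
  have hsub : U ⊆ ((A.biUnion fun C => U ∩ verts C) ∪ (B.biUnion fun C => U ∩ verts C))
      ∪ (U ∩ (verts (edges (touched 𝒮 𝒯 \ A)) ∪ verts (edges (touched 𝒯 𝒮 \ B))))
      ∪ (isolatedParts 𝒮 𝒯).biUnion verts := by
    have key : ∀ (𝒮 𝒯 A : Finset (Finset (Pair n))), ∀ u ∈ verts (edges 𝒮),
        (∃ C ∈ A, u ∈ verts C) ∨ u ∈ verts (edges (touched 𝒮 𝒯 \ A)) ∨
          ∃ C ∈ untouched 𝒮 𝒯, u ∈ verts C := by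
      intro 𝒮 𝒯 A u hu
      obtain ⟨C, hC, huC⟩ := mem_verts_edges.1 hu
      by_cases hd : Disjoint (verts C) (verts (edges 𝒯))
      · exact Or.inr (Or.inr ⟨C, Finset.mem_filter.2 ⟨hC, hd⟩, huC⟩)
      · by_cases hA : C ∈ A
        · exact Or.inl ⟨C, hA, huC⟩
        · exact Or.inr (Or.inl (mem_verts_edges.2
            ⟨C, Finset.mem_sdiff.2 ⟨Finset.mem_filter.2 ⟨hC, hd⟩, hA⟩, huC⟩))
    intro u hu
    simp only [Finset.mem_union, Finset.mem_biUnion, Finset.mem_inter, isolatedParts]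
    have h1 : u ∈ verts (edges 𝒮) ∨ u ∈ verts (edges 𝒯) := by
      rcases Finset.mem_symmDiff.1 hu with h | h
      · exact Or.inl h.1
      · exact Or.inr h.1
    rcases h1 with h | h
    · rcases key 𝒮 𝒯 A u h with ⟨C, hC, h⟩ | h | ⟨C, hC, h⟩
      · exact Or.inl (Or.inl (Or.inl ⟨C, hC, hu, h⟩))
      · exact Or.inl (Or.inr ⟨hu, Or.inl h⟩)
      · exact Or.inr ⟨C, Or.inl hC, h⟩
    · rcases key 𝒯 𝒮 B u h with ⟨C, hC, h⟩ | h | ⟨C, hC, h⟩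
      · exact Or.inl (Or.inl (Or.inr ⟨C, hC, hu, h⟩))
      · exact Or.inl (Or.inr ⟨hu, Or.inr h⟩)
      · exact Or.inr ⟨C, Or.inr hC, h⟩
  refine (Finset.card_le_card hsub).trans ?_
  refine (Finset.card_union_le _ _).trans (add_le_add ?_ Finset.card_biUnion_le)
  refine (Finset.card_union_le _ _).trans (add_le_add ?_ le_rfl)
  exact (Finset.card_union_le _ _).trans (add_le_add Finset.card_biUnion_le Finset.card_biUnion_le)

lemma card_symmDiff_add (A B : Finset (Pair n)) :
    (symmDiff A B).card + 2 * (A ∩ B).card = A.card + B.card := by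
  have h1 : (symmDiff A B).card = (A \ B).card + (B \ A).card := by
    rw [symmDiff_def, Finset.sup_eq_union, Finset.card_union_of_disjoint]
    exact disjoint_sdiff_sdiff
  have h2 := Finset.card_sdiff_add_card_inter A B
  have h3 := Finset.card_sdiff_add_card_inter B A
  rw [Finset.inter_comm] at h3
  omega

end Configurations

/-! ### The terms of the overlap expansion -/

section TermBound

variable {n : ℕ} {lam p : ℝ} {θ : (Fin n → Fin n) → Pair n → ℝ}

lemma EdgeWeight.dependsOn_prod (hθ : EdgeWeight lam p θ) (C : Finset (Pair n)) :
    DependsOn (fun z => ∏ e ∈ C, θ z e) (verts C : Set (Fin n)) :=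
  DependsOn.prod fun e he => (hθ.dependsOn e).mono fun _ hv =>
    Finset.mem_coe.2 (mem_verts.2 ⟨e, he, hv⟩)

lemma dependsOn_ind_eq {u w : Fin n} {s : Set (Fin n)} (hu : u ∈ s) (hw : w ∈ s) :
    DependsOn (fun z : Fin n → Fin n => ind (z u = z w)) s := by
  intro z z' hz
  simp only [hz u hu, hz w hw]

/-- A connected component is a block: its labels are revealed from an arbitrary vertex on. -/
lemma EdgeWeight.block [Nonempty (Fin n)] (hθ : EdgeWeight lam p θ) {C : Finset (Pair n)}
    (hC : IsConnectedEdges C) :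
    (verts C).card - 1 ≤ C.card ∧
    Block (verts C) (fun z => ∏ e ∈ C, θ z e) (lam ^ C.card * p ^ ((verts C).card - 1)) := by
  have hexit : ∀ v ∈ verts C, Exits C ((verts C).erase v) := fun v hv =>
    hC.exits (Finset.erase_subset _ _) ⟨v, hv, Finset.notMem_erase _ _⟩
  have hsub : ∀ v, ((verts C : Finset (Fin n)) : Set (Fin n))ᶜ
      ⊆ (((verts C).erase v : Finset (Fin n)) : Set (Fin n))ᶜ := fun v =>
    Set.compl_subset_compl.2 (by exact_mod_cast Finset.erase_subset _ _)
  obtain ⟨v₀, hv₀⟩ := hC.verts_nonempty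
  refine ⟨?_, hC.verts_nonempty, fun z => Finset.prod_nonneg fun e _ => hθ.nonneg z e,
    hθ.dependsOn_prod C, ?_, ?_⟩
  · have := (hθ.expect_prod_le _ C (hexit v₀ hv₀) (fun _ => 1) (fun _ _ _ => rfl)
      fun _ => zero_le_one).1
    rwa [Finset.card_erase_of_mem hv₀] at this
  · intro g hg hg0
    have := (hθ.expect_prod_le _ C (hexit v₀ hv₀) g (hg.mono (hsub v₀)) hg0).2
    rwa [Finset.card_erase_of_mem hv₀] at this
  · intro g hg hg0 v hv r hr
    have hvr : v ≠ r := fun h => hr (h ▸ hv)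
    have h1 := (hθ.expect_prod_le _ C (hexit v hv) (fun z => g z * ind (z v = z r))
      ((hg.mono (hsub v)).mul (dependsOn_ind_eq (by simp) (by simp [hr])))
      fun z => mul_nonneg (hg0 z) (ind_nonneg _)).2
    rw [Finset.card_erase_of_mem hv] at h1
    have h2 := expect_mul_ind_eq_le (ι := Fin n) (κ := Fin n) (g := g) hvr
      (hg.mono (by simpa using hv)) hg0
    calc 𝔼 z, g z * ((∏ e ∈ C, θ z e) * ind (z v = z r))
        = 𝔼 z, g z * ind (z v = z r) * ∏ e ∈ C, θ z e :=
          Finset.expect_congr rfl fun z _ => by ring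
      _ ≤ _ := h1
      _ ≤ ((𝔼 z, g z) * (1 / Fintype.card (Fin n))) *
            (lam ^ C.card * p ^ ((verts C).card - 1)) := by
          exact mul_le_mul_of_nonneg_right h2
            (mul_nonneg (pow_nonneg hθ.lam_nonneg _) (pow_nonneg hθ.p_nonneg _))
      _ = _ := by ring

/-- The expectation of the monomial of a component, in terms of the edge weights. -/
noncomputable def componentMean (S : Sampling) (θ : (Fin n → Fin n) → Pair n → ℝ)
    (C : Finset (Pair n)) : ℝ := latentE S fun z => ∏ e ∈ C, θ z e

lemma EdgeWeight.componentMean_nonneg (hθ : EdgeWeight lam p θ) (S : Sampling)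
    (C : Finset (Pair n)) : 0 ≤ componentMean S θ C :=
  latentE_nonneg fun z => Finset.prod_nonneg fun e _ => hθ.nonneg z e

lemma EdgeWeight.componentMean_le [Nonempty (Fin n)] (hθ : EdgeWeight lam p θ) (S : Sampling)
    {C : Finset (Pair n)} {U : Finset (Fin n)} (hU : Exits C U) {m : ℕ}
    (hm : (verts C).card ≤ m) (hmn : 2 * m ^ 2 ≤ n) :
    U.card ≤ C.card ∧ componentMean S θ C ≤ 2 * (lam ^ C.card * p ^ U.card) := by
  obtain ⟨h1, h2⟩ := hθ.expect_prod_le U C hU (fun _ => 1) (fun _ _ _ => rfl)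
    fun _ => zero_le_one
  refine ⟨h1, (latentE_le S hm (by simpa using hmn) (hθ.dependsOn_prod C) fun z =>
    Finset.prod_nonneg fun e _ => hθ.nonneg z e).trans ?_⟩
  simp only [one_mul, Fintype.expect_const] at h2
  linarith

lemma EdgeWeight.mixedMoment_nonneg (hθ : EdgeWeight lam p θ) {q : ℝ} (hq : 0 ≤ q)
    (hq2 : q ≤ 1 / 2) (A B : Finset (Pair n)) (z : Fin n → Fin n) :
    0 ≤ mixedMoment q (θ z) A B :=
  mul_nonneg (Finset.prod_nonneg fun e _ => add_nonneg (mul_nonneg hq (by linarith))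
    (mul_nonneg (by linarith) (hθ.nonneg z e))) (Finset.prod_nonneg fun e _ => hθ.nonneg z e)

lemma EdgeWeight.dependsOn_mixedMoment (hθ : EdgeWeight lam p θ) (q : ℝ)
    (A B : Finset (Pair n)) :
    DependsOn (fun z => mixedMoment q (θ z) A B)
      ((verts A ∪ verts B : Finset (Fin n)) : Set (Fin n)) := by
  refine DependsOn.mul (DependsOn.prod fun e he z z' hz => ?_) (DependsOn.prod fun e he =>
    (hθ.dependsOn e).mono fun v hv => ?_)
  · have := hθ.dependsOn e (x := z) (y := z') fun v hv => hz v (Finset.mem_coe.2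
      (Finset.mem_union_left _ (mem_verts.2 ⟨e, (Finset.mem_inter.1 he).1, hv⟩)))
    simp only at this
    simp only [this]
  · rw [Finset.mem_coe, Finset.mem_union]
    rcases Finset.mem_symmDiff.1 he with h | h
    · exact Or.inl (mem_verts.2 ⟨e, h.1, hv⟩)
    · exact Or.inr (mem_verts.2 ⟨e, h.1, hv⟩)

lemma EdgeWeight.expect_mixedMoment_le [Nonempty (Fin n)] (hθ : EdgeWeight lam p θ) {q : ℝ}
    (hq : 0 ≤ q) (hq2 : q ≤ 1 / 2) {A B : Finset (Pair n)} {U : Finset (Fin n)}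
    (hU : Exits (symmDiff A B) U) :
    U.card ≤ (symmDiff A B).card ∧ 𝔼 z, mixedMoment q (θ z) A B
      ≤ (q * (1 - q) + lam) ^ (A ∩ B).card * (lam ^ (symmDiff A B).card * p ^ U.card) := by
  obtain ⟨h1, h2⟩ := hθ.expect_prod_le U _ hU
    (fun _ => (q * (1 - q) + lam) ^ (A ∩ B).card) (fun _ _ _ => rfl)
    fun _ => pow_nonneg (add_nonneg (mul_nonneg hq (by linarith)) hθ.lam_nonneg) _
  refine ⟨h1, le_trans (Finset.expect_le_expect fun z _ => ?_)
    (h2.trans_eq (by rw [Fintype.expect_const]))⟩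
  refine mul_le_mul_of_nonneg_right ?_ (Finset.prod_nonneg fun e _ => hθ.nonneg z e)
  refine (Finset.prod_le_prod (fun e _ => ?_) fun e _ => ?_).trans_eq (Finset.prod_const _)
  · exact add_nonneg (mul_nonneg hq (by linarith)) (mul_nonneg (by linarith) (hθ.nonneg z e))
  · have h3 := hθ.nonneg z e
    have h4 := hθ.le z e
    nlinarith

/-- The parameter range. The number `m` bounds the number of vertices and of edges in play, `p` is
the probability that an edge carries signal, and `y` bounds the two signal-to-noise ratios
`λ / √(q (1 - q))` and `λ p √n / √(q (1 - q))`. -/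
structure Regime (n m : ℕ) (q lam p y : ℝ) : Prop where
  q_pos : 0 < q
  q_le : q ≤ 1 / 2
  le_m : 4 ≤ m
  m_sq_le : 4 * m ^ 2 ≤ n
  y_nonneg : 0 ≤ y
  lam_le : lam ≤ y * √(q * (1 - q))
  lam_mul_le : lam * p ≤ y * √(q * (1 - q)) * (1 / √n)
  pow_le_two : (1 + lam / (q * (1 - q))) ^ m ≤ 2

lemma Regime.var_pos {m : ℕ} {q y : ℝ} (h : Regime n m q lam p y) : 0 < q * (1 - q) :=
  mul_pos h.q_pos (by linarith [h.q_le])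

/-- The weight of `f` edges linking `u ≤ f` new vertices: each vertex uses one edge for its own
factor `n^(-1/2)`. -/
lemma Regime.pow_mul_pow_le {m : ℕ} {q y : ℝ} (h : Regime n m q lam p y)
    (hθ : EdgeWeight lam p θ) {f u : ℕ} (huf : u ≤ f) :
    lam ^ f * p ^ u ≤ (y * √(q * (1 - q))) ^ f * (1 / √n) ^ u := by
  obtain ⟨d, rfl⟩ := Nat.exists_eq_add_of_le huf
  have hys : 0 ≤ y * √(q * (1 - q)) := mul_nonneg h.y_nonneg (Real.sqrt_nonneg _)
  calc lam ^ (u + d) * p ^ u = lam ^ d * (lam * p) ^ u := by rw [pow_add, mul_pow]; ring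
    _ ≤ (y * √(q * (1 - q))) ^ d * (y * √(q * (1 - q)) * (1 / √n)) ^ u := by
        refine mul_le_mul (pow_le_pow_left₀ hθ.lam_nonneg h.lam_le _)
          (pow_le_pow_left₀ (mul_nonneg hθ.lam_nonneg hθ.p_nonneg) h.lam_mul_le _)
          (pow_nonneg (mul_nonneg hθ.lam_nonneg hθ.p_nonneg) _) (pow_nonneg hys _)
    _ = _ := by rw [pow_add, mul_pow]; ring

lemma Regime.two_m_sq_le {m : ℕ} {q y : ℝ} (h : Regime n m q lam p y) : 2 * m ^ 2 ≤ n := by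
  have := h.m_sq_le
  omega

/-- A term in the expansion of `𝔼[P̄_𝒮 P̄_𝒯]`: the touched components in `A` and `B` are replaced
by minus their means, and the untouched components stay centered. -/
noncomputable def overlapTerm (S : Sampling) (q : ℝ) (θ : (Fin n → Fin n) → Pair n → ℝ)
    (𝒮 𝒯 A B : Finset (Finset (Pair n))) : ℝ :=
  (∏ C ∈ A, -componentMean S θ C) * (∏ C ∈ B, -componentMean S θ C) *
    latentE S fun z => mixedMoment q (θ z) (edges (touched 𝒮 𝒯 \ A)) (edges (touched 𝒯 𝒮 \ B))
      * ∏ C ∈ isolatedParts 𝒮 𝒯, (∏ e ∈ C, θ z e - componentMean S θ C)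

lemma prod_componentMean_le [Nonempty (Fin n)] {m : ℕ} {q y : ℝ} (h : Regime n m q lam p y)
    (hθ : EdgeWeight lam p θ) (S : Sampling) {t : ℝ} (ht : y ≤ t)
    {U : Finset (Fin n)} (A : Finset (Finset (Pair n)))
    (hA : ∀ C ∈ A, Exits C (U ∩ verts C) ∧ (verts C).card ≤ m) :
    |∏ C ∈ A, -componentMean S θ C| ≤ 2 ^ A.card * (t * √(q * (1 - q))) ^ (∑ C ∈ A, C.card) *
      (1 / √n) ^ (∑ C ∈ A, (U ∩ verts C).card) := by
  rw [Finset.abs_prod, ← Finset.prod_pow_eq_pow_sum, ← Finset.prod_pow_eq_pow_sum,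
    ← Finset.prod_const, ← Finset.prod_mul_distrib, ← Finset.prod_mul_distrib]
  refine Finset.prod_le_prod (fun _ _ => abs_nonneg _) fun C hC => ?_
  obtain ⟨h1, h2⟩ := hθ.componentMean_le S (hA C hC).1 (hA C hC).2 h.two_m_sq_le
  rw [abs_neg, abs_of_nonneg (hθ.componentMean_nonneg S C), mul_assoc]
  refine h2.trans (mul_le_mul_of_nonneg_left ?_ zero_le_two)
  refine (h.pow_mul_pow_le hθ h1).trans (mul_le_mul_of_nonneg_right ?_ (by positivity))
  exact pow_le_pow_left₀ (mul_nonneg h.y_nonneg (Real.sqrt_nonneg _))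
    (mul_le_mul_of_nonneg_right ht (Real.sqrt_nonneg _)) _

/-- Each term of the expansion gains `w` for each edge which is not shared, for each replaced
component, and `n^(-1/2)` for each unmatched vertex. -/
theorem abs_overlapTerm_le [Nonempty (Fin n)] {m : ℕ} {q y w : ℝ} (h : Regime n m q lam p y)
    (hθ : EdgeWeight lam p θ) (S : Sampling) (hw0 : 0 ≤ w) (hw1 : w ≤ 1)
    (hw : 3 * m ^ 2 * y ≤ w ^ 2)
    {𝒮 𝒯 A B : Finset (Finset (Pair n))} (h𝒮 : IsConfig 𝒮) (h𝒯 : IsConfig 𝒯)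
    (hA : A ⊆ touched 𝒮 𝒯) (hB : B ⊆ touched 𝒯 𝒮)
    (hcard : 2 * (edges 𝒮).card + 2 * (edges 𝒯).card ≤ m) :
    |overlapTerm S q θ 𝒮 𝒯 A B| ≤ 4 * √(q * (1 - q)) ^ ((edges 𝒮).card + (edges 𝒯).card) *
      (1 / √n) ^ (unmatched 𝒮 𝒯).card * w ^ (symmDiff (edges 𝒮) (edges 𝒯)).card *
      ((2 * w) ^ A.card * (2 * w) ^ B.card) := by
  have hm4 : (4 : ℝ) ≤ m := by exact_mod_cast h.le_m
  have hn : (1 : ℝ) ≤ n := by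
    have : (0 : ℕ) < n := Fin.pos (Classical.arbitrary (Fin n))
    exact_mod_cast this
  set s := √(q * (1 - q)) with hs
  have hs0 : 0 ≤ s := Real.sqrt_nonneg _
  have hs2 : s ^ 2 = q * (1 - q) := Real.sq_sqrt h.var_pos.le
  set ν : ℝ := 1 / √n with hν
  have hν0 : 0 ≤ ν := by positivity
  have hν1 : ν ≤ 1 := by
    rw [hν, div_le_one (by positivity)]
    exact Real.one_le_sqrt.2 hn
  set t : ℝ := 3 * m ^ 2 * y with ht
  have hy0 := h.y_nonneg
  have ht0 : 0 ≤ t := by positivity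
  have hyt : y ≤ t := by
    have : 1 ≤ 3 * (m : ℝ) ^ 2 := by nlinarith
    exact le_mul_of_one_le_left hy0 this
  set U := unmatched 𝒮 𝒯 with hU
  set S₁ := edges (touched 𝒮 𝒯 \ A) with hS₁
  set T₁ := edges (touched 𝒯 𝒮 \ B) with hT₁
  set 𝒞 := isolatedParts 𝒮 𝒯 with h𝒞
  have h𝒞c : IsConfig 𝒞 := isConfig_isolatedParts h𝒮 h𝒯
  have hS₁s : S₁ ⊆ edges 𝒮 := edges_mono (Finset.sdiff_subset.trans (touched_subset _ _))
  have hT₁s : T₁ ⊆ edges 𝒯 := edges_mono (Finset.sdiff_subset.trans (touched_subset _ _))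
  have hall : ∀ W : Finset (Fin n), W ⊆ verts (edges 𝒮) ∪ verts (edges 𝒯) → W.card ≤ m :=
    fun W hW => (Finset.card_le_card hW).trans ((Finset.card_union_le _ _).trans
      ((add_le_add (card_verts_le _) (card_verts_le _)).trans hcard))
  have hvS : ∀ C ∈ 𝒮, verts C ⊆ verts (edges 𝒮) ∪ verts (edges 𝒯) := fun C hC =>
    (verts_mono (subset_edges hC)).trans Finset.subset_union_left
  have hvT : ∀ C ∈ 𝒯, verts C ⊆ verts (edges 𝒮) ∪ verts (edges 𝒯) := fun C hC =>
    (verts_mono (subset_edges hC)).trans Finset.subset_union_right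
  have hvC : ∀ C ∈ 𝒞, verts C ⊆ verts (edges 𝒮) ∪ verts (edges 𝒯) := fun C hC => by
    rcases Finset.mem_union.1 hC with h | h
    · exact hvS C (untouched_subset _ _ h)
    · exact hvT C (untouched_subset _ _ h)
  -- the replaced components
  have hμA := prod_componentMean_le h hθ S hyt (U := U) A fun C hC =>
    ⟨exits_inter_unmatched h𝒮 (hA hC), hall _ (hvS C (touched_subset _ _ (hA hC)))⟩
  have hμB := prod_componentMean_le h hθ S hyt (U := U) B fun C hC =>
    ⟨hU ▸ unmatched_comm 𝒯 𝒮 ▸ exits_inter_unmatched h𝒯 (hB hC),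
      hall _ (hvT C (touched_subset _ _ (hB hC)))⟩
  -- the untouched components
  have hlat := abs_latentE_mul_prod_le S (V := verts) (T := fun C z => ∏ e ∈ C, θ z e)
    (b := fun C => lam ^ C.card * p ^ ((verts C).card - 1)) h.le_m
    (by simpa using h.m_sq_le) (I := 𝒞) (fun C hC => (hθ.block (h𝒞c.conn C hC)).2) h𝒞c.disj
    (R := verts S₁ ∪ verts T₁) (g := fun z => mixedMoment q (θ z) S₁ T₁)
    (fun C hC => Finset.disjoint_union_right.2
      ⟨(disjoint_verts_touched_left h𝒮 hC).mono_right (verts_mono (edges_mono Finset.sdiff_subset)),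
        (disjoint_verts_touched_right h𝒯 hC).mono_right
          (verts_mono (edges_mono Finset.sdiff_subset))⟩)
    (hall _ (Finset.union_subset (Finset.union_subset_union (verts_mono hS₁s) (verts_mono hT₁s))
      (Finset.biUnion_subset.2 hvC)))
    (hθ.dependsOn_mixedMoment q S₁ T₁)
    (hθ.mixedMoment_nonneg h.q_pos.le h.q_le S₁ T₁)
  -- the shared edges and the edges of exactly one of the two remaining graphs
  obtain ⟨hu, hmix⟩ := hθ.expect_mixedMoment_le h.q_pos.le h.q_le
    (exits_symmDiff h𝒮 h𝒯 (𝒮₁ := touched 𝒮 𝒯 \ A) (𝒯₁ := touched 𝒯 𝒮 \ B)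
      Finset.sdiff_subset Finset.sdiff_subset)
  rw [← hS₁, ← hT₁, ← hU] at hu hmix
  set U₁ := U ∩ (verts S₁ ∪ verts T₁) with hU₁
  have hshared : (q * (1 - q) + lam) ^ (S₁ ∩ T₁).card ≤ 2 * s ^ (2 * (S₁ ∩ T₁).card) := by
    have h1 : q * (1 - q) + lam = s ^ 2 * (1 + lam / (q * (1 - q))) := by
      have hq0 : q ≠ 0 := h.q_pos.ne'
      have hq1 : 1 - q ≠ 0 := by linarith [h.q_le]
      rw [hs2]; field_simp
    have h2 : 1 ≤ 1 + lam / (q * (1 - q)) :=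
      le_add_of_nonneg_right (div_nonneg hθ.lam_nonneg h.var_pos.le)
    have h3 : (S₁ ∩ T₁).card ≤ m := by
      have := Finset.card_le_card ((Finset.inter_subset_left (s₁ := S₁) (s₂ := T₁)).trans hS₁s)
      omega
    rw [h1, mul_pow, ← pow_mul, mul_comm]
    exact mul_le_mul_of_nonneg_right ((pow_le_pow_right₀ h2 h3).trans h.pow_le_two)
      (by positivity)
  have hmix' : 𝔼 z, mixedMoment q (θ z) S₁ T₁ ≤ 2 * s ^ (2 * (S₁ ∩ T₁).card) *
      ((t * s) ^ (symmDiff S₁ T₁).card * ν ^ U₁.card) := by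
    refine hmix.trans (mul_le_mul hshared ((h.pow_mul_pow_le hθ hu).trans ?_)
      (mul_nonneg (pow_nonneg hθ.lam_nonneg _) (pow_nonneg hθ.p_nonneg _)) (by positivity))
    exact mul_le_mul_of_nonneg_right (pow_le_pow_left₀ (by positivity)
      (mul_le_mul_of_nonneg_right hyt hs0) _) (by positivity)
  have hiso : ∏ C ∈ 𝒞, (3 * (lam ^ C.card * p ^ ((verts C).card - 1)) *
        (m ^ 2 / √(Fintype.card (Fin n))))
      ≤ (t * s) ^ (∑ C ∈ 𝒞, C.card) * ν ^ (∑ C ∈ 𝒞, (verts C).card) := by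
    rw [← Finset.prod_pow_eq_pow_sum, ← Finset.prod_pow_eq_pow_sum, ← Finset.prod_mul_distrib]
    have hlp : ∀ i j : ℕ, 0 ≤ lam ^ i * p ^ j := fun i j =>
      mul_nonneg (pow_nonneg hθ.lam_nonneg _) (pow_nonneg hθ.p_nonneg _)
    refine Finset.prod_le_prod (fun C _ => ?_) fun C hC => ?_
    · have := hlp C.card ((verts C).card - 1)
      positivity
    have hcC : C.card ≠ 0 := (Finset.card_pos.2 (h𝒞c.conn C hC).nonempty).ne'
    have hvC0 : 0 < (verts C).card := Finset.card_pos.2 (h𝒞c.conn C hC).verts_nonempty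
    have h3m : 1 ≤ 3 * (m : ℝ) ^ 2 := by nlinarith
    rw [Fintype.card_fin]
    calc 3 * (lam ^ C.card * p ^ ((verts C).card - 1)) * (m ^ 2 / √n)
        = (3 * m ^ 2) * (lam ^ C.card * p ^ ((verts C).card - 1)) * ν := by rw [hν]; ring
      _ ≤ (3 * m ^ 2) ^ C.card * ((y * s) ^ C.card * ν ^ ((verts C).card - 1)) * ν := by
          refine mul_le_mul_of_nonneg_right (mul_le_mul (le_self_pow₀ h3m hcC)
            (h.pow_mul_pow_le hθ (hθ.block (h𝒞c.conn C hC)).1) (hlp _ _) (by positivity)) hν0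
      _ = (t * s) ^ C.card * ν ^ ((verts C).card - 1 + 1) := by
          rw [pow_succ, ht, mul_assoc (3 * (m : ℝ) ^ 2) y s, mul_pow]; ring
      _ = _ := by rw [Nat.sub_add_cancel hvC0]
  -- counting edges and vertices
  set f : ℕ := (∑ C ∈ A, C.card) + (∑ C ∈ B, C.card) + (symmDiff S₁ T₁).card + ∑ C ∈ 𝒞, C.card
    with hf
  set u : ℕ := (∑ C ∈ A, (U ∩ verts C).card) + (∑ C ∈ B, (U ∩ verts C).card) + U₁.card
    + ∑ C ∈ 𝒞, (verts C).card with hu_def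
  have hUu : U.card ≤ u := card_unmatched_le
  have hcS : (edges 𝒮).card = (∑ C ∈ A, C.card) + S₁.card
      + ∑ C ∈ untouched 𝒮 𝒯, C.card := by
    rw [h𝒮.card_edges, sum_eq_touched_add_untouched 𝒮 𝒯, ← Finset.sum_sdiff hA,
      hS₁, (h𝒮.subset (Finset.sdiff_subset.trans (touched_subset _ _))).card_edges]
    ring
  have hcT : (edges 𝒯).card = (∑ C ∈ B, C.card) + T₁.card
      + ∑ C ∈ untouched 𝒯 𝒮, C.card := by
    rw [h𝒯.card_edges, sum_eq_touched_add_untouched 𝒯 𝒮, ← Finset.sum_sdiff hB,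
      hT₁, (h𝒯.subset (Finset.sdiff_subset.trans (touched_subset _ _))).card_edges]
    ring
  have hc𝒞 : ∑ C ∈ 𝒞, C.card = ∑ C ∈ untouched 𝒮 𝒯, C.card + ∑ C ∈ untouched 𝒯 𝒮, C.card :=
    Finset.sum_union (disjoint_untouched h𝒮)
  have hsd := card_symmDiff_add S₁ T₁
  have hsd' := card_symmDiff_add (edges 𝒮) (edges 𝒯)
  have hinter := Finset.card_le_card (Finset.inter_subset_inter hS₁s hT₁s)
  have hcA := (h𝒮.subset (hA.trans (touched_subset _ _))).card_le
  have hcB := (h𝒯.subset (hB.trans (touched_subset _ _))).card_le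
  have hf1 : 2 * (S₁ ∩ T₁).card + f = (edges 𝒮).card + (edges 𝒯).card := by omega
  have hf2 : (symmDiff (edges 𝒮) (edges 𝒯)).card ≤ f := by omega
  have hf3 : A.card + B.card ≤ f := by omega
  have hlat' : |latentE S fun z => mixedMoment q (θ z) S₁ T₁ *
      ∏ C ∈ 𝒞, (∏ e ∈ C, θ z e - componentMean S θ C)| ≤
      2 * (2 * s ^ (2 * (S₁ ∩ T₁).card) * ((t * s) ^ (symmDiff S₁ T₁).card * ν ^ U₁.card)) *
        ((t * s) ^ (∑ C ∈ 𝒞, C.card) * ν ^ (∑ C ∈ 𝒞, (verts C).card)) := by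
    refine hlat.trans (mul_le_mul (mul_le_mul_of_nonneg_left hmix' zero_le_two) hiso
      (Finset.prod_nonneg fun C _ => ?_) (by positivity))
    have := mul_nonneg (pow_nonneg hθ.lam_nonneg C.card)
      (pow_nonneg hθ.p_nonneg ((verts C).card - 1))
    positivity
  rw [overlapTerm, abs_mul, abs_mul]
  calc _ ≤ (2 ^ A.card * (t * s) ^ (∑ C ∈ A, C.card) * ν ^ (∑ C ∈ A, (U ∩ verts C).card)) *
        (2 ^ B.card * (t * s) ^ (∑ C ∈ B, C.card) * ν ^ (∑ C ∈ B, (U ∩ verts C).card)) *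
        (2 * (2 * s ^ (2 * (S₁ ∩ T₁).card) * ((t * s) ^ (symmDiff S₁ T₁).card * ν ^ U₁.card)) *
        ((t * s) ^ (∑ C ∈ 𝒞, C.card) * ν ^ (∑ C ∈ 𝒞, (verts C).card))) :=
        mul_le_mul (mul_le_mul hμA hμB (abs_nonneg _) (by positivity)) hlat' (abs_nonneg _)
          (by positivity)
    _ = 4 * s ^ (2 * (S₁ ∩ T₁).card + f) * ν ^ u * (2 ^ A.card * 2 ^ B.card) * t ^ f := by
        rw [hf, hu_def]
        simp only [pow_add, mul_pow]
        ring
    _ ≤ 4 * s ^ (2 * (S₁ ∩ T₁).card + f) * ν ^ U.card * (2 ^ A.card * 2 ^ B.card) *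
          w ^ (2 * f) := by
        refine mul_le_mul (mul_le_mul_of_nonneg_right (mul_le_mul_of_nonneg_left
          (pow_le_pow_of_le_one hν0 hν1 hUu) (by positivity)) (by positivity)) ?_ (by positivity)
          (by positivity)
        rw [pow_mul]
        exact pow_le_pow_left₀ ht0 hw _
    -- one factor `w ^ f` pays for the edges which are not shared, the other for `A` and `B`
    _ ≤ 4 * s ^ (2 * (S₁ ∩ T₁).card + f) * ν ^ U.card * (2 ^ A.card * 2 ^ B.card) *
          w ^ ((symmDiff (edges 𝒮) (edges 𝒯)).card + (A.card + B.card)) :=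
        mul_le_mul_of_nonneg_left (pow_le_pow_of_le_one hw0 hw1 (by omega)) (by positivity)
    _ = _ := by
        rw [hf1]
        simp only [pow_add, mul_pow]
        ring

end TermBound

/-! ### Entries of the Gram matrix -/

section Gram

variable {n : ℕ}

/-- The corrected monomial of a labelled graph given by its components. -/
noncomputable def corrected (S : Sampling) (q : ℝ) (θ : (Fin n → Fin n) → Pair n → ℝ)
    (𝒮 : Finset (Finset (Pair n))) (y : Obs n) : ℝ :=
  ∏ C ∈ 𝒮, (edgeMonomial q C y - componentMean S θ C)

lemma integral_edgeMonomial [Nonempty (Fin n)] {k : ℕ} {lam q : ℝ} (hk : 1 ≤ k) (M : Planted)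
    (S : Sampling) (hlam : 0 ≤ lam) (hq : 0 ≤ q) (hql : lam ≤ 1 - q) (C : Finset (Pair n)) :
    ∫ y, edgeMonomial q C y ∂(obsLaw M S n k lam q)
      = componentMean S (pairTheta M k lam) C := by
  rw [integral_obsLaw, componentMean]
  congr 1
  ext z
  have h := integral_edgeMonomial_mul hk M hlam hq hql z C ∅
  have h1 : ∀ y : Obs n, edgeMonomial q ∅ y = 1 := fun y => Finset.prod_empty
  simp only [h1, mul_one] at h
  rw [h, mixedMoment, Finset.inter_empty, Finset.prod_empty, one_mul]
  congr 1
  exact symmDiff_bot C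

lemma latentE_sum {α : Type*} (S : Sampling) (s : Finset α) (f : α → (Fin n → Fin n) → ℝ) :
    latentE S (fun z => ∑ a ∈ s, f a z) = ∑ a ∈ s, latentE S (f a) := by
  cases S <;> exact Finset.expect_sum_comm _ _ _

lemma latentE_const_mul (S : Sampling) (c : ℝ) (f : (Fin n → Fin n) → ℝ) :
    latentE S (fun z => c * f z) = c * latentE S f := by
  cases S <;> exact (Finset.mul_expect _ _ _).symm

/-- Expanding the centering of the touched components only. -/
lemma integral_corrected_mul [Nonempty (Fin n)] {k : ℕ} {lam q : ℝ} (hk : 1 ≤ k) (M : Planted)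
    (S : Sampling) (hlam : 0 ≤ lam) (hq : 0 ≤ q) (hql : lam ≤ 1 - q)
    {𝒮 𝒯 : Finset (Finset (Pair n))} (h𝒮 : IsConfig 𝒮) (h𝒯 : IsConfig 𝒯) :
    ∫ y, corrected S q (pairTheta M k lam) 𝒮 y * corrected S q (pairTheta M k lam) 𝒯 y
        ∂(obsLaw M S n k lam q)
      = ∑ A ∈ (touched 𝒮 𝒯).powerset, ∑ B ∈ (touched 𝒯 𝒮).powerset,
          overlapTerm S q (pairTheta M k lam) 𝒮 𝒯 A B := by
  set θ := pairTheta (n := n) M k lam with hθ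
  set μ := componentMean S θ with hμ
  set 𝒞 := isolatedParts 𝒮 𝒯 with h𝒞
  have h𝒞c : IsConfig 𝒞 := isConfig_isolatedParts h𝒮 h𝒯
  have hexp : ∀ (𝒮 𝒯 : Finset (Finset (Pair n))), IsConfig 𝒮 → ∀ y : Obs n,
      ∏ C ∈ touched 𝒮 𝒯, (edgeMonomial q C y - μ C)
        = ∑ A ∈ (touched 𝒮 𝒯).powerset, (∏ C ∈ A, -μ C) *
          edgeMonomial q (edges (touched 𝒮 𝒯 \ A)) y := by
    intro 𝒮 𝒯 h𝒮 y
    have : ∀ C, edgeMonomial q C y - μ C = -μ C + edgeMonomial q C y := fun C => by ring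
    simp only [this]
    rw [Finset.prod_add]
    refine Finset.sum_congr rfl fun A _ => ?_
    rw [(h𝒮.subset (Finset.sdiff_subset.trans (touched_subset _ _))).prod_edgeMonomial]
  have hpt : ∀ y : Obs n, corrected S q θ 𝒮 y * corrected S q θ 𝒯 y
      = ∑ A ∈ (touched 𝒮 𝒯).powerset, ∑ B ∈ (touched 𝒯 𝒮).powerset,
        (∏ C ∈ A, -μ C) * (∏ C ∈ B, -μ C) *
          (edgeMonomial q (edges (touched 𝒮 𝒯 \ A)) y * edgeMonomial q (edges (touched 𝒯 𝒮 \ B)) y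
            * ∏ C ∈ 𝒞, (edgeMonomial q C y - μ C)) := by
    intro y
    rw [corrected, corrected, prod_eq_touched_mul_untouched 𝒮 𝒯,
      prod_eq_touched_mul_untouched 𝒯 𝒮, hexp 𝒮 𝒯 h𝒮, hexp 𝒯 𝒮 h𝒯, h𝒞, isolatedParts,
      Finset.prod_union (disjoint_untouched h𝒮), mul_mul_mul_comm, Finset.sum_mul_sum,
      Finset.sum_mul]
    refine Finset.sum_congr rfl fun A _ => ?_
    rw [Finset.sum_mul]
    refine Finset.sum_congr rfl fun B _ => ?_
    ring
  rw [integral_obsLaw]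
  simp only [hpt]
  have hz : ∀ z, ∫ y, ∑ A ∈ (touched 𝒮 𝒯).powerset, ∑ B ∈ (touched 𝒯 𝒮).powerset,
        (∏ C ∈ A, -μ C) * (∏ C ∈ B, -μ C) *
          (edgeMonomial q (edges (touched 𝒮 𝒯 \ A)) y * edgeMonomial q (edges (touched 𝒯 𝒮 \ B)) y
            * ∏ C ∈ 𝒞, (edgeMonomial q C y - μ C)) ∂(condLaw M k lam q z)
      = ∑ A ∈ (touched 𝒮 𝒯).powerset, ∑ B ∈ (touched 𝒯 𝒮).powerset,
        (∏ C ∈ A, -μ C) * (∏ C ∈ B, -μ C) *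
          (mixedMoment q (θ z) (edges (touched 𝒮 𝒯 \ A)) (edges (touched 𝒯 𝒮 \ B))
            * ∏ C ∈ 𝒞, (∏ e ∈ C, θ z e - μ C)) := by
    intro z
    rw [integral_finsetSum _ fun _ _ => .of_finite]
    refine Finset.sum_congr rfl fun A _ => ?_
    rw [integral_finsetSum _ fun _ _ => .of_finite]
    refine Finset.sum_congr rfl fun B _ => ?_
    rw [integral_const_mul, integral_edgeMonomial_mul_prod hk M hlam hq hql z μ 𝒞
      fun C hC C' hC' hne => h𝒞c.disjoint hC hC' hne]
    · exact fun C hC => disjoint_of_disjoint_verts ((disjoint_verts_touched_left h𝒮 hC).mono_right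
        (verts_mono (edges_mono Finset.sdiff_subset)))
    · exact fun C hC => disjoint_of_disjoint_verts ((disjoint_verts_touched_right h𝒯 hC).mono_right
        (verts_mono (edges_mono Finset.sdiff_subset)))
  simp only [hz]
  rw [latentE_sum]
  refine Finset.sum_congr rfl fun A _ => ?_
  rw [latentE_sum]
  refine Finset.sum_congr rfl fun B _ => ?_
  rw [latentE_const_mul, overlapTerm]

variable {lam p : ℝ} {θ : (Fin n → Fin n) → Pair n → ℝ}

/-- The sum over the choices of replaced components costs a constant factor only. -/
lemma abs_sum_overlapTerm_le [Nonempty (Fin n)] {m : ℕ} {q y w : ℝ}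
    (h : Regime n m q lam p y) (hθ : EdgeWeight lam p θ) (S : Sampling) (hw0 : 0 ≤ w)
    (hw1 : w ≤ 1) (hw : 3 * m ^ 2 * y ≤ w ^ 2) (hw2 : (1 + 2 * w) ^ m ≤ 2)
    {𝒮 𝒯 : Finset (Finset (Pair n))} (h𝒮 : IsConfig 𝒮) (h𝒯 : IsConfig 𝒯)
    (hcard : 2 * (edges 𝒮).card + 2 * (edges 𝒯).card ≤ m) :
    |∑ A ∈ (touched 𝒮 𝒯).powerset, ∑ B ∈ (touched 𝒯 𝒮).powerset, overlapTerm S q θ 𝒮 𝒯 A B|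
      ≤ √(q * (1 - q)) ^ ((edges 𝒮).card + (edges 𝒯).card) *
        (8 * ((1 / √n) ^ (unmatched 𝒮 𝒯).card * w ^ (symmDiff (edges 𝒮) (edges 𝒯)).card)) := by
  set s := √(q * (1 - q)) with hs
  have hs0 : 0 ≤ s := Real.sqrt_nonneg _
  set K : ℝ := 4 * s ^ ((edges 𝒮).card + (edges 𝒯).card) * (1 / √n) ^ (unmatched 𝒮 𝒯).card *
    w ^ (symmDiff (edges 𝒮) (edges 𝒯)).card with hK
  have hK0 : 0 ≤ K := by positivity
  have hc : (touched 𝒮 𝒯).card + (touched 𝒯 𝒮).card ≤ m := by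
    have h1 := (Finset.card_le_card (touched_subset 𝒮 𝒯)).trans h𝒮.card_le
    have h2 := (Finset.card_le_card (touched_subset 𝒯 𝒮)).trans h𝒯.card_le
    rw [← h𝒮.card_edges] at h1
    rw [← h𝒯.card_edges] at h2
    omega
  calc _ ≤ ∑ A ∈ (touched 𝒮 𝒯).powerset, ∑ B ∈ (touched 𝒯 𝒮).powerset,
        K * ((2 * w) ^ A.card * (2 * w) ^ B.card) := by
        refine (Finset.abs_sum_le_sum_abs _ _).trans (Finset.sum_le_sum fun A hA => ?_)
        refine (Finset.abs_sum_le_sum_abs _ _).trans (Finset.sum_le_sum fun B hB => ?_)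
        exact abs_overlapTerm_le h hθ S hw0 hw1 hw h𝒮 h𝒯 (Finset.mem_powerset.1 hA)
          (Finset.mem_powerset.1 hB) hcard
    _ = K * (1 + 2 * w) ^ ((touched 𝒮 𝒯).card + (touched 𝒯 𝒮).card) := by
        rw [pow_add, ← sum_powerset_pow, ← sum_powerset_pow, Finset.sum_mul_sum, Finset.mul_sum]
        exact Finset.sum_congr rfl fun A _ => (Finset.mul_sum _ _ _).symm
    _ ≤ K * 2 := mul_le_mul_of_nonneg_left
        ((pow_le_pow_right₀ (by linarith) hc).trans hw2) hK0
    _ = _ := by rw [hK]; ring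

/-- The squared norm of a corrected monomial is close to the noise level `(q (1 - q)) ^ |E|`. -/
lemma abs_sum_overlapTerm_self_sub_le [Nonempty (Fin n)] {m : ℕ} {q y w : ℝ}
    (h : Regime n m q lam p y) (hθ : EdgeWeight lam p θ) (S : Sampling) (hw0 : 0 ≤ w)
    (hw1 : w ≤ 1) (hw : 3 * m ^ 2 * y ≤ w ^ 2)
    {𝒮 : Finset (Finset (Pair n))} (h𝒮 : IsConfig 𝒮)
    (hcard : 2 * (edges 𝒮).card + 2 * (edges 𝒮).card ≤ m) :
    |(∑ A ∈ (touched 𝒮 𝒮).powerset, ∑ B ∈ (touched 𝒮 𝒮).powerset, overlapTerm S q θ 𝒮 𝒮 A B)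
        - √(q * (1 - q)) ^ ((edges 𝒮).card + (edges 𝒮).card)|
      ≤ √(q * (1 - q)) ^ ((edges 𝒮).card + (edges 𝒮).card) *
        (((1 + lam / (q * (1 - q))) ^ m - 1) + 4 * ((1 + 2 * w) ^ m - 1)) := by
  set s := √(q * (1 - q)) with hs
  have hs0 : 0 ≤ s := Real.sqrt_nonneg _
  have hs2 : s ^ 2 = q * (1 - q) := Real.sq_sqrt h.var_pos.le
  set N := (edges 𝒮).card with hN
  set P := (touched 𝒮 𝒮).powerset with hP
  have hP0 : (∅, ∅) ∈ P ×ˢ P := by simp [hP]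
  rw [← Finset.sum_product', ← Finset.add_sum_erase _ _ hP0]
  -- the leading term is the second moment of the monomial of all the edges
  have hlead : overlapTerm S q θ 𝒮 𝒮 ∅ ∅
      = latentE S fun z => ∏ e ∈ edges 𝒮, (q * (1 - q) + (1 - 2 * q) * θ z e) := by
    rw [overlapTerm, isolatedParts, untouched_self h𝒮, touched_self h𝒮]
    simp only [Finset.prod_empty, mul_one, one_mul, Finset.sdiff_empty, Finset.union_empty,
      mixedMoment, Finset.inter_self, symmDiff_self, Finset.bot_eq_empty]
  have hsN : s ^ (N + N) = (q * (1 - q)) ^ N := by rw [← hs2, ← pow_mul, two_mul]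
  have hvar := h.var_pos
  have hr : 1 ≤ 1 + lam / (q * (1 - q)) :=
    le_add_of_nonneg_right (div_nonneg hθ.lam_nonneg hvar.le)
  have hlo : s ^ (N + N) ≤ overlapTerm S q θ 𝒮 𝒮 ∅ ∅ := by
    rw [hlead, hsN, ← latentE_const (ι := Fin n) S ((q * (1 - q)) ^ N)]
    refine latentE_mono fun z => ?_
    rw [hN, ← Finset.prod_const]
    refine Finset.prod_le_prod (fun _ _ => hvar.le) fun e _ => le_add_of_nonneg_right
      (mul_nonneg (by linarith [h.q_le]) (hθ.nonneg z e))
  have hhi : overlapTerm S q θ 𝒮 𝒮 ∅ ∅ ≤ s ^ (N + N) * (1 + lam / (q * (1 - q))) ^ m := by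
    rw [hlead, ← latentE_const (ι := Fin n) S (s ^ (N + N) * (1 + lam / (q * (1 - q))) ^ m)]
    refine latentE_mono fun z => ?_
    have h1 : ∏ e ∈ edges 𝒮, (q * (1 - q) + (1 - 2 * q) * θ z e)
        ≤ ((q * (1 - q)) * (1 + lam / (q * (1 - q)))) ^ N := by
      rw [hN, ← Finset.prod_const]
      refine Finset.prod_le_prod (fun e _ => add_nonneg hvar.le
        (mul_nonneg (by linarith [h.q_le]) (hθ.nonneg z e))) fun e _ => ?_
      have h2 : q * (1 - q) * (1 + lam / (q * (1 - q))) = q * (1 - q) + lam := by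
        have hq0 : q ≠ 0 := h.q_pos.ne'
        have hq1 : 1 - q ≠ 0 := by linarith [h.q_le]
        field_simp
      rw [h2]
      nlinarith [hθ.nonneg z e, hθ.le z e, h.q_pos]
    refine h1.trans ?_
    rw [mul_pow, ← hsN]
    exact mul_le_mul_of_nonneg_left (pow_le_pow_right₀ hr (by omega)) (by positivity)
  -- all the other terms replace at least one component by its mean
  have hrest : |∑ x ∈ (P ×ˢ P).erase (∅, ∅), overlapTerm S q θ 𝒮 𝒮 x.1 x.2|
      ≤ s ^ (N + N) * (4 * ((1 + 2 * w) ^ m - 1)) := by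
    have hc : (touched 𝒮 𝒮).card + (touched 𝒮 𝒮).card ≤ m := by
      have h1 := (Finset.card_le_card (touched_subset 𝒮 𝒮)).trans h𝒮.card_le
      rw [← h𝒮.card_edges] at h1
      omega
    have hsum : ∑ x ∈ (P ×ˢ P).erase (∅, ∅), (2 * w) ^ x.1.card * (2 * w) ^ x.2.card
        = (1 + 2 * w) ^ ((touched 𝒮 𝒮).card + (touched 𝒮 𝒮).card) - 1 := by
      rw [pow_add, ← sum_powerset_pow, Finset.sum_mul_sum, ← Finset.sum_product',
        ← hP, ← Finset.add_sum_erase _ _ hP0]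
      simp
    calc _ ≤ ∑ x ∈ (P ×ˢ P).erase (∅, ∅),
          (4 * s ^ (N + N)) * ((2 * w) ^ x.1.card * (2 * w) ^ x.2.card) := by
          refine (Finset.abs_sum_le_sum_abs _ _).trans (Finset.sum_le_sum fun x hx => ?_)
          obtain ⟨hx1, hx2⟩ := Finset.mem_product.1 (Finset.mem_of_mem_erase hx)
          have := abs_overlapTerm_le h hθ S hw0 hw1 hw h𝒮 h𝒮 (Finset.mem_powerset.1 hx1)
            (Finset.mem_powerset.1 hx2) hcard
          simpa [unmatched] using this
      _ = (4 * s ^ (N + N)) *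
          ((1 + 2 * w) ^ ((touched 𝒮 𝒮).card + (touched 𝒮 𝒮).card) - 1) := by
          rw [← Finset.mul_sum, hsum]
      _ ≤ (4 * s ^ (N + N)) * ((1 + 2 * w) ^ m - 1) :=
          mul_le_mul_of_nonneg_left (sub_le_sub_right (pow_le_pow_right₀ (by linarith) hc) _)
            (by positivity)
      _ = _ := by ring
  rw [abs_le] at hrest ⊢
  have h1 : 0 ≤ s ^ (N + N) * ((1 + lam / (q * (1 - q))) ^ m - 1) :=
    mul_nonneg (by positivity) (sub_nonneg.2 (one_le_pow₀ hr))
  constructor <;> nlinarith [hrest.1, hrest.2]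

end Gram

/-! ### Schur test and near-orthonormality -/

section Schur

/-- Weighted Schur test. -/
lemma abs_sum_mul_mul_le {α : Type*} (s : Finset α) (K : α → α → ℝ) (W a : α → ℝ) {δ : ℝ}
    (hK : ∀ i j, K i j = K j i) (hW : ∀ i ∈ s, 0 < W i)
    (h : ∀ i ∈ s, ∑ j ∈ s, |K i j| * W j ≤ δ * W i) :
    |∑ i ∈ s, ∑ j ∈ s, a i * a j * K i j| ≤ δ * ∑ i ∈ s, a i ^ 2 := by
  have h1 : ∀ i ∈ s, ∀ j ∈ s, |a i * a j * K i j|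
      ≤ (a i ^ 2 / W i * (|K i j| * W j)) / 2 + (a j ^ 2 / W j * (|K j i| * W i)) / 2 := by
    intro i hi j hj
    have hi' := hW i hi
    have hj' := hW j hj
    rw [abs_mul, abs_mul, hK j i]
    have h2 : |a i| * |a j| ≤ (a i ^ 2 / W i * W j) / 2 + (a j ^ 2 / W j * W i) / 2 := by
      rw [← sq_abs (a i), ← sq_abs (a j)]
      have h3 : (|a i| ^ 2 / W i * W j) / 2 + (|a j| ^ 2 / W j * W i) / 2 - |a i| * |a j|
          = (|a i| * W j - |a j| * W i) ^ 2 / (2 * (W i * W j)) := by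
        field_simp
        ring
      have h4 : 0 ≤ (|a i| * W j - |a j| * W i) ^ 2 / (2 * (W i * W j)) := by positivity
      linarith
    calc |a i| * |a j| * |K i j|
        ≤ ((a i ^ 2 / W i * W j) / 2 + (a j ^ 2 / W j * W i) / 2) * |K i j| :=
          mul_le_mul_of_nonneg_right h2 (abs_nonneg _)
      _ = _ := by ring
  have h5 : ∑ i ∈ s, ∑ j ∈ s, (a i ^ 2 / W i * (|K i j| * W j)) ≤ δ * ∑ i ∈ s, a i ^ 2 := by
    rw [Finset.mul_sum]
    refine Finset.sum_le_sum fun i hi => ?_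
    rw [← Finset.mul_sum]
    have hi' := hW i hi
    calc a i ^ 2 / W i * ∑ j ∈ s, |K i j| * W j ≤ a i ^ 2 / W i * (δ * W i) :=
          mul_le_mul_of_nonneg_left (h i hi) (by positivity)
      _ = _ := by field_simp
  calc |∑ i ∈ s, ∑ j ∈ s, a i * a j * K i j| ≤ ∑ i ∈ s, ∑ j ∈ s, |a i * a j * K i j| :=
        (Finset.abs_sum_le_sum_abs _ _).trans
          (Finset.sum_le_sum fun i _ => Finset.abs_sum_le_sum_abs _ _)
    _ ≤ ∑ i ∈ s, ∑ j ∈ s, ((a i ^ 2 / W i * (|K i j| * W j)) / 2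
          + (a j ^ 2 / W j * (|K j i| * W i)) / 2) :=
        Finset.sum_le_sum fun i hi => Finset.sum_le_sum fun j hj => h1 i hi j hj
    _ = (∑ i ∈ s, ∑ j ∈ s, (a i ^ 2 / W i * (|K i j| * W j))) / 2
          + (∑ j ∈ s, ∑ i ∈ s, (a j ^ 2 / W j * (|K j i| * W i))) / 2 := by
        simp only [Finset.sum_add_distrib, Finset.sum_div]
        rw [Finset.sum_comm (f := fun i j => a j ^ 2 / W j * (|K j i| * W i) / 2)]
    _ ≤ _ := by linarith

variable {n : ℕ}

/-- The edges with both endpoints in `A`. -/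
def pairsIn (A : Finset (Fin n)) : Finset (Pair n) :=
  Finset.univ.filter fun e => e.1 ∈ A.sym2

lemma card_pairsIn_le (A : Finset (Fin n)) : (pairsIn A).card ≤ A.card ^ 2 := by
  have h1 : (pairsIn A).card ≤ A.sym2.card := by
    rw [← Finset.card_map (Function.Embedding.subtype _)]
    refine Finset.card_le_card fun e he => ?_
    obtain ⟨f, hf, rfl⟩ := Finset.mem_map.1 he
    exact (Finset.mem_filter.1 hf).2
  refine h1.trans ?_
  rw [Finset.card_sym2, Nat.choose_two_right, Nat.add_sub_cancel]
  refine Nat.div_le_of_le_mul ?_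
  rcases Nat.eq_zero_or_pos A.card with h | h
  · simp [h]
  · nlinarith

lemma subset_pairsIn {F : Finset (Pair n)} {A : Finset (Fin n)} (h : verts F ⊆ A) :
    F ⊆ pairsIn A := fun e he =>
  Finset.mem_filter.2 ⟨Finset.mem_univ _, Finset.mem_sym2_iff.2 fun _ hv =>
    h (mem_verts.2 ⟨e, he, hv⟩)⟩

lemma sum_powerset_inv_le (hn : 0 < n) :
    ∑ R ∈ (Finset.univ : Finset (Fin n)).powerset, (1 / n : ℝ) ^ R.card ≤ 3 := by
  rw [sum_powerset_pow, Finset.card_univ, Fintype.card_fin]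
  have hn' : (0 : ℝ) < n := by exact_mod_cast hn
  have h1 : (1 + 1 / n : ℝ) ≤ Real.exp (1 / n) := by
    rw [add_comm]; exact Real.add_one_le_exp _
  calc (1 + 1 / n : ℝ) ^ n ≤ Real.exp (1 / n) ^ n := pow_le_pow_left₀ (by positivity) h1 _
    _ = Real.exp 1 := by
        rw [← Real.exp_nat_mul]
        congr 1
        field_simp
    _ ≤ 3 := by linarith [Real.exp_one_lt_d9]

/-- Sum over the nonempty sets of edges `F`, with a price `w` for each edge and `1 / n` for each
vertex outside `W`: the free choice of these vertices is paid by the price. -/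
lemma sum_edgeSets_le (hn : 0 < n) {m : ℕ} {w : ℝ} (hw : 0 ≤ w) {W : Finset (Fin n)}
    (hW : W.card ≤ m) (ℱ : Finset (Finset (Pair n))) (hne : ∀ F ∈ ℱ, F.Nonempty)
    (hF : ∀ F ∈ ℱ, (verts F).card ≤ m) :
    ∑ F ∈ ℱ, w ^ F.card * (1 / n : ℝ) ^ (verts F \ W).card
      ≤ 3 * ((1 + w) ^ (4 * m ^ 2) - 1) := by
  have hB : 0 ≤ (1 + w) ^ (4 * m ^ 2) - 1 := sub_nonneg.2 (one_le_pow₀ (by linarith))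
  have hfib : ∀ R ∈ (Finset.univ : Finset (Fin n)).powerset,
      ∑ F ∈ ℱ.filter (fun F => verts F \ W = R), w ^ F.card * (1 / n : ℝ) ^ (verts F \ W).card
      ≤ (1 / n : ℝ) ^ R.card * ((1 + w) ^ (4 * m ^ 2) - 1) := by
    intro R _
    by_cases hR : R.card ≤ m
    · have hsub : ℱ.filter (fun F => verts F \ W = R) ⊆ (pairsIn (W ∪ R)).powerset.erase ∅ := by
        intro F hFm
        obtain ⟨hFℱ, hFR⟩ := Finset.mem_filter.1 hFm
        refine Finset.mem_erase.2 ⟨(hne F hFℱ).ne_empty, Finset.mem_powerset.2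
          (subset_pairsIn fun v hv => ?_)⟩
        by_cases hvW : v ∈ W
        · exact Finset.mem_union_left _ hvW
        · exact Finset.mem_union_right _ (hFR ▸ Finset.mem_sdiff.2 ⟨hv, hvW⟩)
      have hcard : (pairsIn (W ∪ R)).card ≤ 4 * m ^ 2 := by
        refine (card_pairsIn_le _).trans ?_
        have := (Finset.card_union_le W R).trans (add_le_add hW hR)
        calc (W ∪ R).card ^ 2 ≤ (m + m) ^ 2 := Nat.pow_le_pow_left this 2
          _ = 4 * m ^ 2 := by ring
      calc _ = (1 / n : ℝ) ^ R.card * ∑ F ∈ ℱ.filter (fun F => verts F \ W = R), w ^ F.card := by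
            rw [Finset.mul_sum]
            refine Finset.sum_congr rfl fun F hFm => ?_
            rw [(Finset.mem_filter.1 hFm).2]
            ring
        _ ≤ (1 / n : ℝ) ^ R.card * ∑ F ∈ (pairsIn (W ∪ R)).powerset.erase ∅, w ^ F.card :=
            mul_le_mul_of_nonneg_left (Finset.sum_le_sum_of_subset_of_nonneg hsub
              fun _ _ _ => by positivity) (by positivity)
        _ = (1 / n : ℝ) ^ R.card * ((1 + w) ^ (pairsIn (W ∪ R)).card - 1) := by
            rw [← sum_powerset_pow, ← Finset.add_sum_erase _ _ (Finset.empty_mem_powerset _)]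
            simp
        _ ≤ _ := mul_le_mul_of_nonneg_left (sub_le_sub_right
            (pow_le_pow_right₀ (by linarith) hcard) _) (by positivity)
    · rw [Finset.filter_false_of_mem, Finset.sum_empty]
      · positivity
      · intro F hFℱ hFR
        exact hR (hFR ▸ (Finset.card_le_card Finset.sdiff_subset).trans (hF F hFℱ))
  rw [← Finset.sum_fiberwise_of_maps_to (g := fun F => verts F \ W)
    (t := (Finset.univ : Finset (Fin n)).powerset) (fun F _ => Finset.mem_powerset.2
      (Finset.subset_univ _))]
  refine (Finset.sum_le_sum hfib).trans ?_
  rw [← Finset.sum_mul]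
  exact mul_le_mul_of_nonneg_right (sum_powerset_inv_le hn) hB

lemma verts_symmDiff_sdiff (A B : Finset (Pair n)) :
    verts (symmDiff A B) \ verts A = verts B \ verts A := by
  ext v
  simp only [Finset.mem_sdiff, mem_verts, Finset.mem_symmDiff]
  constructor
  · rintro ⟨⟨e, h | h, hv⟩, hn⟩
    · exact absurd ⟨e, h.1, hv⟩ hn
    · exact ⟨⟨e, h.1, hv⟩, hn⟩
  · rintro ⟨⟨e, h, hv⟩, hn⟩
    exact ⟨⟨e, Or.inr ⟨h, fun hA => hn ⟨e, hA, hv⟩⟩, hv⟩, hn⟩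

/-- The corrected monomials, normalized by the standard deviation of the edges, form a nearly
orthonormal family. -/
theorem near_orthonormal_corrected [Nonempty (Fin n)] {k m D : ℕ} {lam q y w : ℝ} (hk : 1 ≤ k)
    (M : Planted) (S : Sampling) (hlam : 0 ≤ lam) (hql : lam ≤ 1 - q)
    (h : Regime n m q lam (2 * k / n) y) (hw0 : 0 ≤ w)
    (hw1 : w ≤ 1) (hw : 3 * m ^ 2 * y ≤ w ^ 2) (hw2 : (1 + 2 * w) ^ m ≤ 2) (hD : 4 * D ≤ m)
    (𝒦 : Finset (Finset (Finset (Pair n)))) (h𝒦 : ∀ 𝒮 ∈ 𝒦, IsConfig 𝒮 ∧ (edges 𝒮).card ≤ D)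
    (a : Finset (Finset (Pair n)) → ℝ) :
    |∫ y, (∑ 𝒮 ∈ 𝒦, a 𝒮 * (corrected S q (pairTheta M k lam) 𝒮 y
        / √(q * (1 - q)) ^ (edges 𝒮).card)) ^ 2 ∂(obsLaw M S n k lam q) - ∑ 𝒮 ∈ 𝒦, a 𝒮 ^ 2|
      ≤ (((1 + lam / (q * (1 - q))) ^ m - 1) + 4 * ((1 + 2 * w) ^ m - 1)
          + 24 * ((1 + w) ^ (4 * m ^ 2) - 1)) * ∑ 𝒮 ∈ 𝒦, a 𝒮 ^ 2 := by
  classical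
  have hq := h.q_pos
  set θ := pairTheta (n := n) M k lam with hθdef
  have hθ : EdgeWeight lam (2 * k / n) θ := edgeWeight_pairTheta hk M hlam
  have hn : 0 < n := Fin.pos (Classical.arbitrary (Fin n))
  have hn' : (0 : ℝ) < n := by exact_mod_cast hn
  set s := √(q * (1 - q)) with hs
  have hs0 : 0 < s := Real.sqrt_pos.2 h.var_pos
  set φ : Finset (Finset (Pair n)) → Obs n → ℝ := fun 𝒮 y =>
    corrected S q θ 𝒮 y / s ^ (edges 𝒮).card with hφ
  set μ := obsLaw M S n k lam q with hμ
  set K : Finset (Finset (Pair n)) → Finset (Finset (Pair n)) → ℝ := fun 𝒮 𝒯 =>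
    (∫ y, φ 𝒮 y * φ 𝒯 y ∂μ) - if 𝒮 = 𝒯 then 1 else 0 with hK
  have hexp : (∫ y, (∑ 𝒮 ∈ 𝒦, a 𝒮 * φ 𝒮 y) ^ 2 ∂μ) - ∑ 𝒮 ∈ 𝒦, a 𝒮 ^ 2
      = ∑ 𝒮 ∈ 𝒦, ∑ 𝒯 ∈ 𝒦, a 𝒮 * a 𝒯 * K 𝒮 𝒯 := by
    have h1 : ∀ y, (∑ 𝒮 ∈ 𝒦, a 𝒮 * φ 𝒮 y) ^ 2
        = ∑ 𝒮 ∈ 𝒦, ∑ 𝒯 ∈ 𝒦, a 𝒮 * a 𝒯 * (φ 𝒮 y * φ 𝒯 y) := fun y => by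
      rw [sq, Finset.sum_mul_sum]
      exact Finset.sum_congr rfl fun _ _ => Finset.sum_congr rfl fun _ _ => by ring
    simp only [h1]
    rw [integral_finsetSum _ fun _ _ => .of_finite, ← Finset.sum_sub_distrib]
    refine Finset.sum_congr rfl fun 𝒮 h𝒮 => ?_
    rw [integral_finsetSum _ fun _ _ => .of_finite]
    simp only [hK, mul_sub, Finset.sum_sub_distrib, integral_const_mul, mul_ite, mul_one,
      mul_zero, Finset.sum_ite_eq, h𝒮, if_true]
    ring
  have hgram : ∀ 𝒮 𝒯, ∫ y, φ 𝒮 y * φ 𝒯 y ∂μ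
      = (∫ y, corrected S q θ 𝒮 y * corrected S q θ 𝒯 y ∂μ)
        / s ^ ((edges 𝒮).card + (edges 𝒯).card) := by
    intro 𝒮 𝒯
    rw [← integral_div]
    congr 1
    ext y
    rw [hφ, pow_add]
    exact div_mul_div_comm _ _ _ _
  have hcards : ∀ 𝒮 ∈ 𝒦, ∀ 𝒯 ∈ 𝒦, 2 * (edges 𝒮).card + 2 * (edges 𝒯).card ≤ m := by
    intro 𝒮 h𝒮 𝒯 h𝒯
    have h1 := (h𝒦 𝒮 h𝒮).2
    have h2 := (h𝒦 𝒯 h𝒯).2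
    omega
  have hdiag : ∀ 𝒮 ∈ 𝒦, |K 𝒮 𝒮|
      ≤ ((1 + lam / (q * (1 - q))) ^ m - 1) + 4 * ((1 + 2 * w) ^ m - 1) := by
    intro 𝒮 h𝒮
    have h1 := abs_sum_overlapTerm_self_sub_le h hθ S hw0 hw1 hw (h𝒦 𝒮 h𝒮).1
      (hcards 𝒮 h𝒮 𝒮 h𝒮)
    rw [← integral_corrected_mul hk M S hlam hq.le hql (h𝒦 𝒮 h𝒮).1 (h𝒦 𝒮 h𝒮).1, ← hs] at h1
    have h2 : 0 < s ^ ((edges 𝒮).card + (edges 𝒮).card) := by positivity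
    simp only [hK, if_true]
    rw [hgram, div_sub_one h2.ne', abs_div, abs_of_pos h2, div_le_iff₀ h2, mul_comm]
    exact h1
  have hoff : ∀ 𝒮 ∈ 𝒦, ∀ 𝒯 ∈ 𝒦, 𝒮 ≠ 𝒯 → |K 𝒮 𝒯|
      ≤ 8 * ((1 / √n) ^ (unmatched 𝒮 𝒯).card * w ^ (symmDiff (edges 𝒮) (edges 𝒯)).card) := by
    intro 𝒮 h𝒮 𝒯 h𝒯 hne
    have h1 := abs_sum_overlapTerm_le h hθ S hw0 hw1 hw hw2 (h𝒦 𝒮 h𝒮).1 (h𝒦 𝒯 h𝒯).1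
      (hcards 𝒮 h𝒮 𝒯 h𝒯)
    rw [← integral_corrected_mul hk M S hlam hq.le hql (h𝒦 𝒮 h𝒮).1 (h𝒦 𝒯 h𝒯).1, ← hs] at h1
    have h2 : 0 < s ^ ((edges 𝒮).card + (edges 𝒯).card) := by positivity
    simp only [hK, if_neg hne, sub_zero]
    rw [hgram, abs_div, abs_of_pos h2, div_le_iff₀ h2, mul_comm]
    exact h1
  rw [hexp]
  -- The weights balance the number of graphs `𝒯` with many vertices outside `𝒮`.
  refine abs_sum_mul_mul_le 𝒦 K (fun 𝒮 => (1 / √n) ^ (verts (edges 𝒮)).card) a ?_ ?_ ?_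
  · intro 𝒮 𝒯
    simp only [hK]
    congr 1
    · congr 1; ext y; ring
    · exact if_congr eq_comm rfl rfl
  · intro 𝒮 _
    positivity
  · intro 𝒮 h𝒮
    rw [← Finset.add_sum_erase _ _ h𝒮, add_mul]
    refine add_le_add (mul_le_mul_of_nonneg_right (hdiag 𝒮 h𝒮) (by positivity)) ?_
    have hterm : ∀ 𝒯 ∈ 𝒦.erase 𝒮, |K 𝒮 𝒯| * (1 / √n) ^ (verts (edges 𝒯)).card
        ≤ 8 * (1 / √n) ^ (verts (edges 𝒮)).card * (w ^ (symmDiff (edges 𝒮) (edges 𝒯)).card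
          * (1 / n : ℝ) ^ (verts (symmDiff (edges 𝒮) (edges 𝒯)) \ verts (edges 𝒮)).card) := by
      intro 𝒯 h𝒯
      obtain ⟨hne, h𝒯⟩ := Finset.mem_erase.1 h𝒯
      have h1 : (unmatched 𝒮 𝒯).card + (verts (edges 𝒯)).card
          = (verts (edges 𝒮)).card + 2 * (verts (edges 𝒯) \ verts (edges 𝒮)).card := by
        have e1 : (unmatched 𝒮 𝒯).card = (verts (edges 𝒮) \ verts (edges 𝒯)).card
            + (verts (edges 𝒯) \ verts (edges 𝒮)).card := by
          rw [unmatched, symmDiff_def, Finset.sup_eq_union,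
            Finset.card_union_of_disjoint disjoint_sdiff_sdiff]
        have e2 := Finset.card_sdiff_add_card_inter (verts (edges 𝒮)) (verts (edges 𝒯))
        have e3 := Finset.card_sdiff_add_card_inter (verts (edges 𝒯)) (verts (edges 𝒮))
        rw [Finset.inter_comm] at e3
        omega
      have h2 : (1 / √n : ℝ) ^ 2 = 1 / n := by
        rw [div_pow, one_pow, Real.sq_sqrt hn'.le]
      calc _ ≤ 8 * ((1 / √n) ^ (unmatched 𝒮 𝒯).card *
            w ^ (symmDiff (edges 𝒮) (edges 𝒯)).card) * (1 / √n) ^ (verts (edges 𝒯)).card :=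
            mul_le_mul_of_nonneg_right (hoff 𝒮 h𝒮 𝒯 h𝒯 hne.symm) (by positivity)
        _ = 8 * w ^ (symmDiff (edges 𝒮) (edges 𝒯)).card *
            (1 / √n) ^ ((unmatched 𝒮 𝒯).card + (verts (edges 𝒯)).card) := by
            rw [pow_add]; ring
        _ = _ := by
            rw [h1, pow_add, pow_mul, h2, verts_symmDiff_sdiff]
            ring
    refine (Finset.sum_le_sum hterm).trans ?_
    rw [← Finset.mul_sum]
    -- A labelled graph `𝒯` is determined by its symmetric difference with `𝒮`.
    have hinj : Set.InjOn (fun 𝒯 => symmDiff (edges 𝒮) (edges 𝒯)) (𝒦.erase 𝒮 : Set _) := by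
      intro 𝒯 h𝒯 𝒯' h𝒯' heq
      exact (h𝒦 𝒯 (Finset.mem_of_mem_erase h𝒯)).1.eq_of_edges_eq
        (h𝒦 𝒯' (Finset.mem_of_mem_erase h𝒯')).1 (symmDiff_right_injective _ heq)
    have hsum := sum_edgeSets_le hn (m := m) hw0 (W := verts (edges 𝒮)) ?_
      ((𝒦.erase 𝒮).image fun 𝒯 => symmDiff (edges 𝒮) (edges 𝒯)) ?_ ?_
    · rw [Finset.sum_image hinj] at hsum
      calc _ ≤ 8 * (1 / √n) ^ (verts (edges 𝒮)).card * (3 * ((1 + w) ^ (4 * m ^ 2) - 1)) :=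
            mul_le_mul_of_nonneg_left hsum (by positivity)
        _ = _ := by ring
    · have := card_verts_le (edges 𝒮)
      have := (h𝒦 𝒮 h𝒮).2
      omega
    · intro F hF
      obtain ⟨𝒯, h𝒯, rfl⟩ := Finset.mem_image.1 hF
      obtain ⟨hne, h𝒯⟩ := Finset.mem_erase.1 h𝒯
      rw [Finset.nonempty_iff_ne_empty]
      intro hemp
      exact hne ((h𝒦 𝒯 h𝒯).1.eq_of_edges_eq (h𝒦 𝒮 h𝒮).1 (symmDiff_eq_bot.1 hemp).symm)
    · intro F hF
      obtain ⟨𝒯, h𝒯, rfl⟩ := Finset.mem_image.1 hF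
      have h1 := card_verts_le (symmDiff (edges 𝒮) (edges 𝒯))
      have h2 := card_symmDiff_add (edges 𝒮) (edges 𝒯)
      have h3 := hcards 𝒮 h𝒮 𝒯 (Finset.mem_of_mem_erase h𝒯)
      omega

end Schur

/-! ### Images of templates -/

section Templates

lemma imagePair_injective {V : Type} {n : ℕ} (G : SimpleGraph V) (p : V ↪ Fin n) :
    Function.Injective (imagePair G p) := by
  intro e e' h
  exact Subtype.ext (Sym2.map.injective p.injective (congrArg Subtype.val h))

variable {V W : Type} [Fintype V] [Fintype W] {n : ℕ}

open Classical in
/-- The set of edges of the image of a graph by a labeling of its vertices. -/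
noncomputable def imgEdges (G : SimpleGraph V) (p : V ↪ Fin n) : Finset (Pair n) :=
  Finset.univ.image (imagePair G p)

lemma monomial_eq_edgeMonomial (q : ℝ) (G : SimpleGraph V) (p : V ↪ Fin n) (y : Obs n) :
    monomial q G p y = edgeMonomial q (imgEdges G p) y := by
  classical
  rw [monomial, edgeMonomial, imgEdges, Finset.prod_image (imagePair_injective G p).injOn]

lemma mem_imgEdges {G : SimpleGraph V} {p : V ↪ Fin n} {f : Pair n} :
    f ∈ imgEdges G p ↔ ∃ u v, G.Adj u v ∧ f.1 = s(p u, p v) := by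
  classical
  simp only [imgEdges, Finset.mem_image, Finset.mem_univ, true_and]
  constructor
  · rintro ⟨⟨e, he⟩, rfl⟩
    induction e using Sym2.ind with
    | _ u v => exact ⟨u, v, he, rfl⟩
  · rintro ⟨u, v, h, hf⟩
    exact ⟨⟨s(u, v), h⟩, Subtype.ext hf.symm⟩

lemma card_imgEdges (G : SimpleGraph V) (p : V ↪ Fin n) :
    (imgEdges G p).card = G.edgeSet.ncard := by
  classical
  rw [imgEdges, Finset.card_image_of_injective _ (imagePair_injective G p), Finset.card_univ,
    ← Nat.card_eq_fintype_card]
  rfl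

lemma mem_verts_imgEdges {G : SimpleGraph V} {p : V ↪ Fin n} {x : Fin n} :
    x ∈ verts (imgEdges G p) ↔ ∃ u v, G.Adj u v ∧ p u = x := by
  simp only [mem_verts, mem_imgEdges]
  constructor
  · rintro ⟨f, ⟨u, v, h, hf⟩, hx⟩
    rw [hf, Sym2.mem_iff] at hx
    rcases hx with rfl | rfl
    · exact ⟨u, v, h, rfl⟩
    · exact ⟨v, u, h.symm, rfl⟩
  · rintro ⟨u, v, h, rfl⟩
    have : ¬ (s(p u, p v)).IsDiag := by
      rw [Sym2.mk_isDiag_iff]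
      exact fun he => h.ne (p.injective he)
    exact ⟨⟨s(p u, p v), this⟩, ⟨u, v, h, rfl⟩, Sym2.mem_mk_left _ _⟩

lemma adj_iff_exists_mem_imgEdges {G : SimpleGraph V} {p : V ↪ Fin n} {u v : V} :
    G.Adj u v ↔ ∃ f ∈ imgEdges G p, f.1 = s(p u, p v) := by
  constructor
  · intro h
    have : ¬ (s(p u, p v)).IsDiag := by
      rw [Sym2.mk_isDiag_iff]
      exact fun he => h.ne (p.injective he)
    exact ⟨⟨s(p u, p v), this⟩, mem_imgEdges.2 ⟨u, v, h, rfl⟩, rfl⟩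
  · rintro ⟨f, hf, hfe⟩
    obtain ⟨a, b, h, hab⟩ := mem_imgEdges.1 hf
    rw [hfe, Sym2.eq_iff] at hab
    rcases hab with ⟨h1, h2⟩ | ⟨h1, h2⟩
    · rwa [p.injective h1, p.injective h2]
    · rw [p.injective h1, p.injective h2]
      exact h.symm

/-- Two graphs without isolated vertices and with the same image are isomorphic. -/
lemma exists_iso_of_imgEdges_eq {G : SimpleGraph V} {H : SimpleGraph W}
    (hG : ∀ v, ¬ G.IsIsolated v) (hH : ∀ v, ¬ H.IsIsolated v) {p : V ↪ Fin n} {r : W ↪ Fin n}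
    (h : imgEdges G p = imgEdges H r) : ∃ φ : G ≃g H, ∀ v, r (φ v) = p v := by
  have key : ∀ {V W : Type} [Fintype V] [Fintype W] {G : SimpleGraph V} {H : SimpleGraph W}
      {p : V ↪ Fin n} {r : W ↪ Fin n}, (∀ v, ¬ G.IsIsolated v) → imgEdges G p = imgEdges H r →
      ∀ v, ∃ w, r w = p v := by
    intro V W _ _ G H p r hG h v
    obtain ⟨u, hu⟩ := not_forall_not.1 (hG v)
    have h1 : p v ∈ verts (imgEdges H r) := h ▸ mem_verts_imgEdges.2 ⟨v, u, hu, rfl⟩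
    obtain ⟨w, -, -, hw⟩ := mem_verts_imgEdges.1 h1
    exact ⟨w, hw⟩
  choose f hf using key hG h
  choose g hg using key hH h.symm
  refine ⟨⟨⟨f, g, fun v => p.injective ?_, fun w => r.injective ?_⟩, ?_⟩, hf⟩
  · rw [hg, hf]
  · rw [hf, hg]
  · intro u v
    change H.Adj (f u) (f v) ↔ G.Adj u v
    rw [adj_iff_exists_mem_imgEdges (G := H) (p := r),
      adj_iff_exists_mem_imgEdges (G := G) (p := p), hf, hf, h]

lemma imgEdges_iso {G : SimpleGraph V} (φ : G ≃g G) (p : V ↪ Fin n) :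
    imgEdges G (φ.toEquiv.toEmbedding.trans p) = imgEdges G p := by
  ext f
  rw [mem_imgEdges, mem_imgEdges]
  constructor
  · rintro ⟨u, v, h, hf⟩
    exact ⟨φ u, φ v, φ.map_adj_iff.2 h, hf⟩
  · rintro ⟨u, v, h, hf⟩
    refine ⟨φ.symm u, φ.symm v, φ.symm.map_adj_iff.2 h, ?_⟩
    rw [hf]
    simp

open Classical in
/-- The labelings of a graph without isolated vertices with a given image are the composites of one
of them with the automorphisms of the graph. -/
lemma card_filter_imgEdges_eq {G : SimpleGraph V} (hG : ∀ v, ¬ G.IsIsolated v) (p : V ↪ Fin n) :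
    (Finset.univ.filter fun r : V ↪ Fin n => imgEdges G r = imgEdges G p).card
      = Nat.card (G ≃g G) := by
  rw [← Fintype.card_subtype, ← Nat.card_eq_fintype_card]
  symm
  refine Nat.card_congr (Equiv.ofBijective
    (fun φ : G ≃g G => ⟨φ.toEquiv.toEmbedding.trans p, imgEdges_iso φ p⟩) ⟨?_, ?_⟩)
  · intro φ ψ h
    ext v
    have h1 := congrArg (fun x : {r : V ↪ Fin n // imgEdges G r = imgEdges G p} => x.1 v) h
    exact p.injective h1
  · rintro ⟨r, hr⟩
    obtain ⟨φ, hφ⟩ := exists_iso_of_imgEdges_eq hG hG hr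
    refine ⟨φ, Subtype.ext (Function.Embedding.ext fun v => hφ v)⟩

/-- The edges of the image of a connected component. -/
noncomputable def componentEdges {G : SimpleGraph V} (p : V ↪ Fin n) (C : G.ConnectedComponent) :
    Finset (Pair n) :=
  open Classical in imgEdges C.toSimpleGraph ((Function.Embedding.subtype (· ∈ C)).trans p)

lemma mem_componentEdges {G : SimpleGraph V} {p : V ↪ Fin n} {C : G.ConnectedComponent}
    {f : Pair n} : f ∈ componentEdges p C ↔
      ∃ u v, u ∈ C ∧ v ∈ C ∧ G.Adj u v ∧ f.1 = s(p u, p v) := by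
  classical
  rw [componentEdges, mem_imgEdges]
  constructor
  · rintro ⟨⟨u, hu⟩, ⟨v, hv⟩, h, hf⟩
    exact ⟨u, v, hu, hv, (C.toSimpleGraph_adj hu hv).1 h, hf⟩
  · rintro ⟨u, v, hu, hv, h, hf⟩
    exact ⟨⟨u, hu⟩, ⟨v, hv⟩, (C.toSimpleGraph_adj hu hv).2 h, hf⟩

lemma exists_mem_of_mem_verts_componentEdges {G : SimpleGraph V} {p : V ↪ Fin n}
    {C : G.ConnectedComponent} {x : Fin n} (h : x ∈ verts (componentEdges p C)) :
    ∃ u ∈ C, p u = x := by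
  obtain ⟨f, hf, hx⟩ := mem_verts.1 h
  obtain ⟨u, v, hu, hv, -, hfe⟩ := mem_componentEdges.1 hf
  rw [hfe, Sym2.mem_iff] at hx
  rcases hx with rfl | rfl
  · exact ⟨u, hu, rfl⟩
  · exact ⟨v, hv, rfl⟩

lemma isConnectedEdges_componentEdges {G : SimpleGraph V} (hG : ∀ v, ¬ G.IsIsolated v)
    (p : V ↪ Fin n) (C : G.ConnectedComponent) : IsConnectedEdges (componentEdges p C) := by
  constructor
  · obtain ⟨u, hu⟩ := C.nonempty_supp
    obtain ⟨v, hv⟩ := not_forall_not.1 (hG u)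
    have hvC : v ∈ C := SimpleGraph.ConnectedComponent.mem_supp_of_adj_mem_supp C hu hv
    obtain ⟨f, -, hf⟩ := (adj_iff_exists_mem_imgEdges (p := p)).1 hv
    exact ⟨f, mem_componentEdges.2 ⟨u, v, hu, hvC, hv, hf⟩⟩
  · rintro U ⟨x, hxU, hx⟩ ⟨y, hy, hyU⟩
    obtain ⟨a, ha, rfl⟩ := exists_mem_of_mem_verts_componentEdges hx
    obtain ⟨b, hb, rfl⟩ := exists_mem_of_mem_verts_componentEdges hy
    obtain ⟨walk⟩ := C.reachable_toSimpleGraph ha hb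
    obtain ⟨d, -, hd1, hd2⟩ := walk.exists_boundary_dart {v | p v.1 ∈ U} hxU hyU
    have hadj : G.Adj d.fst.1 d.snd.1 := (C.toSimpleGraph_adj d.fst.2 d.snd.2).1 d.adj
    obtain ⟨f, -, hf⟩ := (adj_iff_exists_mem_imgEdges (p := p)).1 hadj
    refine ⟨f, mem_componentEdges.2 ⟨_, _, d.fst.2, d.snd.2, hadj, hf⟩, p d.fst.1, hd1,
      p d.snd.1, hd2, ?_, ?_⟩ <;> simp [hf]

lemma disjoint_verts_componentEdges {G : SimpleGraph V} (p : V ↪ Fin n)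
    {C C' : G.ConnectedComponent} (h : C ≠ C') :
    Disjoint (verts (componentEdges p C)) (verts (componentEdges p C')) := by
  rw [Finset.disjoint_left]
  intro x hx hx'
  obtain ⟨u, hu, rfl⟩ := exists_mem_of_mem_verts_componentEdges hx
  obtain ⟨v, hv, huv⟩ := exists_mem_of_mem_verts_componentEdges hx'
  rw [p.injective huv] at hv
  exact h (SimpleGraph.ConnectedComponent.eq_of_common_vertex hu hv)

open Classical in
/-- The labelled graph which is the image of a graph by a labeling. -/
noncomputable def config (G : SimpleGraph V) (p : V ↪ Fin n) : Finset (Finset (Pair n)) :=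
  Finset.univ.image fun C : G.ConnectedComponent => componentEdges p C

lemma isConfig_config {G : SimpleGraph V} (hG : ∀ v, ¬ G.IsIsolated v) (p : V ↪ Fin n) :
    IsConfig (config G p) := by
  classical
  constructor
  · intro C hC
    obtain ⟨C, -, rfl⟩ := Finset.mem_image.1 hC
    exact isConnectedEdges_componentEdges hG p C
  · intro C hC C' hC' hne
    obtain ⟨C, -, rfl⟩ := Finset.mem_image.1 hC
    obtain ⟨C', -, rfl⟩ := Finset.mem_image.1 hC'
    exact disjoint_verts_componentEdges p fun h => hne (h ▸ rfl)

lemma edges_config (G : SimpleGraph V) (p : V ↪ Fin n) :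
    edges (config G p) = imgEdges G p := by
  classical
  ext f
  simp only [mem_edges, config, Finset.mem_image, Finset.mem_univ, true_and, exists_exists_eq_and,
    mem_componentEdges, mem_imgEdges]
  constructor
  · rintro ⟨C, u, v, -, -, h, hf⟩
    exact ⟨u, v, h, hf⟩
  · rintro ⟨u, v, h, hf⟩
    have hu : u ∈ G.connectedComponentMk u :=
      SimpleGraph.ConnectedComponent.connectedComponentMk_mem
    exact ⟨G.connectedComponentMk u, u, v, hu,
      SimpleGraph.ConnectedComponent.mem_supp_of_adj_mem_supp _ hu h, h, hf⟩

lemma config_eq_iff {G : SimpleGraph V} {H : SimpleGraph W} (hG : ∀ v, ¬ G.IsIsolated v)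
    (hH : ∀ v, ¬ H.IsIsolated v) {p : V ↪ Fin n} {r : W ↪ Fin n} :
    config G p = config H r ↔ imgEdges G p = imgEdges H r := by
  rw [← edges_config G p, ← edges_config H r]
  exact ⟨fun h => h ▸ rfl, (isConfig_config hG p).eq_of_edges_eq (isConfig_config hH r)⟩

lemma componentEdges_injective {G : SimpleGraph V} (hG : ∀ v, ¬ G.IsIsolated v) (p : V ↪ Fin n) :
    Function.Injective fun C : G.ConnectedComponent => componentEdges p C := by
  intro C C' h
  by_contra hne
  obtain ⟨x, hx⟩ := (isConnectedEdges_componentEdges hG p C).verts_nonempty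
  have h' : componentEdges p C = componentEdges p C' := h
  exact Finset.disjoint_left.1 (disjoint_verts_componentEdges p hne) hx (h' ▸ hx)

/-- A corrected monomial depends on the graph and its labeling through the image only. -/
lemma correctedMonomial_eq [Nonempty (Fin n)] {k : ℕ} {lam q : ℝ} (hk : 1 ≤ k) (M : Planted)
    (S : Sampling) (hlam : 0 ≤ lam) (hq : 0 ≤ q) (hql : lam ≤ 1 - q) {G : SimpleGraph V}
    (hG : ∀ v, ¬ G.IsIsolated v) (p : V ↪ Fin n) (y : Obs n) :
    correctedMonomial M S k lam q G p y = corrected S q (pairTheta M k lam) (config G p) y := by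
  classical
  rw [corrected, config, Finset.prod_image (componentEdges_injective hG p).injOn,
    correctedMonomial]
  refine Finset.prod_congr ?_ fun C _ => ?_
  · ext; simp
  · simp only [monomial_eq_edgeMonomial]
    rw [← integral_edgeMonomial hk M S hlam hq hql]
    unfold componentEdges
    congr!

end Templates

/-! ### The second moment -/

section Assembly

variable {n : ℕ}

lemma Template.order_le (G : Template) : G.order ≤ 2 * G.size := by
  have h1 : verts (imgEdges G.graph (Function.Embedding.refl (Fin G.order))) = Finset.univ := by
    refine Finset.eq_univ_of_forall fun v => ?_
    obtain ⟨u, hu⟩ := not_forall_not.1 (G.no_isolated v)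
    exact mem_verts_imgEdges.2 ⟨v, u, hu, rfl⟩
  have h2 := card_verts_le (imgEdges G.graph (Function.Embedding.refl (Fin G.order)))
  rw [h1, Finset.card_univ, Fintype.card_fin, card_imgEdges] at h2
  exact h2

lemma Template.size_pos (G : Template) : 0 < G.size := by
  have h1 := G.order_le
  have h2 := G.order_pos
  omega

/-- The number of pairs of labelings of a template which have the same image. -/
noncomputable def labelPairs (n : ℕ) (G : Template) : ℝ :=
  (n.descFactorial G.order : ℝ) * (Nat.card (G.graph ≃g G.graph) : ℝ)

lemma labelPairs_pos {G : Template} (h : G.order ≤ n) : 0 < labelPairs n G := by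
  have h1 : 0 < n.descFactorial G.order := Nat.descFactorial_pos.2 h
  have : Finite (G.graph ≃g G.graph) := Finite.of_injective
    (fun φ => (φ : Fin G.order → Fin G.order)) DFunLike.coe_injective
  have h2 : 0 < Nat.card (G.graph ≃g G.graph) := Nat.card_pos
  exact mul_pos (by exact_mod_cast h1) (by exact_mod_cast h2)

lemma sqrt_varianceProxy {q : ℝ} (hq : 0 ≤ q * (1 - q)) {G : Template} (h : G.order ≤ n) :
    √(varianceProxy n q G) = √(labelPairs n G) * √(q * (1 - q)) ^ G.size := by
  rw [show varianceProxy n q G = labelPairs n G * (q * (1 - q)) ^ G.size from rfl,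
    Real.sqrt_mul (labelPairs_pos h).le]
  congr 1
  rw [Real.sqrt_eq_iff_mul_self_eq (pow_nonneg hq _) (pow_nonneg (Real.sqrt_nonneg _) _),
    ← mul_pow, Real.mul_self_sqrt hq]

open Classical in
/-- The coefficient of a labelled graph in the expansion of `∑ G, α G * Ψ_G`. -/
noncomputable def labelledCoeff (𝒢 : Finset Template) (α : Template → ℝ)
    (𝒮 : Finset (Finset (Pair n))) : ℝ :=
  ∑ G ∈ 𝒢, ∑ p : Fin G.order ↪ Fin n,
    if config G.graph p = 𝒮 then α G / √(labelPairs n G) else 0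

open Classical in
/-- The labelled graphs which are images of templates of `𝒢`. -/
noncomputable def labelledGraphs (n : ℕ) (𝒢 : Finset Template) :
    Finset (Finset (Finset (Pair n))) :=
  𝒢.biUnion fun G => Finset.univ.image fun p : Fin G.order ↪ Fin n => config G.graph p

lemma mem_labelledGraphs {𝒢 : Finset Template} {𝒮 : Finset (Finset (Pair n))} :
    𝒮 ∈ labelledGraphs n 𝒢 ↔ ∃ G ∈ 𝒢, ∃ p : Fin G.order ↪ Fin n, config G.graph p = 𝒮 := by
  classical
  simp [labelledGraphs]

lemma sum_labelledCoeff_mul (𝒢 : Finset Template) (α : Template → ℝ)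
    (f : Finset (Finset (Pair n)) → ℝ) :
    ∑ 𝒮 ∈ labelledGraphs n 𝒢, labelledCoeff 𝒢 α 𝒮 * f 𝒮
      = ∑ G ∈ 𝒢, ∑ p : Fin G.order ↪ Fin n, α G / √(labelPairs n G) * f (config G.graph p) := by
  classical
  simp only [labelledCoeff, Finset.sum_mul]
  rw [Finset.sum_comm]
  refine Finset.sum_congr rfl fun G hG => ?_
  rw [Finset.sum_comm]
  refine Finset.sum_congr rfl fun p _ => ?_
  have hmem : config G.graph p ∈ labelledGraphs n 𝒢 := mem_labelledGraphs.2 ⟨G, hG, p, rfl⟩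
  simp only [ite_mul, zero_mul]
  rw [Finset.sum_ite_eq, if_pos hmem]

/-- A labelled graph is the image of a single template of the collection, by as many labelings as
the template has automorphisms. -/
lemma labelledCoeff_config {𝒢 : Finset Template} {D : ℕ} (h𝒢 : IsTemplateCollection D 𝒢)
    (α : Template → ℝ) {G : Template} (hG : G ∈ 𝒢) (p : Fin G.order ↪ Fin n) :
    labelledCoeff 𝒢 α (config G.graph p)
      = Nat.card (G.graph ≃g G.graph) * (α G / √(labelPairs n G)) := by
  classical
  rw [labelledCoeff, Finset.sum_eq_single_of_mem G hG]
  · rw [← Finset.sum_filter, Finset.sum_const, nsmul_eq_mul,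
      ← card_filter_imgEdges_eq G.no_isolated p]
    simp only [config_eq_iff G.no_isolated G.no_isolated]
  · intro H hH hne
    refine Finset.sum_eq_zero fun r _ => if_neg fun h => hne ?_
    obtain ⟨φ, -⟩ := exists_iso_of_imgEdges_eq H.no_isolated G.no_isolated
      ((config_eq_iff H.no_isolated G.no_isolated).1 h)
    exact h𝒢.eq_of_iso H hH G hG ⟨φ⟩

/-- The normalization of `Ψ_G` makes the passage to labelled graphs an isometry on coefficients. -/
lemma sum_labelledCoeff_sq {𝒢 : Finset Template} {D : ℕ} (h𝒢 : IsTemplateCollection D 𝒢)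
    (hn : ∀ G ∈ 𝒢, G.order ≤ n) (α : Template → ℝ) :
    ∑ 𝒮 ∈ labelledGraphs n 𝒢, labelledCoeff 𝒢 α 𝒮 ^ 2 = ∑ G ∈ 𝒢, α G ^ 2 := by
  classical
  have h1 := sum_labelledCoeff_mul (n := n) 𝒢 α (labelledCoeff 𝒢 α)
  simp only [sq]
  rw [h1]
  refine Finset.sum_congr rfl fun G hG => ?_
  have hpos := labelPairs_pos (hn G hG)
  simp only [labelledCoeff_config h𝒢 α hG, Finset.sum_const, nsmul_eq_mul, Finset.card_univ,
    Fintype.card_embedding_eq, Fintype.card_fin]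
  have h2 : √(labelPairs n G) * √(labelPairs n G) = labelPairs n G := Real.mul_self_sqrt hpos.le
  have h3 : 0 < √(labelPairs n G) := Real.sqrt_pos.2 hpos
  calc _ = α G * α G * labelPairs n G / (√(labelPairs n G) * √(labelPairs n G)) := by
        rw [labelPairs]; ring
    _ = _ := by rw [h2, mul_div_cancel_right₀ _ hpos.ne']

lemma psi_eq [Nonempty (Fin n)] {k : ℕ} {lam q : ℝ} (hk : 1 ≤ k) (M : Planted)
    (S : Sampling) (hlam : 0 ≤ lam) (hq : 0 ≤ q) (hql : lam ≤ 1 - q) {G : Template}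
    (hG : G.order ≤ n) (hv : 0 ≤ q * (1 - q)) (y : Obs n) :
    Psi M S n k lam q G y = ∑ p : Fin G.order ↪ Fin n, 1 / √(labelPairs n G) *
      (corrected S q (pairTheta M k lam) (config G.graph p) y
        / √(q * (1 - q)) ^ (edges (config G.graph p)).card) := by
  have hsize : ∀ p : Fin G.order ↪ Fin n, (edges (config G.graph p)).card = G.size := fun p => by
    rw [edges_config, card_imgEdges]; rfl
  rw [Psi, sqrt_varianceProxy hv hG, Finset.sum_div]
  refine Finset.sum_congr rfl fun p _ => ?_
  rw [hsize, correctedMonomial_eq hk M S hlam hq hql G.no_isolated]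
  rw [div_mul_div_comm, one_mul]

/-- Near-orthonormality of the family `Ψ_G`, transferred from that of the labelled graphs; the empty
labelled graph carries the constant `α₀`. -/
theorem abs_second_moment_sub_le [Nonempty (Fin n)] {k m D : ℕ} {lam q y w : ℝ} (hk : 1 ≤ k)
    (M : Planted) (S : Sampling) (hlam : 0 ≤ lam) (hql : lam ≤ 1 - q)
    (h : Regime n m q lam (2 * k / n) y) (hw0 : 0 ≤ w)
    (hw1 : w ≤ 1) (hw : 3 * m ^ 2 * y ≤ w ^ 2) (hw2 : (1 + 2 * w) ^ m ≤ 2) (hD : 4 * D ≤ m)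
    {𝒢 : Finset Template} (h𝒢 : IsTemplateCollection D 𝒢) (α₀ : ℝ) (α : Template → ℝ) :
    |∫ y, (α₀ + ∑ G ∈ 𝒢, α G * Psi M S n k lam q G y) ^ 2 ∂(obsLaw M S n k lam q)
        - (α₀ ^ 2 + ∑ G ∈ 𝒢, α G ^ 2)|
      ≤ (((1 + lam / (q * (1 - q))) ^ m - 1) + 4 * ((1 + 2 * w) ^ m - 1)
          + 24 * ((1 + w) ^ (4 * m ^ 2) - 1)) * (α₀ ^ 2 + ∑ G ∈ 𝒢, α G ^ 2) := by
  classical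
  have hn : ∀ G ∈ 𝒢, G.order ≤ n := by
    intro G hG
    have h1 := G.order_le
    have h2 := h𝒢.size_le G hG
    have h3 := h.m_sq_le
    nlinarith
  have hempty : ∅ ∉ labelledGraphs n 𝒢 := by
    rw [mem_labelledGraphs]
    rintro ⟨G, -, p, hp⟩
    have h1 := card_imgEdges G.graph p
    rw [← edges_config, hp] at h1
    have h2 : (edges (∅ : Finset (Finset (Pair n)))).card = 0 := by simp [edges]
    have h3 : 0 < G.graph.edgeSet.ncard := G.size_pos
    omega
  set a : Finset (Finset (Pair n)) → ℝ := fun 𝒮 =>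
    if 𝒮 = ∅ then α₀ else labelledCoeff 𝒢 α 𝒮 with ha
  have ha' : ∀ 𝒮 ∈ labelledGraphs n 𝒢, a 𝒮 = labelledCoeff 𝒢 α 𝒮 := by
    intro 𝒮 h𝒮
    exact if_neg (fun h : 𝒮 = ∅ => hempty (h ▸ h𝒮))
  have key := near_orthonormal_corrected hk M S hlam hql h hw0 hw1 hw hw2 hD
    (insert ∅ (labelledGraphs n 𝒢)) ?_ a
  · have hsq : ∑ 𝒮 ∈ insert ∅ (labelledGraphs n 𝒢), a 𝒮 ^ 2 = α₀ ^ 2 + ∑ G ∈ 𝒢, α G ^ 2 := by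
      rw [Finset.sum_insert hempty, ← sum_labelledCoeff_sq h𝒢 hn α]
      congr 1
      exact Finset.sum_congr rfl fun 𝒮 h𝒮 => by rw [ha' 𝒮 h𝒮]
    have hlin : ∀ y, ∑ 𝒮 ∈ insert ∅ (labelledGraphs n 𝒢), a 𝒮 *
        (corrected S q (pairTheta M k lam) 𝒮 y / √(q * (1 - q)) ^ (edges 𝒮).card)
        = α₀ + ∑ G ∈ 𝒢, α G * Psi M S n k lam q G y := by
      intro y
      rw [Finset.sum_insert hempty]
      congr 1
      · simp [ha, corrected, edges]
      · rw [Finset.sum_congr rfl fun 𝒮 h𝒮 => by rw [ha' 𝒮 h𝒮], sum_labelledCoeff_mul]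
        refine Finset.sum_congr rfl fun G hG => ?_
        rw [psi_eq hk M S hlam h.q_pos.le hql (hn G hG) h.var_pos.le, Finset.mul_sum]
        exact Finset.sum_congr rfl fun p _ => by ring
    rw [hsq] at key
    simpa only [hlin] using key
  · intro 𝒮 h𝒮
    rcases Finset.mem_insert.1 h𝒮 with rfl | h𝒮
    · exact ⟨⟨by simp, by simp⟩, by simp [edges]⟩
    · obtain ⟨G, hG, p, rfl⟩ := mem_labelledGraphs.1 h𝒮
      refine ⟨isConfig_config G.no_isolated p, ?_⟩
      rw [edges_config, card_imgEdges]
      exact h𝒢.size_le G hG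

end Assembly

/-! ### Numerical constants -/

/-- With `ε = D ^ (-50)` and `m = 4 * D`, twice the largest number of vertices of a graph with `D`
edges, the assumptions on the three ratios put the parameters in the regime `y = 3 * ε`. The bound
on `k / n` serves to make `n` large. -/
lemma regime_of_le {n k D : ℕ} {lam q ε : ℝ} (hD : 2 ≤ D) (hε : ε * (D : ℝ) ^ 50 = 1)
    (hk : 1 ≤ k) (hkn : k ≤ n) (hq0 : 0 < q) (hq : q ≤ 1 / 2) (hlam : 0 ≤ lam)
    (h1 : (k : ℝ) / n ≤ ε) (h2 : lam * k / √(n * q) ≤ ε) (h3 : lam / q ≤ ε) :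
    Regime n (4 * D) q lam (2 * k / n) (3 * ε) ∧ lam / (q * (1 - q)) ≤ 2 * ε := by
  have hD' : (2 : ℝ) ≤ D := by exact_mod_cast hD
  have hn : (0 : ℝ) < n := by exact_mod_cast (by omega : 0 < n)
  have hk' : (1 : ℝ) ≤ k := by exact_mod_cast hk
  have hDp : (0 : ℝ) < (D : ℝ) ^ 50 := by positivity
  have hε0 : 0 < ε := pos_of_mul_pos_left (by rw [hε]; exact one_pos) hDp.le
  have hv : q / 2 ≤ q * (1 - q) := by nlinarith
  have hv0 : 0 < q * (1 - q) := by nlinarith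
  have hlq : lam ≤ ε * q := (div_le_iff₀ hq0).1 h3
  have hlv : lam / (q * (1 - q)) ≤ 2 * ε := by
    rw [div_le_iff₀ hv0]; nlinarith
  have hsv : 0 < √(q * (1 - q)) := Real.sqrt_pos.2 hv0
  have hqs : q ≤ √(q * (1 - q)) := by
    refine Real.le_sqrt_of_sq_le ?_
    nlinarith
  have hmD : 4 * D * ε ≤ 1 / 4 := by
    have h4 : (2 : ℝ) ^ 49 ≤ (D : ℝ) ^ 49 := by gcongr
    have h5 : ε * D * (D : ℝ) ^ 49 = 1 := by rw [← hε]; ring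
    have h6 : 0 < ε * D := by positivity
    nlinarith
  refine ⟨⟨hq0, hq, by omega, ?_, by positivity, ?_, ?_, ?_⟩, hlv⟩
  · have h4 : (D : ℝ) ^ 50 ≤ n := by
      have h5 : (k : ℝ) ≤ ε * n := (div_le_iff₀ hn).1 h1
      calc (D : ℝ) ^ 50 ≤ (D : ℝ) ^ 50 * (ε * n) :=
            le_mul_of_one_le_right hDp.le (hk'.trans h5)
        _ = (n : ℝ) := by rw [← mul_assoc, mul_comm _ ε, hε, one_mul]
    have h5 : D ^ 50 ≤ n := by exact_mod_cast h4
    have h6 : 2 ^ 48 ≤ D ^ 48 := by gcongr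
    calc 4 * (4 * D) ^ 2 = 64 * D ^ 2 := by ring
      _ ≤ D ^ 48 * D ^ 2 := by gcongr; omega
      _ = D ^ 50 := by ring
      _ ≤ n := h5
  · nlinarith
  · have hsn : 0 < √(n : ℝ) := Real.sqrt_pos.2 hn
    have hsq : √q ≤ 3 / 2 * √(q * (1 - q)) := by
      rw [Real.sqrt_le_left (by positivity), mul_pow, Real.sq_sqrt hv0.le]
      nlinarith
    have h4 : lam * k ≤ ε * (√n * √q) := by
      rw [← Real.sqrt_mul hn.le]
      exact (div_le_iff₀ (Real.sqrt_pos.2 (by positivity))).1 h2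
    have h5 : lam * (2 * k / n) = 2 * (lam * k) / (√n * √n) := by
      rw [Real.mul_self_sqrt hn.le]; ring
    rw [h5, div_le_iff₀ (by positivity)]
    calc 2 * (lam * k) ≤ 2 * (ε * (√n * (3 / 2 * √(q * (1 - q))))) := by
          refine mul_le_mul_of_nonneg_left (h4.trans ?_) (by norm_num)
          gcongr
      _ = 3 * ε * √(q * (1 - q)) * (1 / √n) * (√n * √n) := by
          field_simp
  · have h4 : (1 + lam / (q * (1 - q))) ^ (4 * D) ≤ (1 + 2 * ε) ^ (4 * D) := by
      gcongr
    have h5 := one_add_pow_le (x := 2 * ε) (by positivity) (4 * D) (by push_cast; linarith)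
    push_cast at h5
    linarith

end LatentGraph

theorem mainTheorem3 :
    ∃ c₀ c : ℝ, 0 < c₀ ∧ 0 < c ∧
      ∀ (D : ℕ), 2 ≤ D →
      ∀ (M : LatentGraph.Planted) (S : LatentGraph.Sampling) (n k : ℕ) (lam q : ℝ),
        1 ≤ k → k ≤ n → M.Admissible n k →
        0 < q → q ≤ 1 / 2 → 0 ≤ lam → lam ≤ 1 - q →
        max (max ((k : ℝ) / n) (lam * k / √(n * q))) (lam / q) ≤ (D : ℝ) ^ (-c₀) →
      ∀ 𝒢 : Finset LatentGraph.Template, LatentGraph.IsTemplateCollection D 𝒢 →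
      ∀ (α₀ : ℝ) (α : LatentGraph.Template → ℝ),
        (1 - c * (D : ℝ) ^ (-2 : ℝ)) * (α₀ ^ 2 + ∑ G ∈ 𝒢, α G ^ 2)
            ≤ ∫ y, (α₀ + ∑ G ∈ 𝒢, α G * LatentGraph.Psi M S n k lam q G y) ^ 2
                ∂(LatentGraph.obsLaw M S n k lam q) ∧
          ∫ y, (α₀ + ∑ G ∈ 𝒢, α G * LatentGraph.Psi M S n k lam q G y) ^ 2
              ∂(LatentGraph.obsLaw M S n k lam q)
            ≤ (1 + c * (D : ℝ) ^ (-2 : ℝ)) * (α₀ ^ 2 + ∑ G ∈ 𝒢, α G ^ 2) := by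
  refine ⟨50, 10000, by norm_num, by norm_num, ?_⟩
  intro D hD M S n k lam q hk hkn _ hq0 hq hlam hql hmax 𝒢 h𝒢 α₀ α
  have hD' : (2 : ℝ) ≤ D := by exact_mod_cast hD
  have hD0 : (0 : ℝ) < D := by linarith
  have : Nonempty (Fin n) := ⟨⟨0, by omega⟩⟩
  set ε : ℝ := (D : ℝ) ^ (-50 : ℝ) with hε
  have hεD : ε * (D : ℝ) ^ 50 = 1 := by
    rw [hε, Real.rpow_neg hD0.le, show (50 : ℝ) = ((50 : ℕ) : ℝ) by norm_num, Real.rpow_natCast]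
    exact inv_mul_cancel₀ (by positivity)
  set δ : ℝ := (D : ℝ) ^ (-2 : ℝ) with hδ
  have hδD : δ * (D : ℝ) ^ 2 = 1 := by
    rw [hδ, Real.rpow_neg hD0.le, show (2 : ℝ) = ((2 : ℕ) : ℝ) by norm_num, Real.rpow_natCast]
    exact inv_mul_cancel₀ (by positivity)
  have hδ0 : 0 < δ := by positivity
  have hε0 : 0 < ε := by positivity
  obtain ⟨hmax', h3⟩ := max_le_iff.1 hmax
  obtain ⟨h1, h2⟩ := max_le_iff.1 hmax'
  obtain ⟨hreg, hlv⟩ := LatentGraph.regime_of_le hD hεD hk hkn hq0 hq hlam h1 h2 h3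
  -- Powers of `D` in terms of `δ = D ^ (-2)`.
  have hD4 : (4 : ℝ) ≤ (D : ℝ) ^ 2 := by nlinarith
  have hδ4 : δ ≤ 1 / 4 := by nlinarith
  have hε' : ε = δ ^ 25 := by
    have h5 : δ ^ 25 * (D : ℝ) ^ 50 = 1 := by
      rw [show (D : ℝ) ^ 50 = ((D : ℝ) ^ 2) ^ 25 by ring, ← mul_pow, hδD, one_pow]
    exact mul_right_cancel₀ (by positivity) (hεD.trans h5.symm)
  have hDδ : D * δ ≤ 1 / 2 := by nlinarith
  have hD2 : ∀ i : ℕ, (D : ℝ) ^ 2 * δ ^ (i + 1) = δ ^ i := fun i => by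
    rw [pow_succ]; linear_combination δ ^ i * hδD
  have hsmall : ∀ i : ℕ, δ ^ i ≤ (1 / 4) ^ i := fun i => pow_le_pow_left₀ hδ0.le hδ4 i
  have hDD : (D : ℝ) ≤ D ^ 2 := by nlinarith
  have hw : δ ^ 10 ≤ 1 := pow_le_one₀ hδ0.le (by linarith)
  have hDw : (D : ℝ) * δ ^ 10 ≤ δ ^ 9 :=
    (mul_le_mul_of_nonneg_right hDD (by positivity)).trans_eq (hD2 9)
  have hDε : (D : ℝ) * ε ≤ δ ^ 24 := by
    rw [hε']
    exact (mul_le_mul_of_nonneg_right hDD (by positivity)).trans_eq (hD2 24)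
  have hs9 : δ ^ 9 ≤ δ * (1 / 4) ^ 8 := by
    rw [pow_succ']; exact mul_le_mul_of_nonneg_left (hsmall 8) hδ0.le
  have hs24 : δ ^ 24 ≤ δ * (1 / 4) ^ 23 := by
    rw [pow_succ']; exact mul_le_mul_of_nonneg_left (hsmall 23) hδ0.le
  have hd9 := hD2 9
  norm_num at hs9 hs24 hd9
  have hpow1 : (1 + 2 * δ ^ 10) ^ (4 * D) ≤ 1 + 16 * (D * δ ^ 10) := by
    have h5 := LatentGraph.one_add_pow_le (x := 2 * δ ^ 10) (by positivity) (4 * D)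
      (by push_cast; linarith)
    push_cast at h5
    linarith
  have hpow2 : (1 + δ ^ 10) ^ (4 * (4 * D) ^ 2) ≤ 1 + 128 * δ ^ 9 := by
    have h5 := LatentGraph.one_add_pow_le (x := δ ^ 10) (by positivity) (4 * (4 * D) ^ 2)
      (by push_cast; linarith)
    push_cast at h5
    linarith
  have hpow3 : (1 + lam / (q * (1 - q))) ^ (4 * D) ≤ 1 + 16 * (D * ε) := by
    have h0 : 0 ≤ lam / (q * (1 - q)) := div_nonneg hlam hreg.var_pos.le
    have h4 : (1 + lam / (q * (1 - q))) ^ (4 * D) ≤ (1 + 2 * ε) ^ (4 * D) := by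
      gcongr
    have h5 := LatentGraph.one_add_pow_le (x := 2 * ε) (by positivity) (4 * D)
      (by push_cast; linarith)
    push_cast at h5
    linarith
  have hyw : 3 * ((4 * D : ℕ) : ℝ) ^ 2 * (3 * ε) ≤ (δ ^ 10) ^ 2 := by
    have h5 := hD2 24
    have h6 : δ ^ 24 ≤ δ ^ 20 * (1 / 4) ^ 4 := by
      rw [show δ ^ 24 = δ ^ 20 * δ ^ 4 by ring]
      exact mul_le_mul_of_nonneg_left (hsmall 4) (by positivity)
    norm_num at h6 h5
    rw [hε']
    push_cast
    calc 3 * (4 * (D : ℝ)) ^ 2 * (3 * δ ^ 25) = 144 * (D ^ 2 * δ ^ 25) := by ring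
      _ ≤ δ ^ 20 := by linarith [pow_pos hδ0 20]
      _ = (δ ^ 10) ^ 2 := by ring
  -- The price of an edge is taken to be `w = δ ^ 10 = D ^ (-20)`.
  have key := LatentGraph.abs_second_moment_sub_le hk M S hlam hql hreg (by positivity) hw hyw
    (by linarith) le_rfl h𝒢 α₀ α
  have hnorm : 0 ≤ α₀ ^ 2 + ∑ G ∈ 𝒢, α G ^ 2 := by positivity
  have key' := key.trans (mul_le_mul_of_nonneg_right (b := _) (c := 10000 * δ) (by linarith) hnorm)
  obtain ⟨hlo, hhi⟩ := abs_le.1 key'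
  constructor <;> linarith
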